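/- Let $(X,S,Y)$ be a jointly Gaussian zero-mean triple with values in $\mathbb R^{n_x}\times\mathbb R^{n_s}\times\mathbb R^{n_y}$ and $Q_Y\succ0$. For random vectors $U,V,T$ put $Q_{U,V}=\mathrm{cov}(U,V)$, $Q_{U,V|T}=\mathbf E[(U-\mathbf E(U|T))(V-\mathbf E(V|T))^{T}]$ and $Q_{U|T}=Q_{U,U|T}$. For $\Delta_X\ge 0$ let $$R_{S;Z|Y}(\Delta_X)=\inf I(S;Z|Y),\qquad R_{S;\widehat X|Y}(\Delta_X)=\inf I(S;\widehat X|Y),$$ the first infimum over all auxiliary random variables $Z$ (in any measurable space, jointly distributed with $(X,S,Y)$) with $\mathbf P_{Z|X,S,Y}=\mathbf P_{Z|S}$ for which some measurable $f$ gives $\mathbf E\|X-f(Y,Z)\|^2\le\Delta_X$; the second over all $\mathbb R^{n_x}$-valued $\widehat X$ with $\mathbf P_{\widehat X|X,S,Y}=\mathbf P_{\widehat X|S,Y}$ and $\mathbf E\|X-\widehat X\|^2\le\Delta_X$. Here $\inf\emptyset=\infty$. Consider parameters $H\in\mathbb R^{n_x\times n_s}$, $Q_W\succeq0$ and $\Sigma_\Delta$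 with $$HQ_{X,S|Y}^{T}=Q_{X|Y}-\Sigma_\Delta,\quad HQ_{X,S|Y}^{T}=Q_{X,S|Y}H^{T}\succeq0,\quad Q_W=HQ_{X,S|Y}^{T}-HQ_{S|Y}H^{T},\qquad(*)$$ and the test channel $$Z=HS+W,\qquad \widehat X=(Q_{X,Y}-HQ_{S,Y})Q_Y^{-1}Y+Z,$$ with $W\sim N(0,Q_W)$ independent of $(X,S,Y)$. (a) Every test channel satisfying $(*)$ satisfies $\Sigma_\Delta=\mathbf E[(X-\widehat X)(X-\widehat X)^{T}]$ and (i) $\mathbf P_{X|\widehat X,Y,Z}=\mathbf P_{X|\widehat X,Y}=\mathbf P_{X|\widehat X}$; (ii) $\mathbf P_{Z|X,S,Y}=\mathbf P_{Z|S}$; (iii) $I(S;Z|Y)=I(S;\widehat X|Y)$; (iv) $Q_{S|Z,Y}=Q_{S|\widehat X,Y}=Q_{S|Y}-Q_{S|Y}H^{T}Q_{\widehat X|Y}^{\dagger}HQ_{S|Y}$ and $Q_{Z|Y}=Q_{\widehat X|Y}=HQ_{S|Y}H^{T}+Q_W=Q_{X|Y}-\Sigma_\Delta$, where $\dagger$ is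 the Moore–Penrose pseudoinverse; (v) $\mathbf E(X|\widehat X,Y,Z)=\mathbf E(X|\widehat X)=\widehat X$ and $\mathbf E(X|Y)=\mathbf E(\widehat X|Y)$, almost surely. If some auxiliary variable is admissible at distortion $\Delta_X$, then some test channel of this form, with $\Sigma_\Delta\succeq0$ and $\operatorname{tr}\Sigma_\Delta\le\Delta_X$, achieves $R_{S;Z|Y}(\Delta_X)$: $Z$ (with the above $\widehat X$ as reconstruction) and $\widehat X$ are admissible in the respective problems, and $I(S;Z|Y)=R_{S;Z|Y}(\Delta_X)$. (b) For every $\Delta_X\ge0$, side information at the encoder gives no rate gain, and $$R_{S;Z|Y}(\Delta_X)=R_{S;\widehat X|Y}(\Delta_X)=\inf\tfrac12\log\frac{\det Q_{S|Y}}{\det Q_{S|\widehat X,Y}}=\inf\tfrac12\log\frac{\det Q_{\widehat X|Y}}{\det Q_W},$$ where both infima are over the triples $(H,Q_W,\Sigma_\Delta)$ with $(*)$, $\Sigma_\Delta\succeq0$, $\operatorname{tr}\Sigma_\Delta\le\Delta_X$, the first subject also to $Q_{S|Y}\succeq Q_{S|\widehat X,Y}\succeq0$ and the second to $Q_{\widehat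 X|Y}\succeq Q_W\succeq0$, and $Q_{\widehat X|Y}$, $Q_{S|\widehat X,Y}$ are given by the formulas in (iv). If the admissible set is nonempty, the test channel in (a) attains both infima. (A quotient of determinants with numerator matrix $A$ and denominator matrix $B$, $A\succeq B\succeq0$, is $\infty$ if $\operatorname{rank}B<\operatorname{rank}A$, and otherwise the quotient of the products of the nonzero eigenvalues; for nonsingular $A$ and $B$ this is $\det A/\det B$.) -/

import Mathlib

open MeasureTheory ProbabilityTheory Matrix
open scoped ENNReal

noncomputable section

namespace RemoteRDF

/-- `ℝⁿ` with the Euclidean norm. -/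
abbrev Vec (n : ℕ) : Type := EuclideanSpace ℝ (Fin n)

/-- The space of values of a source `(X, S, Y)`. -/
abbrev Src (nx ns ny : ℕ) : Type := Vec nx × Vec ns × Vec ny

section General

variable {Ω : Type*} [MeasurableSpace Ω]

/-- The σ-algebra generated by the random variable `U`. -/
abbrev sig {α : Type*} [MeasurableSpace α] (U : Ω → α) : MeasurableSpace Ω :=
  MeasurableSpace.comap U inferInstance

/-- `P_{Z|U} = P_{Z|V}` almost surely: for every event `B`, the conditional probabilities of
`Z ∈ B` given `U` and given `V` agree almost surely. -/
def CondLawEq {ζ α β : Type*} [MeasurableSpace ζ] [MeasurableSpace α] [MeasurableSpace β]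
    (μ : Measure Ω) (Z : Ω → ζ) (U : Ω → α) (V : Ω → β) : Prop :=
  ∀ B : Set ζ, MeasurableSet B → μ⟦Z ⁻¹' B | sig U⟧ =ᵐ[μ] μ⟦Z ⁻¹' B | sig V⟧

/-- The conditional mutual information `I(S; Z | Y)`: the Kullback-Leibler divergence of the
joint law of `((Y, Z), S)` from the law under which `(Y, Z)` keeps its law and, given `(Y, Z)`,
`S` is drawn from `P_{S|Y}`; that is, `D(P_{Y,Z,S} ‖ P_Y P_{Z|Y} P_{S|Y})`. -/
def condMutualInfo {n : ℕ} {υ ζ : Type*} [MeasurableSpace υ] [MeasurableSpace ζ]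
    (μ : Measure Ω) [IsFiniteMeasure μ] (S : Ω → Vec n) (Z : Ω → ζ) (Y : Ω → υ) : ℝ≥0∞ :=
  InformationTheory.klDiv (μ.map fun ω => ((Y ω, Z ω), S ω))
    ((μ.map fun ω => (Y ω, Z ω)) ⊗ₘ (condDistrib S Y μ).prodMkRight ζ)

/-- The cross-covariance matrix `Q_{U,V}`. -/
def crossCov {m n : ℕ} (μ : Measure Ω) (U : Ω → Vec m) (V : Ω → Vec n) :
    Matrix (Fin m) (Fin n) ℝ :=
  Matrix.of fun i j => cov[fun ω => U ω i, fun ω => V ω j; μ]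

/-- The conditional covariance matrix
`Q_{U,V|T} = E[(U - E[U|T]) (V - E[V|T])ᵀ]` of jointly Gaussian `(U, V, T)`. -/
def condCov {m n : ℕ} {τ : Type*} [MeasurableSpace τ] (μ : Measure Ω)
    (U : Ω → Vec m) (V : Ω → Vec n) (T : Ω → τ) : Matrix (Fin m) (Fin n) ℝ :=
  Matrix.of fun i j =>
    ∫ ω, (U ω - (μ[U | sig T]) ω) i * (V ω - (μ[V | sig T]) ω) j ∂μ

/-- The matrix `E[U Uᵀ]` of second moments. -/
def secondMoment {m : ℕ} (μ : Measure Ω) (U : Ω → Vec m) : Matrix (Fin m) (Fin m) ℝ :=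
  Matrix.of fun i j => ∫ ω, U ω i * U ω j ∂μ

/-- The mean square error `E‖X - X̂‖²`. -/
def mse {n : ℕ} (μ : Measure Ω) (X Xhat : Ω → Vec n) : ℝ≥0∞ :=
  ∫⁻ ω, ‖X ω - Xhat ω‖ₑ ^ 2 ∂μ

/-- Side information at the decoder only: `Z` is an admissible auxiliary variable at distortion
`Δ` with reconstruction `X̂ = f (Y, Z)`, i.e. `P_{Z|X,S,Y} = P_{Z|S}` and
`E‖X - f(Y, Z)‖² ≤ Δ`. -/
structure DecAdmissible {nx ns ny : ℕ} {ζ : Type*} [MeasurableSpace ζ] (μ : Measure Ω)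
    (X : Ω → Vec nx) (S : Ω → Vec ns) (Y : Ω → Vec ny) (Z : Ω → ζ)
    (f : Vec ny × ζ → Vec nx) (Δ : ℝ) : Prop where
  measurable_aux : Measurable Z
  measurable_rec : Measurable f
  markov : CondLawEq μ Z (fun ω => (X ω, S ω, Y ω)) S
  distortion : mse μ X (fun ω => f (Y ω, Z ω)) ≤ ENNReal.ofReal Δ

/-- Side information at encoder and decoder: `X̂` is an admissible reconstruction at distortion
`Δ`, i.e. `P_{X̂|X,S,Y} = P_{X̂|S,Y}` and `E‖X - X̂‖² ≤ Δ`. -/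
structure EncAdmissible {nx ns ny : ℕ} (μ : Measure Ω)
    (X : Ω → Vec nx) (S : Ω → Vec ns) (Y : Ω → Vec ny) (Xhat : Ω → Vec nx) (Δ : ℝ) : Prop where
  measurable_rec : Measurable Xhat
  markov : CondLawEq μ Xhat (fun ω => (X ω, S ω, Y ω)) (fun ω => (S ω, Y ω))
  distortion : mse μ X Xhat ≤ ENNReal.ofReal Δ

end General

section Source

variable {nx ns ny : ℕ}

/-- The coordinates of the source. -/
def srcX (v : Src nx ns ny) : Vec nx := v.1

/-- The coordinates of the source. -/
def srcS (v : Src nx ns ny) : Vec ns := v.2.1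

/-- The coordinates of the source. -/
def srcY (v : Src nx ns ny) : Vec ny := v.2.2

/-- `ρ` is the joint law of `((X, S, Y), Z)` for a source `(X, S, Y)` of law `P` and an auxiliary
variable `Z`, admissible at distortion `Δ` with side information at the decoder only. -/
def IsDecLaw (P : Measure (Src nx ns ny)) (Δ : ℝ) {ζ : Type*} [MeasurableSpace ζ]
    (ρ : ProbabilityMeasure (Src nx ns ny × ζ)) : Prop :=
  (ρ : Measure (Src nx ns ny × ζ)).map Prod.fst = P ∧
  ∃ f : Vec ny × ζ → Vec nx,
    DecAdmissible (ρ : Measure (Src nx ns ny × ζ)) (fun v => srcX v.1) (fun v => srcS v.1)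
      (fun v => srcY v.1) Prod.snd f Δ

/-- `ρ` is the joint law of `((X, S, Y), X̂)` for a source `(X, S, Y)` of law `P` and a
reconstruction `X̂`, admissible at distortion `Δ` with side information at both ends. -/
def IsEncLaw (P : Measure (Src nx ns ny)) (Δ : ℝ)
    (ρ : ProbabilityMeasure (Src nx ns ny × Vec nx)) : Prop :=
  (ρ : Measure (Src nx ns ny × Vec nx)).map Prod.fst = P ∧
  EncAdmissible (ρ : Measure (Src nx ns ny × Vec nx)) (fun v => srcX v.1) (fun v => srcS v.1)
    (fun v => srcY v.1) Prod.snd Δ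

/-- The rate distortion function `R_{S;Z|Y}(Δ)`, side information at the decoder only: the
infimum of `I(S; Z | Y)` over all admissible auxiliary variables, with values in an arbitrary
measurable space (`∞` if there are none). -/
def rdfDec (P : Measure (Src nx ns ny)) (Δ : ℝ) : ℝ≥0∞ :=
  ⨅ (ζ : Type) (_ : MeasurableSpace ζ) (ρ : ProbabilityMeasure (Src nx ns ny × ζ))
    (_ : IsDecLaw P Δ ρ),
    condMutualInfo (ρ : Measure (Src nx ns ny × ζ)) (fun v => srcS v.1) Prod.snd
      (fun v => srcY v.1)

/-- The rate distortion function `R_{S;X̂|Y}(Δ)`, side information at encoder and decoder: the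
infimum of `I(S; X̂ | Y)` over all admissible reconstructions (`∞` if there are none). -/
def rdfEnc (P : Measure (Src nx ns ny)) (Δ : ℝ) : ℝ≥0∞ :=
  ⨅ (ρ : ProbabilityMeasure (Src nx ns ny × Vec nx)) (_ : IsEncLaw P Δ ρ),
    condMutualInfo (ρ : Measure (Src nx ns ny × Vec nx)) (fun v => srcS v.1) Prod.snd
      (fun v => srcY v.1)

/-- `Q_{X,Y}` -/
def covXY (P : Measure (Src nx ns ny)) : Matrix (Fin nx) (Fin ny) ℝ := crossCov P srcX srcY

/-- `Q_{S,Y}` -/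
def covSY (P : Measure (Src nx ns ny)) : Matrix (Fin ns) (Fin ny) ℝ := crossCov P srcS srcY

/-- `Q_Y` -/
def covY (P : Measure (Src nx ns ny)) : Matrix (Fin ny) (Fin ny) ℝ := crossCov P srcY srcY

/-- `Q_{X|Y}` -/
def covXgY (P : Measure (Src nx ns ny)) : Matrix (Fin nx) (Fin nx) ℝ := condCov P srcX srcX srcY

/-- `Q_{S|Y}` -/
def covSgY (P : Measure (Src nx ns ny)) : Matrix (Fin ns) (Fin ns) ℝ := condCov P srcS srcS srcY

/-- `Q_{X,S|Y}` -/
def covXSgY (P : Measure (Src nx ns ny)) : Matrix (Fin nx) (Fin ns) ℝ := condCov P srcX srcS srcY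

/-- The constraints on the parameters `(H, Q_W)` of the test channel, with error covariance
`Σ_Δ = D`. -/
structure IsChannelParam (P : Measure (Src nx ns ny)) (H : Matrix (Fin nx) (Fin ns) ℝ)
    (QW D : Matrix (Fin nx) (Fin nx) ℝ) : Prop where
  noise_posSemidef : QW.PosSemidef
  mul_eq_sub : H * (covXSgY P)ᵀ = covXgY P - D
  mul_symm : H * (covXSgY P)ᵀ = covXSgY P * Hᵀ
  mul_posSemidef : (H * (covXSgY P)ᵀ).PosSemidef
  noise_eq : QW = H * (covXSgY P)ᵀ - H * covSgY P * Hᵀ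

/-- `(X, S, Y)` has law `P`, and `W ∈ G(0, Q_W)` is independent of `(X, S, Y)`. -/
structure IsRealization (P : Measure (Src nx ns ny)) (QW : Matrix (Fin nx) (Fin nx) ℝ)
    {Ω : Type*} [MeasurableSpace Ω] (μ : Measure Ω)
    (X : Ω → Vec nx) (S : Ω → Vec ns) (Y : Ω → Vec ny) (W : Ω → Vec nx) : Prop where
  measurable_X : Measurable X
  measurable_S : Measurable S
  measurable_Y : Measurable Y
  measurable_W : Measurable W
  law_source : μ.map (fun ω => (X ω, S ω, Y ω)) = P
  law_noise : μ.map W = multivariateGaussian 0 QW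
  indep : IndepFun W (fun ω => (X ω, S ω, Y ω)) μ

/-- The test channel `Z = H S + W`. -/
def chanZ {Ω : Type*} (H : Matrix (Fin nx) (Fin ns) ℝ) (S : Ω → Vec ns) (W : Ω → Vec nx)
    (ω : Ω) : Vec nx :=
  toEuclideanLin H (S ω) + W ω

/-- The decoder `(y, z) ↦ (Q_{X,Y} - H Q_{S,Y}) Q_Y⁻¹ y + z`. -/
def chanDec (P : Measure (Src nx ns ny)) (H : Matrix (Fin nx) (Fin ns) ℝ)
    (p : Vec ny × Vec nx) : Vec nx :=
  toEuclideanLin ((covXY P - H * covSY P) * (covY P)⁻¹) p.1 + p.2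

/-- The reconstruction `X̂ = (Q_{X,Y} - H Q_{S,Y}) Q_Y⁻¹ Y + Z`. -/
def chanX {Ω : Type*} (P : Measure (Src nx ns ny)) (H : Matrix (Fin nx) (Fin ns) ℝ)
    (S : Ω → Vec ns) (Y : Ω → Vec ny) (W : Ω → Vec nx) (ω : Ω) : Vec nx :=
  chanDec P H (Y ω, chanZ H S W ω)

end Source

section Characterization

/-- The four Penrose equations: `B` is the Moore-Penrose pseudoinverse of `A`. -/
def IsPinv {m n : ℕ} (A : Matrix (Fin m) (Fin n) ℝ) (B : Matrix (Fin n) (Fin m) ℝ) : Prop :=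
  A * B * A = A ∧ B * A * B = B ∧ (A * B)ᵀ = A * B ∧ (B * A)ᵀ = B * A

open Classical in
/-- The Moore-Penrose pseudoinverse `A†` (it always exists and is unique). -/
def pinv {m n : ℕ} (A : Matrix (Fin m) (Fin n) ℝ) : Matrix (Fin n) (Fin m) ℝ :=
  if h : ∃ B, IsPinv A B then h.choose else 0

/-- The pseudo-determinant, i.e. the product of the nonzero eigenvalues with multiplicity, of a
symmetric matrix. It is `det A` if `A` is nonsingular. -/
def pdet {n : ℕ} (A : Matrix (Fin n) (Fin n) ℝ) : ℝ :=
  (A.charpoly.roots.filter (· ≠ 0)).prod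

/-- `½ log (det A / det B)` for `A ⪰ B ⪰ 0`. If `A` is nonsingular this is the literal expression,
with value `∞` if `det B = 0`. For singular `A`, where the literal quotient is `0 / 0`, the
determinants are taken on the range of `A`; the value is then `∞` if the rank of `B` is smaller. -/
def halfLogDetRatio {n : ℕ} (A B : Matrix (Fin n) (Fin n) ℝ) : ℝ≥0∞ :=
  if A.rank = B.rank then ENNReal.ofReal (1 / 2 * Real.log (pdet A / pdet B)) else ⊤

variable {nx ns ny : ℕ}

/-- `Q_{X̂|Y} = H Q_{S|Y} Hᵀ + Q_W` -/
def covHatgY (P : Measure (Src nx ns ny)) (H : Matrix (Fin nx) (Fin ns) ℝ)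
    (QW : Matrix (Fin nx) (Fin nx) ℝ) : Matrix (Fin nx) (Fin nx) ℝ :=
  H * covSgY P * Hᵀ + QW

/-- `Q_{S|X̂,Y} = Q_{S|Y} - Q_{S|Y} Hᵀ Q_{X̂|Y}† H Q_{S|Y}` -/
def covSgHatY (P : Measure (Src nx ns ny)) (H : Matrix (Fin nx) (Fin ns) ℝ)
    (QW : Matrix (Fin nx) (Fin nx) ℝ) : Matrix (Fin ns) (Fin ns) ℝ :=
  covSgY P - covSgY P * Hᵀ * pinv (covHatgY P H QW) * H * covSgY P

/-- The infimum of `½ log (det Q_{S|Y} / det Q_{S|X̂,Y})` subject to `Σ_Δ ⪰ 0`, `tr Σ_Δ ≤ Δ`,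
`Q_{S|Y} ⪰ Q_{S|X̂,Y} ⪰ 0`. -/
def sourceCharacterization (P : Measure (Src nx ns ny)) (Δ : ℝ) : ℝ≥0∞ :=
  ⨅ (H : Matrix (Fin nx) (Fin ns) ℝ) (QW : Matrix (Fin nx) (Fin nx) ℝ)
    (D : Matrix (Fin nx) (Fin nx) ℝ)
    (_ : IsChannelParam P H QW D ∧ D.PosSemidef ∧ D.trace ≤ Δ ∧
      (covSgY P - covSgHatY P H QW).PosSemidef ∧ (covSgHatY P H QW).PosSemidef),
    halfLogDetRatio (covSgY P) (covSgHatY P H QW)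

/-- The infimum of `½ log (det Q_{X̂|Y} / det Q_W)` subject to `Σ_Δ ⪰ 0`, `tr Σ_Δ ≤ Δ`,
`Q_{X̂|Y} ⪰ Q_W ⪰ 0`. -/
def channelCharacterization (P : Measure (Src nx ns ny)) (Δ : ℝ) : ℝ≥0∞ :=
  ⨅ (H : Matrix (Fin nx) (Fin ns) ℝ) (QW : Matrix (Fin nx) (Fin nx) ℝ)
    (D : Matrix (Fin nx) (Fin nx) ℝ)
    (_ : IsChannelParam P H QW D ∧ D.PosSemidef ∧ D.trace ≤ Δ ∧
      (covHatgY P H QW - QW).PosSemidef ∧ QW.PosSemidef),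
    halfLogDetRatio (covHatgY P H QW) QW

end Characterization

section Structure

variable {nx ns ny : ℕ}

/-- The structural properties of a test channel `(Z, X̂)` with parameters `(H, Q_W)` and error
covariance `D`. -/
structure StructuralProperties (P : Measure (Src nx ns ny)) (H : Matrix (Fin nx) (Fin ns) ℝ)
    (QW D : Matrix (Fin nx) (Fin nx) ℝ)
    {Ω : Type*} [MeasurableSpace Ω] (μ : Measure Ω) [IsFiniteMeasure μ]
    (X : Ω → Vec nx) (S : Ω → Vec ns) (Y : Ω → Vec ny) (Z Xhat : Ω → Vec nx) : Prop where
  /-- `Σ_Δ = E[(X - X̂)(X - X̂)ᵀ]` -/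
  error_cov : secondMoment μ (fun ω => X ω - Xhat ω) = D
  /-- `P_{X|X̂,Y,Z} = P_{X|X̂,Y}` -/
  source_law : CondLawEq μ X (fun ω => (Xhat ω, Y ω, Z ω)) (fun ω => (Xhat ω, Y ω))
  /-- `P_{X|X̂,Y} = P_{X|X̂}` -/
  source_law_hat : CondLawEq μ X (fun ω => (Xhat ω, Y ω)) Xhat
  /-- `P_{Z|X,S,Y} = P_{Z|S}` -/
  aux_markov : CondLawEq μ Z (fun ω => (X ω, S ω, Y ω)) S
  /-- `I(S; Z | Y) = I(S; X̂ | Y)` -/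
  info_eq : condMutualInfo μ S Z Y = condMutualInfo μ S Xhat Y
  /-- `Q_{S|Z,Y} = Q_{S|X̂,Y}` -/
  cov_source_eq : condCov μ S S (fun ω => (Z ω, Y ω)) = condCov μ S S (fun ω => (Xhat ω, Y ω))
  /-- `Q_{X̂|Y} = Q_{Z|Y}` -/
  cov_hat_eq : condCov μ Xhat Xhat Y = condCov μ Z Z Y
  /-- `Q_{S|X̂,Y} = Q_{S|Y} - Q_{S|Y} Hᵀ Q_{X̂|Y}† H Q_{S|Y}` -/
  cov_source_formula : condCov μ S S (fun ω => (Xhat ω, Y ω)) = covSgHatY P H QW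
  /-- `Q_{X̂|Y} = H Q_{S|Y} Hᵀ + Q_W` -/
  cov_hat_formula : condCov μ Xhat Xhat Y = covHatgY P H QW
  /-- `Q_{X̂|Y} = Q_{X|Y} - Σ_Δ` -/
  cov_hat_sub : condCov μ Xhat Xhat Y = covXgY P - D
  /-- `E(X | X̂, Y, Z) = E(X | X̂)` -/
  condExp_eq : μ[X | sig (fun ω => (Xhat ω, Y ω, Z ω))] =ᵐ[μ] μ[X | sig Xhat]
  /-- `E(X | X̂) = X̂` -/
  condExp_hat : μ[X | sig Xhat] =ᵐ[μ] Xhat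
  /-- `E(X | Y) = E(X̂ | Y)` -/
  condExp_side : μ[X | sig Y] =ᵐ[μ] μ[Xhat | sig Y]

end Structure

end RemoteRDF

end

noncomputable section

namespace RemoteRDF

/-! ### Linear algebra: factorizations, pseudoinverses, pseudo-determinants, Schur complements. -/

section LinearAlgebra

/-! Subtracting conditional means given `Y` and whitening what is left of `S` turns every quantity
of the theorem into one compact matrix problem. Write S - E[S|Y] = B N almost surely, with E[N Nᵀ] =
1, Q_{S|Y} = B Bᵀ and B left invertible (so Q_{S|Y} may be singular), and put C = E[(X - E[X|Y])
Nᵀ]. A test channel enters only through J = H B: the constraints become J Cᵀ ⪰ 0, J Cᵀ ⪰ J Jᵀ,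
Q_{X|Y} ⪰ J Cᵀ and tr(Q_{X|Y} - J Cᵀ) ≤ Δ (`Feasible`), and the rate becomes -½ log det(1 - Jᵀ (J
Cᵀ)† J). With J Cᵀ = E Eᵀ and J = E F, the two determinant quotients are 1 / det(1 - Fᵀ F) and 1 /
det(1 - F Fᵀ), which agree by Sylvester's identity.

Converse (`IsWhitening.exists_feasible_le`). In both problems the Markov condition makes the
innovation X - E[X|Y] - C N independent of (Y, Z). Let V be the linear least squares estimate of X -
E[X|Y] from the centred reconstruction, and J = E[V Nᵀ]. Orthogonality and independence give E[V Vᵀ]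
= J Cᵀ, and the constraints on J say that certain covariance matrices are positive semidefinite and
that V does no worse than the reconstruction. Moreover I(S; Z | Y) = I(N; (Y, Z)), and by
`mutualInfo_ge` this is at least -½ log of the determinant of the error covariance of any estimate
of N from (Y, Z); the best linear estimate from V has the Schur complement above as its error
covariance. The bound is the Donsker-Varadhan inequality with a Gaussian log-density as test
function, so no entropy and no density of (Y, Z) is needed.

Achievability. For a test channel, Z and X̂ are both a linear function of Y plus the same vector H
(S - E[S|Y]) + W. The errors X - X̂ and S - E[S|X̂,Y] are Gaussian and uncorrelated with this vector
and with Y, hence independent of both. All structural properties follow, and the bound on the mutual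
information becomes an equality (`mutualInfo_eq`).

Attainment. The feasible set is compact. The Schur determinant is a minimum of continuous functions
of J, one for each linear estimator of N, hence upper semicontinuous, although the pseudoinverse is
not continuous (`exists_feasible_max`). -/

theorem exists_diagonalization {n : Type*} [Fintype n] [DecidableEq n] {A : Matrix n n ℝ}
    (hA : A.PosSemidef) :
    ∃ (U : Matrix n n ℝ) (σ : n → ℝ), Uᵀ * U = 1 ∧ U * Uᵀ = 1 ∧ (∀ i, 0 ≤ σ i) ∧
      A = U * diagonal σ * Uᵀ := by
  refine ⟨(hA.1.eigenvectorUnitary : Matrix n n ℝ), hA.1.eigenvalues, ?_, ?_,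
    hA.eigenvalues_nonneg, ?_⟩
  · have := Unitary.coe_star_mul_self hA.1.eigenvectorUnitary
    rwa [star_eq_conjTranspose, conjTranspose_eq_transpose_of_trivial] at this
  · have := Unitary.coe_mul_star_self hA.1.eigenvectorUnitary
    rwa [Unitary.coe_star, star_eq_conjTranspose, conjTranspose_eq_transpose_of_trivial] at this
  · conv_lhs => rw [hA.1.spectral_theorem]
    rw [Unitary.conjStarAlgAut_apply, star_eq_conjTranspose,
      conjTranspose_eq_transpose_of_trivial]
    rfl

theorem exists_eq_mul_transpose {n : Type*} [Fintype n] [DecidableEq n] {A : Matrix n n ℝ}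
    (hA : A.PosSemidef) : ∃ R : Matrix n n ℝ, A = R * Rᵀ := by
  obtain ⟨U, σ, -, -, hσ, rfl⟩ := exists_diagonalization hA
  refine ⟨U * diagonal fun i => √(σ i), ?_⟩
  rw [transpose_mul, diagonal_transpose, ← Matrix.mul_assoc, Matrix.mul_assoc U
    (diagonal fun i => √(σ i)),
    diagonal_mul_diagonal]
  simp only [Real.mul_self_sqrt (hσ _)]

/-- A positive semidefinite matrix factors as `B Bᵀ` with `B` left invertible. -/
theorem exists_factor {n : ℕ} {Q : Matrix (Fin n) (Fin n) ℝ} (hQ : Q.PosSemidef) :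
    ∃ (r : ℕ) (B : Matrix (Fin n) (Fin r) ℝ) (Bp : Matrix (Fin r) (Fin n) ℝ),
      Q = B * Bᵀ ∧ Bp * B = 1 ∧ (B * Bp)ᵀ = B * Bp := by
  classical
  obtain ⟨U, ev, hUU, -, hev, hsp⟩ := exists_diagonalization hQ
  -- The columns of B are the eigenvectors of the nonzero eigenvalues, scaled by the square roots of
  -- these.
  let κ := {i : Fin n // ev i ≠ 0}
  let e := (Fintype.equivFin κ).symm
  have hpos : ∀ k, 0 < ev (e k).1 := fun k => lt_of_le_of_ne (hev _) (e k).2.symm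
  refine ⟨Fintype.card κ, of fun i k => U i (e k).1 * √(ev (e k).1),
    of fun k i => (√(ev (e k).1))⁻¹ * U i (e k).1, ?_, ?_, ?_⟩
  · ext i j
    rw [hsp]
    simp only [mul_apply, transpose_apply, of_apply, diagonal_apply, mul_ite, mul_zero,
      Finset.sum_ite_eq', Finset.mem_univ, if_true]
    rw [Equiv.sum_comp e (fun k : κ => U i k.1 * √(ev k.1) * (U j k.1 * √(ev k.1))),
      ← Finset.sum_subtype (Finset.univ.filter fun i => ev i ≠ 0) (by simp)
        (fun k => U i k * √(ev k) * (U j k * √(ev k))), Finset.sum_filter]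
    refine Finset.sum_congr rfl fun k _ => ?_
    split_ifs with h
    · linear_combination -(U i k * U j k) * Real.mul_self_sqrt (hev k)
    · rw [not_not.1 h]; ring
  · ext k l
    have h1 : ∑ i, U i (e k).1 * U i (e l).1 = (1 : Matrix (Fin n) (Fin n) ℝ) (e k).1 (e l).1 := by
      rw [← hUU]; rfl
    simp only [mul_apply, of_apply]
    calc ∑ i, (√(ev (e k).1))⁻¹ * U i (e k).1 * (U i (e l).1 * √(ev (e l).1))
        = (√(ev (e k).1))⁻¹ * √(ev (e l).1) * ∑ i, U i (e k).1 * U i (e l).1 := by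
          rw [Finset.mul_sum]; exact Finset.sum_congr rfl fun i _ => by ring
      _ = _ := by
          rw [h1, one_apply, one_apply]
          by_cases hkl : k = l
          · subst hkl
            simp [inv_mul_cancel₀ (Real.sqrt_pos.2 (hpos k)).ne']
          · rw [if_neg hkl, if_neg (fun h => hkl (e.injective (Subtype.ext h))), mul_zero]
  · ext i j
    simp only [mul_apply, of_apply, transpose_apply]
    refine Finset.sum_congr rfl fun k _ => ?_
    have := (Real.sqrt_pos.2 (hpos k)).ne'
    field_simp

/-- The definition chooses a solution of the Penrose equations, so only existence is at stake. If Q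
= B Bᵀ with Bp B = 1 and B Bp symmetric, then Bpᵀ Bp is a solution: its products with Q in both
orders are the projection B Bp. -/
theorem isPinv_pinv {n : ℕ} {Q : Matrix (Fin n) (Fin n) ℝ} (hQ : Q.PosSemidef) :
    IsPinv Q (pinv Q) := by
  have h : ∃ P, IsPinv Q P := by
    obtain ⟨r, B, Bp, rfl, h1, h2⟩ := exists_factor hQ
    have h1' : Bᵀ * Bpᵀ = 1 := by rw [← transpose_mul, h1, transpose_one]
    have hA : B * Bᵀ * (Bpᵀ * Bp) = B * Bp := by
      rw [Matrix.mul_assoc, ← Matrix.mul_assoc Bᵀ, h1', Matrix.one_mul]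
    have hB : Bpᵀ * Bp * (B * Bᵀ) = B * Bp := by
      rw [Matrix.mul_assoc, ← Matrix.mul_assoc Bp, h1, Matrix.one_mul, ← transpose_mul, h2]
    refine ⟨Bpᵀ * Bp, ?_, ?_, ?_, ?_⟩
    · rw [hA, Matrix.mul_assoc, ← Matrix.mul_assoc Bp, h1, Matrix.one_mul]
    · rw [hB, ← h2, transpose_mul, Matrix.mul_assoc, ← Matrix.mul_assoc Bᵀ, h1', Matrix.one_mul]
    · rw [hA, h2]
    · rw [hB, h2]
  rw [pinv, dif_pos h]
  exact h.choose_spec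

theorem posSemidef_mul_mul_transpose {m n : Type*} [Fintype m] [Fintype n] {A : Matrix n n ℝ}
    (hA : A.PosSemidef) (B : Matrix m n ℝ) : (B * A * Bᵀ).PosSemidef := by
  simpa using hA.mul_mul_conjTranspose_same B

theorem posSemidef_mul_transpose {m n : Type*} [Fintype m] [Fintype n] (B : Matrix m n ℝ) :
    (B * Bᵀ).PosSemidef := by
  simpa using posSemidef_self_mul_conjTranspose B

theorem eq_zero_of_neg_mul_transpose {m n : Type*} [Fintype m] [Fintype n] {T : Matrix m n ℝ}
    (h : (-(T * Tᵀ)).PosSemidef) : T = 0 := by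
  have h1 := h.trace_nonneg
  have h2 := (posSemidef_mul_transpose T).trace_nonneg
  rw [trace_neg] at h1
  have : (T * Tᴴ).trace = 0 := by
    rw [conjTranspose_eq_transpose_of_trivial]; linarith
  exact trace_mul_conjTranspose_self_eq_zero_iff.1 this

/-- If `Q ⪰ J Jᵀ` then the columns of `J` lie in the range of `Q`. -/
theorem mul_pinv_mul_of_le {n : ℕ} {κ : Type*} [Fintype κ] {Q : Matrix (Fin n) (Fin n) ℝ}
    {J : Matrix (Fin n) κ ℝ} (hQ : Q.PosSemidef) (hJ : (Q - J * Jᵀ).PosSemidef) :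
    Q * pinv Q * J = J := by
  have hp := isPinv_pinv hQ
  -- Conjugation by the projection onto the kernel of Q kills Q and leaves -(T J)(T J)ᵀ ⪰ 0, which
  -- forces T J = 0.
  set T := (1 : Matrix (Fin n) (Fin n) ℝ) - Q * pinv Q with hT
  have hTQ : T * Q = 0 := by rw [hT, Matrix.sub_mul, hp.1, Matrix.one_mul, sub_self]
  have h := posSemidef_mul_mul_transpose hJ T
  have : T * (Q - J * Jᵀ) * Tᵀ = -((T * J) * (T * J)ᵀ) := by
    rw [Matrix.mul_sub, hTQ, zero_sub, Matrix.neg_mul, transpose_mul]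
    simp only [Matrix.mul_assoc]
  rw [this] at h
  have := eq_zero_of_neg_mul_transpose h
  rw [hT, Matrix.sub_mul, Matrix.one_mul, sub_eq_zero] at this
  exact this.symm

theorem posDef_of_posSemidef_det_ne {n : Type*} [Fintype n] [DecidableEq n] {A : Matrix n n ℝ}
    (hA : A.PosSemidef) (hd : A.det ≠ 0) : A.PosDef := by
  rw [hA.1.posDef_iff_eigenvalues_pos]
  intro i
  refine lt_of_le_of_ne (hA.eigenvalues_nonneg i) fun h => hd ?_
  rw [hA.1.det_eq_prod_eigenvalues]
  exact Finset.prod_eq_zero (Finset.mem_univ i) (by simp [← h])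

theorem one_le_det_one_add {n : Type*} [Fintype n] [DecidableEq n] {C : Matrix n n ℝ}
    (hC : C.PosSemidef) : 1 ≤ (1 + C).det := by
  obtain ⟨U, σ, -, hU, hσ, hsp⟩ := exists_diagonalization hC
  have h1 : 1 + C = U * diagonal (fun i => 1 + σ i) * Uᵀ := by
    have : diagonal (fun i => 1 + σ i) = 1 + diagonal σ := by
      rw [← diagonal_one, diagonal_add]
    rw [this, Matrix.mul_add, Matrix.add_mul, Matrix.mul_one, hU, ← hsp]
  rw [h1, det_mul_right_comm, hU, Matrix.one_mul, det_diagonal]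
  calc (1 : ℝ) = ∏ _i : n, (1 : ℝ) := by simp
    _ ≤ _ := Finset.prod_le_prod (fun _ _ => zero_le_one) fun i _ => by linarith [hσ i]

/-- The determinant is monotone on positive semidefinite matrices. -/
theorem det_le_det_of_posSemidef {n : Type*} [Fintype n] [DecidableEq n] {A B : Matrix n n ℝ}
    (hA : A.PosSemidef) (hAB : (B - A).PosSemidef) : A.det ≤ B.det := by
  by_cases hd : A.det = 0
  · rw [hd]
    have : B.PosSemidef := by simpa using hA.add hAB
    exact this.det_nonneg
  obtain ⟨R, rfl⟩ := exists_eq_mul_transpose hA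
  have hR : IsUnit R.det := by
    rw [det_mul] at hd
    exact isUnit_iff_ne_zero.2 (left_ne_zero_of_mul hd)
  have hRR := mul_nonsing_inv R hR
  have hRR' : R⁻¹ᵀ * Rᵀ = 1 := by rw [← transpose_mul, hRR, transpose_one]
  -- For nonsingular A = R Rᵀ, the ratio det B / det A is the determinant of the identity plus a
  -- positive semidefinite matrix.
  have hB : B = R * (1 + R⁻¹ * (B - R * Rᵀ) * R⁻¹ᵀ) * Rᵀ := by
    have : R * (1 + R⁻¹ * (B - R * Rᵀ) * R⁻¹ᵀ) * Rᵀ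
        = R * Rᵀ + (R * R⁻¹) * (B - R * Rᵀ) * (R⁻¹ᵀ * Rᵀ) := by
      simp only [Matrix.mul_add, Matrix.add_mul, Matrix.mul_one, Matrix.mul_assoc]
    rw [this, hRR, hRR', Matrix.one_mul, Matrix.mul_one]
    abel
  have h1 := one_le_det_one_add (posSemidef_mul_mul_transpose hAB R⁻¹)
  rw [hB, det_mul, det_mul, det_mul, det_transpose]
  nlinarith [mul_self_nonneg R.det]

/-- The characteristic polynomials of C Cᵀ and Cᵀ C agree up to powers of the indeterminate, so
their nonzero roots agree; those of the positive definite Cᵀ C are all nonzero and multiply to its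
determinant. -/
theorem pdet_mul_transpose {n r : ℕ} {C : Matrix (Fin n) (Fin r) ℝ} (hC : (Cᵀ * C).det ≠ 0) :
    pdet (C * Cᵀ) = (Cᵀ * C).det := by
  have hpd := posDef_of_posSemidef_det_ne (A := Cᵀ * C) (by
    simpa using posSemidef_mul_transpose Cᵀ) hC
  have h := charpoly_mul_comm' C Cᵀ
  have h2 := congrArg (fun p : Polynomial ℝ => (p.roots.filter (· ≠ 0)).prod) h
  have h0 : ∀ k : ℕ, ((Polynomial.X : Polynomial ℝ) ^ k).roots.filter (· ≠ 0) = 0 := by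
    intro k
    rw [Polynomial.roots_pow, Polynomial.roots_X, Multiset.filter_eq_nil]
    intro a ha
    simp [Multiset.mem_singleton.1 (Multiset.mem_of_mem_nsmul ha)]
  have h3 : ∀ (k : ℕ) {m : ℕ} (A : Matrix (Fin m) (Fin m) ℝ),
      ((Polynomial.X ^ k * A.charpoly).roots.filter (· ≠ 0)).prod = pdet A := by
    intro k m A
    rw [Polynomial.roots_mul ((Polynomial.monic_X_pow k).mul A.charpoly_monic).ne_zero,
      Multiset.filter_add, h0, zero_add, pdet]
  simp only [h3] at h2
  rw [h2, pdet, hpd.1.roots_charpoly_eq_eigenvalues, hpd.1.det_eq_prod_eigenvalues,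
    Multiset.filter_eq_self.2]
  · rfl
  · intro a ha
    obtain ⟨i, -, rfl⟩ := Multiset.mem_map.1 ha
    simpa using (ne_of_gt (hpd.eigenvalues_pos i))

/-- `½ log (1 / d)`, with the value `∞` at `d = 0`. -/
def halfLogInv (d : ℝ) : ℝ≥0∞ :=
  if d = 0 then ⊤ else ENNReal.ofReal (-(1 / 2) * Real.log d)

theorem halfLogInv_anti {a b : ℝ} (ha : 0 ≤ a) (hab : a ≤ b) : halfLogInv b ≤ halfLogInv a := by
  unfold halfLogInv
  by_cases h : a = 0
  · simp [h]
  · have ha' := lt_of_le_of_ne ha (Ne.symm h)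
    rw [if_neg h, if_neg (ha'.trans_le hab).ne']
    exact ENNReal.ofReal_le_ofReal (by linarith [Real.log_le_log ha' hab])

theorem rank_mul_mul_transpose {n r : ℕ} {B : Matrix (Fin n) (Fin r) ℝ}
    {Bp : Matrix (Fin r) (Fin n) ℝ} (hB : Bp * B = 1) (M : Matrix (Fin r) (Fin r) ℝ) :
    (B * M * Bᵀ).rank = M.rank := by
  have hB' : Bᵀ * Bpᵀ = 1 := by rw [← transpose_mul, hB, transpose_one]
  refine le_antisymm ((rank_mul_le_left _ _).trans (rank_mul_le_right _ _)) ?_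
  have : M = Bp * (B * M * Bᵀ) * Bpᵀ := by
    have : Bp * (B * M * Bᵀ) * Bpᵀ = (Bp * B) * M * (Bᵀ * Bpᵀ) := by simp only [Matrix.mul_assoc]
    rw [this, hB, hB', Matrix.one_mul, Matrix.mul_one]
  conv_lhs => rw [this]
  exact (rank_mul_le_left _ _).trans (rank_mul_le_right _ _)

/-- Since B is injective, the two ranks are r and rank M, and they differ exactly when det M = 0.
Otherwise M = R Rᵀ, and the pseudo-determinants are det(Bᵀ B) and det(Bᵀ B) det M, so det(Bᵀ B)
cancels. -/
theorem halfLogDetRatio_factor {n r : ℕ} {B : Matrix (Fin n) (Fin r) ℝ}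
    {Bp : Matrix (Fin r) (Fin n) ℝ} (hB : Bp * B = 1) {M : Matrix (Fin r) (Fin r) ℝ}
    (hM : M.PosSemidef) : halfLogDetRatio (B * Bᵀ) (B * M * Bᵀ) = halfLogInv M.det := by
  have hBB : (Bᵀ * B).det ≠ 0 := by
    intro h0
    obtain ⟨v, hv, hv0⟩ := exists_mulVec_eq_zero_iff.2 h0
    refine hv ?_
    have h1 : B *ᵥ v = 0 := by
      have : (B *ᵥ v) ⬝ᵥ (B *ᵥ v) = 0 := by
        rw [dotProduct_mulVec, vecMul_mulVec, ← dotProduct_mulVec, hv0, dotProduct_zero]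
      exact dotProduct_self_eq_zero.1 this
    have : (Bp * B) *ᵥ v = 0 := by rw [← mulVec_mulVec, h1, mulVec_zero]
    rwa [hB, one_mulVec] at this
  have hr1 : (B * Bᵀ).rank = r := by
    have := rank_mul_mul_transpose hB (1 : Matrix (Fin r) (Fin r) ℝ)
    rwa [Matrix.mul_one, rank_one, Fintype.card_fin] at this
  rw [halfLogDetRatio, halfLogInv, hr1, rank_mul_mul_transpose hB]
  by_cases hd : M.det = 0
  · rw [if_pos hd, if_neg]
    intro hr
    obtain ⟨v, hv, hv0⟩ := exists_mulVec_eq_zero_iff.2 hd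
    have hk := LinearMap.finrank_range_add_finrank_ker M.mulVecLin
    rw [show Module.finrank ℝ (LinearMap.range M.mulVecLin) = r from hr.symm] at hk
    simp only [Module.finrank_fintype_fun_eq_card, Fintype.card_fin] at hk
    have hk0 : Module.finrank ℝ (LinearMap.ker M.mulVecLin) = 0 := by omega
    rw [Submodule.finrank_eq_zero] at hk0
    refine hv ((Submodule.mem_bot ℝ).1 (hk0 ▸ ?_))
    exact LinearMap.mem_ker.2 hv0
  · rw [if_neg hd, if_pos (by rw [rank_of_det_ne_zero hd, Fintype.card_fin])]
    congr 1
    obtain ⟨R, rfl⟩ := exists_eq_mul_transpose hM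
    have hRd : R.det ≠ 0 := by
      rw [det_mul] at hd
      exact left_ne_zero_of_mul hd
    have h1 : B * (R * Rᵀ) * Bᵀ = (B * R) * (B * R)ᵀ := by
      rw [transpose_mul]; simp only [Matrix.mul_assoc]
    have h2 : ((B * R)ᵀ * (B * R)).det = R.det * (Bᵀ * B).det * R.det := by
      rw [transpose_mul, Matrix.mul_assoc, ← Matrix.mul_assoc Bᵀ, det_mul, det_mul, det_transpose]
      ring
    have h3 : ((B * R)ᵀ * (B * R)).det ≠ 0 := by
      rw [h2]; exact mul_ne_zero (mul_ne_zero hRd hBB) hRd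
    rw [h1, pdet_mul_transpose h3, pdet_mul_transpose hBB, h2, det_mul, det_transpose]
    rw [show (Bᵀ * B).det / (R.det * (Bᵀ * B).det * R.det) = (R.det * R.det)⁻¹ by field_simp,
      Real.log_inv]
    ring

/-- The Schur complement `1 - Jᵀ Q† J`. -/
def schur {n r : ℕ} (Q : Matrix (Fin n) (Fin n) ℝ) (J : Matrix (Fin n) (Fin r) ℝ) :
    Matrix (Fin r) (Fin r) ℝ :=
  1 - Jᵀ * pinv Q * J

/-- Take Q = E Eᵀ with E left invertible. The columns of J lie in the range of Q, so J = E F, and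
cancelling E in Q Q† Q = Q gives Eᵀ Q† E = 1. This expresses the Schur complement and the noise
covariance by the same F. -/
theorem exists_schur_factor {n r : ℕ} {Q : Matrix (Fin n) (Fin n) ℝ}
    {J : Matrix (Fin n) (Fin r) ℝ} (hQ : Q.PosSemidef) (hJ : (Q - J * Jᵀ).PosSemidef) :
    ∃ (k : ℕ) (E : Matrix (Fin n) (Fin k) ℝ) (Ep : Matrix (Fin k) (Fin n) ℝ)
      (F : Matrix (Fin k) (Fin r) ℝ), Ep * E = 1 ∧ Q = E * Eᵀ ∧ schur Q J = 1 - Fᵀ * F ∧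
      Q - J * Jᵀ = E * (1 - F * Fᵀ) * Eᵀ ∧ (1 - F * Fᵀ).PosSemidef := by
  have hp := isPinv_pinv hQ
  have hJ' := mul_pinv_mul_of_le hQ hJ
  obtain ⟨k, E, Ep, hE, hEp, -⟩ := exists_factor hQ
  have hEp' : Eᵀ * Epᵀ = 1 := by rw [← transpose_mul, hEp, transpose_one]
  have hEJ : E * (Ep * J) = J := by
    rw [← hJ']
    conv_lhs => rw [hE]
    conv_rhs => rw [hE]
    simp only [Matrix.mul_assoc]
    rw [← Matrix.mul_assoc Ep, hEp, Matrix.one_mul]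
  have hEQE : Eᵀ * pinv Q * E = 1 := by
    have h1 : Ep * (Q * pinv Q * Q) * Epᵀ = 1 := by
      rw [hp.1, hE, Matrix.mul_assoc, Matrix.mul_assoc, hEp', Matrix.mul_one, hEp]
    have h2 : Ep * (Q * pinv Q * Q) * Epᵀ = (Ep * E) * (Eᵀ * pinv Q * E) * (Eᵀ * Epᵀ) := by
      conv_lhs => rw [show Q * pinv Q * Q = (E * Eᵀ) * pinv Q * (E * Eᵀ) by rw [← hE]]
      simp only [Matrix.mul_assoc]
    rw [h2, hEp, hEp', Matrix.one_mul, Matrix.mul_one] at h1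
    exact h1
  have hW : Q - J * Jᵀ = E * (1 - (Ep * J) * (Ep * J)ᵀ) * Eᵀ := by
    have : E * (1 - (Ep * J) * (Ep * J)ᵀ) * Eᵀ = E * Eᵀ - (E * (Ep * J)) * (E * (Ep * J))ᵀ := by
      rw [transpose_mul E]
      simp only [Matrix.mul_sub, Matrix.sub_mul, Matrix.mul_one, Matrix.mul_assoc]
    rw [this, hEJ, ← hE]
  refine ⟨k, E, Ep, Ep * J, hEp, hE, ?_, hW, ?_⟩
  · have : Jᵀ * pinv Q * J = (E * (Ep * J))ᵀ * pinv Q * (E * (Ep * J)) := by rw [hEJ]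
    rw [schur, this, transpose_mul E, Matrix.mul_assoc, Matrix.mul_assoc (Ep * J)ᵀ,
      ← Matrix.mul_assoc (pinv Q), ← Matrix.mul_assoc Eᵀ, ← Matrix.mul_assoc Eᵀ, hEQE,
      Matrix.one_mul]
  · have h1 := posSemidef_mul_mul_transpose hJ Ep
    rw [hW] at h1
    have : Ep * (E * (1 - (Ep * J) * (Ep * J)ᵀ) * Eᵀ) * Epᵀ
        = (Ep * E) * (1 - (Ep * J) * (Ep * J)ᵀ) * (Eᵀ * Epᵀ) := by
      simp only [Matrix.mul_assoc]
    rwa [this, hEp, hEp', Matrix.one_mul, Matrix.mul_one] at h1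

theorem schur_posSemidef {n r : ℕ} {Q : Matrix (Fin n) (Fin n) ℝ}
    {J : Matrix (Fin n) (Fin r) ℝ} (hQ : Q.PosSemidef) (hJ : (Q - J * Jᵀ).PosSemidef) :
    (schur Q J).PosSemidef := by
  obtain ⟨k, E, Ep, F, -, -, hS, -, hF⟩ := exists_schur_factor hQ hJ
  -- With G = Fᵀ F this is 1 - G = (1 - G)² + (G - G²); it transfers positivity from 1 - F Fᵀ to 1 -
  -- Fᵀ F.
  have h1 : 1 - Fᵀ * F = (1 - Fᵀ * F) * (1 - Fᵀ * F)ᵀ + Fᵀ * (1 - F * Fᵀ) * Fᵀᵀ := by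
    simp only [transpose_sub, transpose_one, transpose_mul, transpose_transpose, Matrix.mul_sub,
      Matrix.sub_mul, Matrix.mul_one, Matrix.one_mul, Matrix.mul_assoc]
    abel
  rw [hS, h1]
  exact (posSemidef_mul_transpose _).add (posSemidef_mul_mul_transpose hF _)

/-- Sylvester's identity det(1 - F Fᵀ) = det(1 - Fᵀ F). This is what makes the quotient det Q_{X̂|Y}
/ det Q_W agree with det Q_{S|Y} / det Q_{S|X̂,Y}. -/
theorem halfLogDetRatio_noise {n r : ℕ} {Q : Matrix (Fin n) (Fin n) ℝ}
    {J : Matrix (Fin n) (Fin r) ℝ} (hQ : Q.PosSemidef) (hJ : (Q - J * Jᵀ).PosSemidef) :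
    halfLogDetRatio Q (Q - J * Jᵀ) = halfLogInv (schur Q J).det := by
  obtain ⟨k, E, Ep, F, hE, hQE, hS, hW, hF⟩ := exists_schur_factor hQ hJ
  rw [hS, det_one_sub_mul_comm, ← halfLogDetRatio_factor hE hF, ← hW, ← hQE]

theorem transpose_mul_pinv_mul_of_le {n r : ℕ} {Q : Matrix (Fin n) (Fin n) ℝ}
    {J : Matrix (Fin n) (Fin r) ℝ} (hQ : Q.PosSemidef) (hJ : (Q - J * Jᵀ).PosSemidef) :
    Jᵀ * pinv Q * Q = Jᵀ := by
  have hp := isPinv_pinv hQ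
  have hJ' := mul_pinv_mul_of_le hQ hJ
  have hQt : Qᵀ = Q := by simpa using hQ.1.eq
  have h1 : pinv Q * Q * Q = Q := by
    have := congrArg transpose hp.1
    rwa [Matrix.mul_assoc, transpose_mul, hp.2.2.2, hQt] at this
  have h2 : pinv Q * Q * J = J := by
    conv_lhs => rw [← hJ']
    rw [← Matrix.mul_assoc, ← Matrix.mul_assoc, h1, hJ']
  have := congrArg transpose h2
  rwa [transpose_mul, hp.2.2.2, ← Matrix.mul_assoc] at this

/-- If Q = E[V Vᵀ] and J = E[V Nᵀ] with N white, the matrix on the right is the error covariance of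
the estimate A V of N. Completing the square, it exceeds the Schur complement by (A - Jᵀ Q†) Q (A -
Jᵀ Q†)ᵀ. -/
theorem det_schur_le {n r : ℕ} {Q : Matrix (Fin n) (Fin n) ℝ}
    {J : Matrix (Fin n) (Fin r) ℝ} (hQ : Q.PosSemidef) (hJ : (Q - J * Jᵀ).PosSemidef)
    (A : Matrix (Fin r) (Fin n) ℝ) :
    (schur Q J).det ≤ (1 - A * J - (A * J)ᵀ + A * Q * Aᵀ).det := by
  refine det_le_det_of_posSemidef (schur_posSemidef hQ hJ) ?_
  have h := posSemidef_mul_mul_transpose hQ (A - Jᵀ * pinv Q)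
  have hQt : Qᵀ = Q := by simpa using hQ.1.eq
  have h1 := transpose_mul_pinv_mul_of_le hQ hJ
  have h2 : Q * ((pinv Q)ᵀ * J) = J := by
    have := congrArg transpose h1
    simpa [hQt] using this
  have h3 : Jᵀ * ((pinv Q)ᵀ * J) = Jᵀ * pinv Q * J := by
    conv_lhs => rw [← h1]
    rw [Matrix.mul_assoc _ Q, h2]
  convert h using 1
  have : (A - Jᵀ * pinv Q) * Q * (A - Jᵀ * pinv Q)ᵀ
      = A * Q * Aᵀ - A * (Q * ((pinv Q)ᵀ * J)) - (Jᵀ * pinv Q * Q) * Aᵀ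
        + (Jᵀ * pinv Q * Q) * ((pinv Q)ᵀ * J) := by
    simp only [Matrix.sub_mul, Matrix.mul_sub, transpose_sub, transpose_mul, transpose_transpose,
      Matrix.mul_assoc]
    abel
  rw [this, h1, h2, h3, schur, transpose_mul]
  abel

end LinearAlgebra

/-! ### The finite-dimensional optimization problem and the existence of an optimum. -/

section Optimization

/-- The constraints on `J = H B` in coordinates where the remote source is white. -/
structure Feasible {n r : ℕ} (C : Matrix (Fin n) (Fin r) ℝ) (QX : Matrix (Fin n) (Fin n) ℝ)
    (Δ : ℝ) (J : Matrix (Fin n) (Fin r) ℝ) : Prop where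
  posSemidef : (J * Cᵀ).PosSemidef
  noise_posSemidef : (J * Cᵀ - J * Jᵀ).PosSemidef
  error_posSemidef : (QX - J * Cᵀ).PosSemidef
  trace_le : (QX - J * Cᵀ).trace ≤ Δ

theorem isClosed_posSemidef (n : ℕ) : IsClosed {M : Matrix (Fin n) (Fin n) ℝ | M.PosSemidef} := by
  simp only [posSemidef_iff_dotProduct_mulVec, Set.ofPred_and, Set.ofPred_forall]
  refine IsClosed.inter ?_ (isClosed_iInter fun x => ?_)
  · exact isClosed_eq (by fun_prop) continuous_id
  · exact isClosed_le continuous_const (by fun_prop)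

/-- The set is bounded because the traces of two of the positivity constraints give tr(J Jᵀ) ≤ tr(J
Cᵀ) ≤ tr Q_X. -/
theorem isCompact_feasible {n r : ℕ} (C : Matrix (Fin n) (Fin r) ℝ)
    (QX : Matrix (Fin n) (Fin n) ℝ) (Δ : ℝ) : IsCompact {J | Feasible C QX Δ J} := by
  have hcl : IsClosed {J | Feasible C QX Δ J} := by
    have : {J | Feasible C QX Δ J} = ((fun J => J * Cᵀ) ⁻¹' {M | M.PosSemidef}) ∩
        (((fun J => J * Cᵀ - J * Jᵀ) ⁻¹' {M | M.PosSemidef}) ∩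
        (((fun J => QX - J * Cᵀ) ⁻¹' {M | M.PosSemidef}) ∩ {J | (QX - J * Cᵀ).trace ≤ Δ})) := by
      ext J
      exact ⟨fun h => ⟨h.1, h.2, h.3, h.4⟩, fun h => ⟨h.1, h.2.1, h.2.2.1, h.2.2.2⟩⟩
    rw [this]
    refine ((isClosed_posSemidef n).preimage (by fun_prop)).inter
      (((isClosed_posSemidef n).preimage (by fun_prop)).inter
      (((isClosed_posSemidef n).preimage (by fun_prop)).inter
      (isClosed_le (by fun_prop) continuous_const)))
  have hK : IsCompact (Set.univ.pi fun _ : Fin n => Set.univ.pi fun _ : Fin r =>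
      Set.Icc (-√QX.trace) (√QX.trace)) :=
    isCompact_univ_pi fun _ => isCompact_univ_pi fun _ => isCompact_Icc
  refine hK.of_isClosed_subset hcl fun (J : Matrix (Fin n) (Fin r) ℝ) hJ i _ j _ => ?_
  have h1 := hJ.noise_posSemidef.trace_nonneg
  have h2 := hJ.error_posSemidef.trace_nonneg
  rw [trace_sub] at h1 h2
  have h3 : J i j ^ 2 ≤ (J * Jᵀ).trace := by
    simp only [trace, diag_apply, mul_apply, transpose_apply, ← pow_two]
    calc J i j ^ 2 ≤ ∑ l, J i l ^ 2 :=
          Finset.single_le_sum (f := fun l => J i l ^ 2) (fun _ _ => sq_nonneg _)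
            (Finset.mem_univ j)
      _ ≤ _ := Finset.single_le_sum (f := fun k => ∑ l, J k l ^ 2)
            (fun _ _ => Finset.sum_nonneg fun _ _ => sq_nonneg _) (Finset.mem_univ i)
  exact abs_le.1 (Real.abs_le_sqrt (by linarith))

/-- The lower bound `det_schur_le` is attained at the optimal linear estimator A = Jᵀ Q†. -/
theorem det_schur_eq {n r : ℕ} {Q : Matrix (Fin n) (Fin n) ℝ}
    {J : Matrix (Fin n) (Fin r) ℝ} (hQ : Q.PosSemidef) (hJ : (Q - J * Jᵀ).PosSemidef) :
    schur Q J = 1 - (Jᵀ * pinv Q) * J - ((Jᵀ * pinv Q) * J)ᵀ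
      + (Jᵀ * pinv Q) * Q * (Jᵀ * pinv Q)ᵀ := by
  rw [transpose_mul_pinv_mul_of_le hQ hJ, transpose_mul (Jᵀ * pinv Q), sub_add_cancel, schur]

/-- The pseudoinverse may jump where the rank of J Cᵀ changes, but the Schur determinant is a
minimum over A of functions continuous in J. Upper semicontinuity on a compact set is enough for a
maximum. -/
theorem exists_feasible_max {n r : ℕ} {C : Matrix (Fin n) (Fin r) ℝ}
    {QX : Matrix (Fin n) (Fin n) ℝ} {Δ : ℝ} (h : ∃ J, Feasible C QX Δ J) :
    ∃ J, Feasible C QX Δ J ∧ ∀ J', Feasible C QX Δ J' →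
      (schur (J' * Cᵀ) J').det ≤ (schur (J * Cᵀ) J).det := by
  have husc : UpperSemicontinuousOn (fun J : Matrix (Fin n) (Fin r) ℝ => (schur (J * Cᵀ) J).det)
      {J | Feasible C QX Δ J} := by
    intro J₀ hJ₀ y hy
    -- Freezing the estimator that is optimal at J₀ gives a continuous function of J that agrees
    -- with the Schur determinant at J₀ and dominates it on the feasible set.
    set A := J₀ᵀ * pinv (J₀ * Cᵀ) with hA
    have hcont : Continuous fun J : Matrix (Fin n) (Fin r) ℝ =>
        (1 - A * J - (A * J)ᵀ + A * (J * Cᵀ) * Aᵀ).det := by fun_prop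
    have h0 : (1 - A * J₀ - (A * J₀)ᵀ + A * (J₀ * Cᵀ) * Aᵀ).det < y := by
      rwa [hA, ← det_schur_eq hJ₀.posSemidef hJ₀.noise_posSemidef]
    filter_upwards [self_mem_nhdsWithin,
      nhdsWithin_le_nhds (hcont.continuousAt.eventually_lt_const h0)] with J hJ hlt
    exact (det_schur_le hJ.posSemidef hJ.noise_posSemidef A).trans_lt hlt
  obtain ⟨J, hJ, hmax⟩ := husc.exists_isMaxOn h (isCompact_feasible C QX Δ)
  exact ⟨J, hJ, fun J' hJ' => hmax hJ'⟩

end Optimization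

/-! ### Matrices of second moments of square integrable vectors. -/

section Moments

variable {Ω : Type*} [MeasurableSpace Ω] {μ : Measure Ω}
variable {ι κ l : Type*}

/-- The matrix `E[U Vᵀ]`. -/
def xmom (μ : Measure Ω) (U : Ω → ι → ℝ) (V : Ω → κ → ℝ) : Matrix ι κ ℝ :=
  Matrix.of fun i j => ∫ ω, U ω i * V ω j ∂μ

/-- Random vectors with square integrable coordinates. -/
def SqInt (μ : Measure Ω) (U : Ω → ι → ℝ) : Prop := ∀ i, MemLp (fun ω => U ω i) 2 μ

theorem SqInt.integrable_mul {U : Ω → ι → ℝ} {V : Ω → κ → ℝ} (hU : SqInt μ U) (hV : SqInt μ V)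
    (i : ι) (j : κ) : Integrable (fun ω => U ω i * V ω j) μ :=
  (hU i).integrable_mul (hV j)

theorem SqInt.sub {U V : Ω → ι → ℝ} (hU : SqInt μ U) (hV : SqInt μ V) :
    SqInt μ fun ω => U ω - V ω := fun i => (hU i).sub (hV i)

theorem SqInt.add {U V : Ω → ι → ℝ} (hU : SqInt μ U) (hV : SqInt μ V) :
    SqInt μ fun ω => U ω + V ω := fun i => (hU i).add (hV i)

theorem SqInt.mulVec [Fintype ι] {U : Ω → ι → ℝ} (hU : SqInt μ U) (A : Matrix κ ι ℝ) :
    SqInt μ fun ω => A *ᵥ U ω := fun k => by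
  simp only [Matrix.mulVec, dotProduct]
  exact memLp_finsetSum _ fun i _ => (hU i).const_mul _

theorem xmom_transpose (U : Ω → ι → ℝ) (V : Ω → κ → ℝ) : (xmom μ U V)ᵀ = xmom μ V U := by
  ext i j
  simp [xmom, mul_comm]

theorem xmom_sub_left {U U' : Ω → ι → ℝ} {V : Ω → κ → ℝ} (hU : SqInt μ U) (hU' : SqInt μ U')
    (hV : SqInt μ V) : xmom μ (fun ω => U ω - U' ω) V = xmom μ U V - xmom μ U' V := by
  ext i j
  simp only [xmom, of_apply, Pi.sub_apply, sub_mul, Matrix.sub_apply]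
  exact integral_sub (hU.integrable_mul hV i j) (hU'.integrable_mul hV i j)

theorem xmom_add_left {U U' : Ω → ι → ℝ} {V : Ω → κ → ℝ} (hU : SqInt μ U) (hU' : SqInt μ U')
    (hV : SqInt μ V) : xmom μ (fun ω => U ω + U' ω) V = xmom μ U V + xmom μ U' V := by
  ext i j
  simp only [xmom, of_apply, Pi.add_apply, add_mul, Matrix.add_apply]
  exact integral_add (hU.integrable_mul hV i j) (hU'.integrable_mul hV i j)

theorem xmom_mulVec_left [Fintype ι] {U : Ω → ι → ℝ} {V : Ω → κ → ℝ} (hU : SqInt μ U)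
    (hV : SqInt μ V)
    (A : Matrix l ι ℝ) : xmom μ (fun ω => A *ᵥ U ω) V = A * xmom μ U V := by
  ext i j
  simp only [xmom, of_apply, Matrix.mulVec, dotProduct, mul_apply, Finset.sum_mul]
  rw [integral_finsetSum]
  · simp only [mul_assoc, integral_const_mul]
  · intro k _
    simp only [mul_assoc]
    exact (hU.integrable_mul hV k j).const_mul _

theorem xmom_sub_right {U : Ω → ι → ℝ} {V V' : Ω → κ → ℝ} (hU : SqInt μ U) (hV : SqInt μ V)
    (hV' : SqInt μ V') : xmom μ U (fun ω => V ω - V' ω) = xmom μ U V - xmom μ U V' := by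
  rw [← xmom_transpose, xmom_sub_left hV hV' hU, transpose_sub, xmom_transpose, xmom_transpose]

theorem xmom_add_right {U : Ω → ι → ℝ} {V V' : Ω → κ → ℝ} (hU : SqInt μ U) (hV : SqInt μ V)
    (hV' : SqInt μ V') : xmom μ U (fun ω => V ω + V' ω) = xmom μ U V + xmom μ U V' := by
  rw [← xmom_transpose, xmom_add_left hV hV' hU, transpose_add, xmom_transpose, xmom_transpose]

theorem xmom_mulVec_right [Fintype κ] {U : Ω → ι → ℝ} {V : Ω → κ → ℝ} (hU : SqInt μ U)
    (hV : SqInt μ V)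
    (A : Matrix l κ ℝ) : xmom μ U (fun ω => A *ᵥ V ω) = xmom μ U V * Aᵀ := by
  rw [← xmom_transpose, xmom_mulVec_left hV hU, transpose_mul, xmom_transpose]

theorem xmom_congr {U U' : Ω → ι → ℝ} {V V' : Ω → κ → ℝ} (hU : U =ᵐ[μ] U') (hV : V =ᵐ[μ] V') :
    xmom μ U V = xmom μ U' V' := by
  ext i j
  refine integral_congr_ae ?_
  filter_upwards [hU, hV] with ω h1 h2
  rw [h1, h2]

theorem dotProduct_xmom_mulVec [Fintype ι] {U : Ω → ι → ℝ} (hU : SqInt μ U) (x : ι → ℝ) :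
    x ⬝ᵥ (xmom μ U U *ᵥ x) = ∫ ω, (x ⬝ᵥ U ω) ^ 2 ∂μ := by
  have h : ∀ ω, (x ⬝ᵥ U ω) ^ 2 = ∑ i, ∑ j, x i * (U ω i * U ω j) * x j := by
    intro ω
    simp only [dotProduct, sq, Finset.sum_mul_sum]
    exact Finset.sum_congr rfl fun i _ => Finset.sum_congr rfl fun j _ => by ring
  simp only [h]
  rw [integral_finsetSum]
  · simp only [dotProduct, Matrix.mulVec, xmom, of_apply, Finset.mul_sum]
    refine Finset.sum_congr rfl fun i _ => ?_
    rw [integral_finsetSum]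
    · refine Finset.sum_congr rfl fun j _ => ?_
      rw [integral_mul_const, integral_const_mul, mul_assoc]
    · intro j _
      exact ((hU.integrable_mul hU i j).const_mul _).mul_const _
  · intro i _
    exact integrable_finsetSum _ fun j _ =>
      ((hU.integrable_mul hU i j).const_mul _).mul_const _

theorem xmom_posSemidef [Fintype ι] {U : Ω → ι → ℝ} (hU : SqInt μ U) : (xmom μ U U).PosSemidef := by
  refine PosSemidef.of_dotProduct_mulVec_nonneg ?_ fun x => ?_
  · rw [IsHermitian, conjTranspose_eq_transpose_of_trivial, xmom_transpose]
  · rw [star_trivial, dotProduct_xmom_mulVec hU]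
    exact integral_nonneg fun ω => sq_nonneg _

theorem ae_dotProduct_eq_zero [Fintype ι] {U : Ω → ι → ℝ} (hU : SqInt μ U) {x : ι → ℝ}
    (hx : xmom μ U U *ᵥ x = 0) : ∀ᵐ ω ∂μ, x ⬝ᵥ U ω = 0 := by
  have h := dotProduct_xmom_mulVec hU x
  rw [hx, dotProduct_zero] at h
  have hintg : Integrable (fun ω => (x ⬝ᵥ U ω) ^ 2) μ := by
    refine MemLp.integrable_sq ?_
    exact memLp_finsetSum _ fun i _ => (hU i).const_mul _
  filter_upwards [(integral_eq_zero_iff_of_nonneg (fun ω => sq_nonneg _) hintg).1 h.symm] with ω hω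
  simpa using hω

/-- If the matrix `A` annihilates the second moments of `U` then `A U = 0` almost surely. -/
theorem ae_mulVec_eq_zero [Fintype ι] [Finite κ] {U : Ω → ι → ℝ} (hU : SqInt μ U) {A : Matrix κ ι ℝ}
    (hA : A * xmom μ U U = 0) : ∀ᵐ ω ∂μ, A *ᵥ U ω = 0 := by
  have : ∀ k, ∀ᵐ ω ∂μ, A k ⬝ᵥ U ω = 0 := by
    intro k
    refine ae_dotProduct_eq_zero hU ?_
    have h1 := congrArg transpose hA
    rw [transpose_mul, xmom_transpose, transpose_zero] at h1
    ext i
    exact congrFun (congrFun h1 i) k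
  filter_upwards [ae_all_iff.2 this] with ω hω
  ext k
  exact hω k

end Moments

/-! ### Relative entropy: Donsker-Varadhan bound and its equality case. -/

section Divergence

variable {α : Type*} [MeasurableSpace α]

/-- The Donsker-Varadhan lower bound, for a normalized exponential. -/
theorem ofReal_integral_le_klDiv {ρ π : Measure α} [IsProbabilityMeasure ρ]
    [IsProbabilityMeasure π] {φ : α → ℝ} (hφ : Integrable φ ρ)
    (hexp : ∫⁻ x, ENNReal.ofReal (Real.exp (φ x)) ∂π = 1) (hm : Measurable φ) :
    ENNReal.ofReal (∫ x, φ x ∂ρ) ≤ InformationTheory.klDiv ρ π := by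
  by_cases htop : InformationTheory.klDiv ρ π = ⊤
  · simp [htop]
  obtain ⟨hac, hintg⟩ := InformationTheory.klDiv_ne_top_iff.1 htop
  have hei : Integrable (fun x => Real.exp (φ x)) π := by
    refine ⟨(by fun_prop), ?_⟩
    rw [hasFiniteIntegral_iff_ofReal (ae_of_all _ fun x => (Real.exp_pos _).le), hexp]
    exact ENNReal.one_lt_top
  have h1 : ∫ x, Real.exp (φ x) ∂π = 1 := by
    rw [integral_eq_lintegral_of_nonneg_ae (ae_of_all _ fun x => (Real.exp_pos _).le)
      hei.aestronglyMeasurable, hexp, ENNReal.toReal_one]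
  -- Relative entropy with respect to the measure tilted by φ is nonnegative, and it is klDiv ρ π
  -- minus the ρ-integral of φ: by the normalization the logarithm of the partition function is 0.
  have := isProbabilityMeasure_tilted hei
  have hac' : ρ ≪ π.tilted φ := hac.trans (absolutelyContinuous_tilted hei)
  have h2 := integral_llr_tilted_right hac hφ hei hintg
  have h3 := InformationTheory.integral_llr_add_sub_measure_univ_nonneg hac'
    (integrable_llr_tilted_right hac hφ hintg hei)
  rw [InformationTheory.klDiv_of_ac_of_integrable hac hintg]
  refine ENNReal.ofReal_le_ofReal ?_
  rw [h1, Real.log_one] at h2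
  simp only [probReal_univ] at h3 ⊢
  linarith

theorem klDiv_withDensity_exp {ρ π : Measure α} [IsProbabilityMeasure ρ]
    [IsProbabilityMeasure π] {φ : α → ℝ} (hm : Measurable φ)
    (hρ : ρ = π.withDensity fun x => ENNReal.ofReal (Real.exp (φ x))) (hφ : Integrable φ ρ) :
    InformationTheory.klDiv ρ π = ENNReal.ofReal (∫ x, φ x ∂ρ) := by
  have hac : ρ ≪ π := hρ ▸ withDensity_absolutelyContinuous _ _
  have hllr : llr ρ π =ᵐ[ρ] φ := by
    have h := Measure.rnDeriv_withDensity π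
      (f := fun x => ENNReal.ofReal (Real.exp (φ x))) (by fun_prop)
    rw [← hρ] at h
    filter_upwards [hac.ae_le h] with x hx
    rw [llr_def]
    simp only [hx, ENNReal.toReal_ofReal (Real.exp_pos _).le, Real.log_exp]
  rw [InformationTheory.klDiv_of_ac_of_integrable hac ((integrable_congr hllr).2 hφ),
    integral_congr_ae hllr]
  simp

end Divergence

/-! ### Densities of Gaussian product measures relative to the standard one. -/

section GaussianDensity

/-- The logarithm of the density of `N(u, v)` with respect to `N(0, 1)`. -/
def gaussLogDensity (v u x : ℝ) : ℝ :=
  -(1 / 2) * Real.log v - (x - u) ^ 2 / (2 * v) + x ^ 2 / 2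

@[fun_prop]
theorem measurable_gaussLogDensity {β : Type*} [MeasurableSpace β] {v : ℝ} {f g : β → ℝ}
    (hf : Measurable f) (hg : Measurable g) :
    Measurable fun b => gaussLogDensity v (f b) (g b) := by
  unfold gaussLogDensity; fun_prop

theorem gaussianReal_eq_withDensity (u : ℝ) {v : ℝ} (hv : 0 < v) :
    gaussianReal u v.toNNReal = (gaussianReal 0 1).withDensity
      fun x => ENNReal.ofReal (Real.exp (gaussLogDensity v u x)) := by
  have hv' : v.toNNReal ≠ 0 := by simpa using hv
  rw [gaussianReal_of_var_ne_zero _ hv', gaussianReal_of_var_ne_zero _ one_ne_zero,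
    ← withDensity_mul _ (measurable_gaussianPDF _ _) (by fun_prop)]
  congr 1
  ext x
  simp only [Pi.mul_apply, gaussianPDF, ← ENNReal.ofReal_mul (gaussianPDFReal_nonneg _ _ _)]
  congr 1
  have hs : √v = Real.exp (1 / 2 * Real.log v) := by
    rw [Real.sqrt_eq_rpow, Real.rpow_def_of_pos hv, mul_comm]
  simp only [gaussianPDFReal, Real.coe_toNNReal _ hv.le, NNReal.coe_one, mul_one, sub_zero]
  rw [Real.sqrt_mul (by positivity), mul_inv, mul_assoc, mul_assoc, ← Real.exp_add, hs,
    ← Real.exp_neg, ← Real.exp_add, gaussLogDensity]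
  congr 2
  ring

/-- It suffices to compare on boxes. There the integrand is a product of functions of single
coordinates, and independence of the coordinates under a product measure factors the integral. -/
theorem pi_eq_withDensity {ι : Type*} [Fintype ι] {γ ν : ι → Measure ℝ}
    [∀ i, IsProbabilityMeasure (γ i)] [∀ i, IsProbabilityMeasure (ν i)] {f : ι → ℝ → ℝ≥0∞}
    (hf : ∀ i, Measurable (f i)) (h : ∀ i, ν i = (γ i).withDensity (f i)) :
    Measure.pi ν = (Measure.pi γ).withDensity fun x => ∏ i, f i (x i) := by
  refine Measure.pi_eq fun s hs => ?_
  rw [withDensity_apply _ (MeasurableSet.univ_pi hs), ← lintegral_indicator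
    (MeasurableSet.univ_pi hs)]
  have h1 : ∀ x : ι → ℝ, (Set.univ.pi s).indicator (fun x => ∏ i, f i (x i)) x
      = ∏ i, (s i).indicator (f i) (x i) := by
    intro x
    by_cases hx : x ∈ Set.univ.pi s
    · rw [Set.indicator_of_mem hx]
      exact Finset.prod_congr rfl fun i _ =>
        (Set.indicator_of_mem (hx i (Set.mem_univ i)) (f i)).symm
    · rw [Set.indicator_of_notMem hx]
      obtain ⟨i, hi⟩ : ∃ i, x i ∉ s i := by simpa [Set.mem_pi] using hx
      exact (Finset.prod_eq_zero (Finset.mem_univ i) (Set.indicator_of_notMem hi _)).symm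
  simp only [h1]
  have hind : iIndepFun (fun i (x : ι → ℝ) => (s i).indicator (f i) (x i)) (Measure.pi γ) :=
    iIndepFun_pi (X := fun i => (s i).indicator (f i))
      fun i => ((hf i).indicator (hs i)).aemeasurable
  have := lintegral_prod_eq_prod_lintegral_of_indepFun Finset.univ _ hind
    fun i => ((hf i).indicator (hs i)).comp (measurable_pi_apply i)
  rw [this]
  refine Finset.prod_congr rfl fun i _ => ?_
  rw [h i, withDensity_apply _ (hs i), ← lintegral_indicator (hs i)]
  exact (measurePreserving_eval γ i).lintegral_comp ((hf i).indicator (hs i))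

/-- The standard Gaussian measure on `ι → ℝ`. -/
abbrev stdPi (ι : Type*) [Fintype ι] : Measure (ι → ℝ) := Measure.pi fun _ => gaussianReal 0 1

/-- The logarithm of the density of `N(u, diag v)` with respect to `N(0, 1)`. -/
def gaussLogDensityPi {ι : Type*} [Fintype ι] (v u x : ι → ℝ) : ℝ :=
  ∑ i, gaussLogDensity (v i) (u i) (x i)

@[fun_prop]
theorem measurable_gaussLogDensityPi {ι β : Type*} [Fintype ι] [MeasurableSpace β] {v : ι → ℝ}
    {f g : β → ι → ℝ} (hf : Measurable f) (hg : Measurable g) :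
    Measurable fun b => gaussLogDensityPi v (f b) (g b) := by
  unfold gaussLogDensityPi; fun_prop

theorem pi_gaussianReal_eq_withDensity {ι : Type*} [Fintype ι] (u : ι → ℝ) {v : ι → ℝ}
    (hv : ∀ i, 0 < v i) :
    Measure.pi (fun i => gaussianReal (u i) (v i).toNNReal) = (stdPi ι).withDensity
      fun x => ENNReal.ofReal (Real.exp (gaussLogDensityPi v u x)) := by
  rw [pi_eq_withDensity (γ := fun _ : ι => gaussianReal 0 1)
    (f := fun i x => ENNReal.ofReal (Real.exp (gaussLogDensity (v i) (u i) x)))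
    (fun i => by fun_prop) (fun i => gaussianReal_eq_withDensity (u i) (hv i))]
  congr 1
  ext x
  rw [gaussLogDensityPi, Real.exp_sum, ENNReal.ofReal_prod_of_nonneg fun _ _ => (Real.exp_pos _).le]

/-- This is the normalization required of a Donsker-Varadhan test function, uniformly in the mean
`u`, which will depend on the observation. -/
theorem lintegral_exp_gaussLogDensityPi {ι : Type*} [Fintype ι] (u : ι → ℝ) {v : ι → ℝ}
    (hv : ∀ i, 0 < v i) :
    ∫⁻ x, ENNReal.ofReal (Real.exp (gaussLogDensityPi v u x)) ∂(stdPi ι) = 1 := by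
  have h := congrArg (fun m => m Set.univ) (pi_gaussianReal_eq_withDensity u hv)
  simp only [measure_univ, withDensity_apply _ MeasurableSet.univ, Measure.restrict_univ] at h
  exact h.symm

end GaussianDensity

/-! ### Mutual information with a white Gaussian vector: uncorrelated estimation errors. -/

section MutualInformation

variable {Ω τ : Type*} [MeasurableSpace Ω] [MeasurableSpace τ] {μ : Measure Ω}
  [IsProbabilityMeasure μ]
variable {ι : Type*} [Fintype ι]

/-- The mutual information `I(T; N)`. -/
def mutualInfo {β : Type*} [MeasurableSpace β] (μ : Measure Ω) (T : Ω → τ) (N : Ω → β) : ℝ≥0∞ :=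
  InformationTheory.klDiv (μ.map fun ω => (T ω, N ω)) ((μ.map T).prod (μ.map N))

/-- Data processing: both the joint law and the product law are pushed forward by `id × g`. -/
theorem mutualInfo_comp_le {β β' : Type*} [MeasurableSpace β] [MeasurableSpace β'] {T : Ω → τ}
    {N : Ω → β} (hT : Measurable T) (hN : Measurable N) {g : β → β'} (hg : Measurable g) :
    mutualInfo μ T (fun ω => g (N ω)) ≤ mutualInfo μ T N := by
  have h := InformationTheory.klDiv_map_le (μ.map fun ω => (T ω, N ω))
    ((μ.map T).prod (μ.map N)) (g := Prod.map id g) (by fun_prop)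
  have : IsProbabilityMeasure (μ.map T) := Measure.isProbabilityMeasure_map hT.aemeasurable
  have : IsProbabilityMeasure (μ.map N) := Measure.isProbabilityMeasure_map hN.aemeasurable
  rwa [Measure.map_map (by fun_prop) (by fun_prop), ← Measure.map_prod_map _ _ measurable_id hg,
    Measure.map_id, Measure.map_map hg hN] at h

theorem integral_gaussLogDensityPi {N U : Ω → ι → ℝ} (hN : SqInt μ N) (hU : SqInt μ U)
    (hNN : ∀ i, ∫ ω, N ω i ^ 2 ∂μ = 1) {σ : ι → ℝ}
    (hσ : ∀ i, ∫ ω, (N ω i - U ω i) ^ 2 ∂μ = σ i) (v : ι → ℝ) :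
    Integrable (fun ω => gaussLogDensityPi v (U ω) (N ω)) μ ∧
    ∫ ω, gaussLogDensityPi v (U ω) (N ω) ∂μ
      = ∑ i, (-(1 / 2) * Real.log (v i) - σ i / (2 * v i) + 1 / 2) := by
  have h1 : ∀ i, Integrable (fun ω => (N ω i - U ω i) ^ 2 / (2 * v i)) μ := fun i =>
    ((hN i).sub (hU i)).integrable_sq.div_const _
  have h2 : ∀ i, Integrable (fun ω => N ω i ^ 2 / 2) μ := fun i =>
    (hN i).integrable_sq.div_const _
  have h3 : ∀ i, Integrable (fun ω => gaussLogDensity (v i) (U ω i) (N ω i)) μ := fun i =>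
    ((integrable_const _).sub (h1 i)).add (h2 i)
  refine ⟨integrable_finsetSum _ fun i _ => h3 i, ?_⟩
  unfold gaussLogDensityPi
  rw [integral_finsetSum _ fun i _ => h3 i]
  refine Finset.sum_congr rfl fun i _ => ?_
  unfold gaussLogDensity
  have h4 : Integrable (fun ω => -(1 / 2) * Real.log (v i) - (N ω i - U ω i) ^ 2 / (2 * v i)) μ :=
    (integrable_const _).sub (h1 i)
  rw [integral_add h4 (h2 i), integral_sub (integrable_const _) (h1 i),
    integral_div, integral_div, hσ, hNN]
  simp

/-- A centered Gaussian vector with uncorrelated coordinates has independent coordinates. -/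
theorem map_eq_pi_gaussianReal [DecidableEq ι] {R : Ω → ι → ℝ} (hR : HasGaussianLaw R μ)
    (h0 : ∀ i, ∫ ω, R ω i ∂μ = 0) {σ : ι → ℝ} (hσ : xmom μ R R = diagonal σ) :
    μ.map R = Measure.pi fun i => gaussianReal 0 (σ i).toNNReal := by
  have hL : SqInt μ R := fun i => (hR.eval (X := fun i ω => R ω i) i).memLp_two
  have hcov : ∀ i j, cov[fun ω => R ω i, fun ω => R ω j; μ] = diagonal σ i j := by
    intro i j
    rw [covariance_eq_sub (hL i) (hL j), h0, zero_mul, sub_zero, ← hσ]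
    rfl
  have hind : iIndepFun (fun i ω => R ω i) μ :=
    HasGaussianLaw.iIndepFun_of_covariance_eq_zero hR fun i j hij => by
      rw [hcov, diagonal_apply_ne _ hij]
  have h1 := (iIndepFun_iff_map_fun_eq_pi_map fun i => (hL i).aestronglyMeasurable.aemeasurable).1
    hind
  change μ.map (fun ω i => R ω i) = _
  rw [h1]
  congr 1
  ext1 i
  rw [(hR.eval (X := fun i ω => R ω i) i).map_eq_gaussianReal, h0,
    ← covariance_self (hL i).aestronglyMeasurable.aemeasurable, hcov, diagonal_apply_eq]

theorem map_eq_stdPi [DecidableEq ι] {N : Ω → ι → ℝ} (hN : HasGaussianLaw N μ)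
    (h0 : ∀ i, ∫ ω, N ω i ∂μ = 0) (h1 : xmom μ N N = 1) : μ.map N = stdPi ι := by
  rw [map_eq_pi_gaussianReal hN h0 (σ := fun _ => 1) (by rw [h1, diagonal_one])]
  simp

/-- Donsker-Varadhan with the log-density of N(u(T), diag(σ + ε)) relative to N(0, 1). For each
value of T its exponential integrates to 1 against the law of N. The positive ε is there because
some σᵢ may vanish. -/
theorem mutualInfo_ge_diagonal {T : Ω → τ} {N : Ω → ι → ℝ} (hT : Measurable T)
    (hNm : Measurable N) (hN : μ.map N = stdPi ι) (hN2 : SqInt μ N)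
    (hN1 : ∀ i, ∫ ω, N ω i ^ 2 ∂μ = 1) {u : τ → ι → ℝ} (hu : Measurable u)
    (hU : SqInt μ fun ω => u (T ω)) {σ : ι → ℝ}
    (hσ : ∀ i, ∫ ω, (N ω i - u (T ω) i) ^ 2 ∂μ = σ i) :
    halfLogInv (∏ i, σ i) ≤ mutualInfo μ T N := by
  have hσ0 : ∀ i, 0 ≤ σ i := fun i => hσ i ▸ integral_nonneg fun _ => sq_nonneg _
  have : IsProbabilityMeasure (μ.map T) := Measure.isProbabilityMeasure_map hT.aemeasurable
  have : IsProbabilityMeasure (μ.map N) := Measure.isProbabilityMeasure_map hNm.aemeasurable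
  have : IsProbabilityMeasure (μ.map fun ω => (T ω, N ω)) :=
    Measure.isProbabilityMeasure_map (hT.prodMk hNm).aemeasurable
  have key : ∀ ε : ℝ, 0 < ε →
      ENNReal.ofReal (-(1 / 2) * Real.log (∏ i, (σ i + ε))) ≤ mutualInfo μ T N := by
    intro ε hε
    have hv : ∀ i, 0 < σ i + ε := fun i => by linarith [hσ0 i]
    obtain ⟨hi, hintg⟩ := integral_gaussLogDensityPi hN2 hU hN1 hσ fun i => σ i + ε
    have hφm : Measurable fun p : τ × (ι → ℝ) =>
        gaussLogDensityPi (fun i => σ i + ε) (u p.1) p.2 := by fun_prop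
    have hdv := ofReal_integral_le_klDiv (ρ := μ.map fun ω => (T ω, N ω))
      (π := (μ.map T).prod (μ.map N))
      (φ := fun p => gaussLogDensityPi (fun i => σ i + ε) (u p.1) p.2)
      ((integrable_map_measure hφm.aestronglyMeasurable (hT.prodMk hNm).aemeasurable).2 hi)
      (by
        rw [hN, lintegral_prod _ (by fun_prop)]
        simp only [lintegral_exp_gaussLogDensityPi _ hv, lintegral_const, measure_univ, mul_one])
      hφm
    refine le_trans (ENNReal.ofReal_le_ofReal ?_) hdv
    rw [integral_map (hT.prodMk hNm).aemeasurable hφm.aestronglyMeasurable, hintg,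
      Real.log_prod fun i _ => (hv i).ne', Finset.mul_sum]
    refine Finset.sum_le_sum fun i _ => ?_
    -- The quadratic terms contribute 1/2 - σᵢ / (2 (σᵢ + ε)) ≥ 0, so only the logarithm is kept.
    have : σ i / (2 * (σ i + ε)) ≤ 1 / 2 := by
      rw [div_le_div_iff₀ (by linarith [hv i]) two_pos]
      linarith
    linarith
  by_cases htop : mutualInfo μ T N = ⊤
  · simp [htop]
  -- If the information is a finite k, then ∏ (σᵢ + ε) ≥ exp(-2k) for all ε > 0. In the limit ∏ σᵢ
  -- is positive, so a vanishing product is possible only with infinite information.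
  set k := (mutualInfo μ T N).toReal with hk
  have hlow : ∀ ε : ℝ, 0 < ε → Real.exp (-2 * k) ≤ ∏ i, (σ i + ε) := by
    intro ε hε
    have hp : 0 < ∏ i, (σ i + ε) := Finset.prod_pos fun i _ => by linarith [hσ0 i]
    have h1 := key ε hε
    rw [← ENNReal.ofReal_toReal htop, ENNReal.ofReal_le_ofReal_iff ENNReal.toReal_nonneg] at h1
    rw [← Real.le_log_iff_exp_le hp]
    linarith
  have hlim : Filter.Tendsto (fun ε : ℝ => ∏ i, (σ i + ε)) (nhdsWithin 0 (Set.Ioi 0))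
      (nhds (∏ i, σ i)) := by
    have : Continuous fun ε : ℝ => ∏ i, (σ i + ε) := by fun_prop
    have h := (this.tendsto 0).mono_left (nhdsWithin_le_nhds (s := Set.Ioi 0))
    simpa using h
  have hfin : Real.exp (-2 * k) ≤ ∏ i, σ i :=
    ge_of_tendsto hlim (by filter_upwards [self_mem_nhdsWithin] with ε hε using hlow ε hε)
  have hp : 0 < ∏ i, σ i := (Real.exp_pos _).trans_le hfin
  rw [halfLogInv, if_neg hp.ne', ← ENNReal.ofReal_toReal htop]
  refine ENNReal.ofReal_le_ofReal ?_
  have := (Real.le_log_iff_exp_le hp).2 hfin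
  linarith

/-- Since N = u(T) + R with R Gaussian and independent of T, the law of N given T is N(u(T), diag
σ). Hence the test function of the lower bound, now with ε = 0, is the true log-density of the joint
law relative to the product. -/
theorem mutualInfo_eq_diagonal [DecidableEq ι] {T : Ω → τ} {N : Ω → ι → ℝ} (hT : Measurable T)
    (hNm : Measurable N) (hN : μ.map N = stdPi ι) (hN2 : SqInt μ N)
    (hN1 : ∀ i, ∫ ω, N ω i ^ 2 ∂μ = 1) {u : τ → ι → ℝ} (hu : Measurable u) {σ : ι → ℝ}
    (hσ0 : ∀ i, 0 < σ i) (hR : HasGaussianLaw (fun ω => N ω - u (T ω)) μ)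
    (hR0 : ∀ i, ∫ ω, (N ω - u (T ω)) i ∂μ = 0)
    (hσ : xmom μ (fun ω => N ω - u (T ω)) (fun ω => N ω - u (T ω)) = diagonal σ)
    (hind : IndepFun T (fun ω => N ω - u (T ω)) μ) :
    mutualInfo μ T N = ENNReal.ofReal (-(1 / 2) * Real.log (∏ i, σ i)) := by
  have hR2 : SqInt μ (fun ω => N ω - u (T ω)) :=
    fun i => (hR.eval (X := fun i ω => (N ω - u (T ω)) i) i).memLp_two
  have hU : SqInt μ fun ω => u (T ω) := by
    have := hN2.sub hR2
    simpa using this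
  have hσ' : ∀ i, ∫ ω, (N ω i - u (T ω) i) ^ 2 ∂μ = σ i := by
    intro i
    have := congrFun (congrFun hσ i) i
    rw [diagonal_apply_eq] at this
    rw [← this]
    simp [xmom, sq]
  have : IsProbabilityMeasure (μ.map T) := Measure.isProbabilityMeasure_map hT.aemeasurable
  have : IsProbabilityMeasure (μ.map N) := Measure.isProbabilityMeasure_map hNm.aemeasurable
  have : IsProbabilityMeasure (μ.map fun ω => (T ω, N ω)) :=
    Measure.isProbabilityMeasure_map (hT.prodMk hNm).aemeasurable
  have hφm : Measurable fun p : τ × (ι → ℝ) => gaussLogDensityPi σ (u p.1) p.2 := by fun_prop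
  obtain ⟨hi, hintg⟩ := integral_gaussLogDensityPi hN2 hU hN1 hσ' σ
  have hlaw : μ.map (fun ω => (T ω, N ω)) = ((μ.map T).prod (μ.map N)).withDensity
      fun p => ENNReal.ofReal (Real.exp (gaussLogDensityPi σ (u p.1) p.2)) := by
    refine Measure.ext_of_lintegral _ fun f hf => ?_
    have hRm : Measurable fun ω => N ω - u (T ω) := by fun_prop
    have hpair := (indepFun_iff_map_prod_eq_prod_map_map hT.aemeasurable hRm.aemeasurable).1 hind
    have hg : Measurable fun p : τ × (ι → ℝ) => (p.1, p.2 + u p.1) := by fun_prop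
    have h1 : μ.map (fun ω => (T ω, N ω))
        -- The joint law is the image of the product law of (T, R) under a shear, which shifts the
        -- Gaussian by u(t) on each fibre.
        = (μ.map fun ω => (T ω, N ω - u (T ω))).map fun p => (p.1, p.2 + u p.1) := by
      rw [Measure.map_map hg (hT.prodMk hRm)]
      congr 1
      ext ω <;> simp
    rw [h1, hpair, lintegral_map hf hg, lintegral_prod _ (by fun_prop),
      lintegral_withDensity_eq_lintegral_mul _ (by fun_prop) hf, hN,
      lintegral_prod _ (by fun_prop), map_eq_pi_gaussianReal hR hR0 hσ]
    refine lintegral_congr fun t => ?_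
    have hshift : (Measure.pi fun i => gaussianReal 0 (σ i).toNNReal).map (fun x => x + u t)
        = Measure.pi fun i => gaussianReal (u t i) (σ i).toNNReal := by
      have := Measure.pi_map_pi (μ := fun i => gaussianReal 0 (σ i).toNNReal)
        (f := fun i x => x + u t i) (fun i => by fun_prop)
      simp only [gaussianReal_map_add_const, zero_add] at this
      exact this
    have h2 : ∫⁻ x, f (t, x + u t) ∂(Measure.pi fun i => gaussianReal 0 (σ i).toNNReal)
        = ∫⁻ x, f (t, x) ∂(Measure.pi fun i => gaussianReal (u t i) (σ i).toNNReal) := by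
      rw [← hshift, lintegral_map (by fun_prop) (by fun_prop)]
    simp only [Pi.mul_apply]
    rw [h2, pi_gaussianReal_eq_withDensity _ hσ0,
      lintegral_withDensity_eq_lintegral_mul _ (by fun_prop) (by fun_prop)]
    rfl
  rw [mutualInfo, klDiv_withDensity_exp hφm hlaw
    ((integrable_map_measure hφm.aestronglyMeasurable (hT.prodMk hNm).aemeasurable).2 hi),
    integral_map (hT.prodMk hNm).aemeasurable hφm.aestronglyMeasurable, hintg,
    Real.log_prod fun i _ => (hσ0 i).ne', Finset.mul_sum]
  congr 1
  refine Finset.sum_congr rfl fun i _ => ?_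
  have := (hσ0 i).ne'
  field_simp
  ring

end MutualInformation

/-! ### Mutual information with a white Gaussian vector: general error covariance. -/

section GaussianInformation

variable {Ω τ : Type*} [MeasurableSpace Ω] [MeasurableSpace τ] {μ : Measure Ω}
variable {ι κ : Type*}

theorem sqInt_of_hasGaussianLaw {N : Ω → ι → ℝ} (hN : HasGaussianLaw N μ) : SqInt μ N :=
  fun i => (hN.eval (X := fun i ω => N ω i) i).memLp_two

variable [Fintype ι]

theorem measurable_mulVec [Fintype κ] (A : Matrix κ ι ℝ) : Measurable fun x : ι → ℝ => A *ᵥ x :=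
  (A.mulVecLin.continuous_of_finiteDimensional).measurable

theorem hasGaussianLaw_mulVec [Fintype κ] {N : Ω → ι → ℝ} (hN : HasGaussianLaw N μ)
    (A : Matrix κ ι ℝ) :
    HasGaussianLaw (fun ω => A *ᵥ N ω) μ :=
  hN.map_fun (LinearMap.toContinuousLinearMap A.mulVecLin)

theorem integral_mulVec_eq_zero [IsProbabilityMeasure μ] {N : Ω → ι → ℝ} (hN : SqInt μ N)
    (h0 : ∀ i, ∫ ω, N ω i ∂μ = 0)
    (A : Matrix κ ι ℝ) (k : κ) : ∫ ω, (A *ᵥ N ω) k ∂μ = 0 := by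
  simp only [Matrix.mulVec, dotProduct]
  rw [integral_finsetSum _ fun i _ => ((hN i).integrable one_le_two).const_mul _]
  simp [integral_const_mul, h0]

theorem xmom_rotate {N U : Ω → ι → ℝ} [DecidableEq ι] (hN : SqInt μ N) (hU : SqInt μ U)
    (O : Matrix ι ι ℝ) :
    xmom μ (fun ω => Oᵀ *ᵥ N ω - Oᵀ *ᵥ U ω) (fun ω => Oᵀ *ᵥ N ω - Oᵀ *ᵥ U ω)
      = Oᵀ * xmom μ (fun ω => N ω - U ω) (fun ω => N ω - U ω) * O := by
  simp only [← mulVec_sub]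
  rw [xmom_mulVec_left (hN.sub hU) ((hN.sub hU).mulVec _), xmom_mulVec_right (hN.sub hU)
    (hN.sub hU),
    transpose_transpose, Matrix.mul_assoc]

/-- An orthogonal change of coordinates diagonalizes the error covariance, keeps N white and cannot
increase the information, so the diagonal case applies. -/
theorem mutualInfo_ge [IsProbabilityMeasure μ] [DecidableEq ι] {T : Ω → τ} {N : Ω → ι → ℝ}
    (hT : Measurable T)
    (hNm : Measurable N) (hN : HasGaussianLaw N μ) (hN0 : ∀ i, ∫ ω, N ω i ∂μ = 0)
    (hN1 : xmom μ N N = 1) {u : τ → ι → ℝ} (hu : Measurable u) (hU : SqInt μ fun ω => u (T ω)) :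
    halfLogInv (xmom μ (fun ω => N ω - u (T ω)) (fun ω => N ω - u (T ω))).det
      ≤ mutualInfo μ T N := by
  have hN2 := sqInt_of_hasGaussianLaw hN
  obtain ⟨O, σ, hO, hO', -, hM⟩ := exists_diagonalization (xmom_posSemidef (hN2.sub hU))
  have hrot := xmom_rotate hN2 hU O
  rw [hM, show Oᵀ * (O * diagonal σ * Oᵀ) * O = (Oᵀ * O) * diagonal σ * (Oᵀ * O) by
    simp only [Matrix.mul_assoc], hO, Matrix.one_mul, Matrix.mul_one] at hrot
  have hN1' : xmom μ (fun ω => Oᵀ *ᵥ N ω) (fun ω => Oᵀ *ᵥ N ω) = 1 := by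
    rw [xmom_mulVec_left hN2 (hN2.mulVec _), xmom_mulVec_right hN2 hN2, hN1, Matrix.one_mul,
      transpose_transpose, hO]
  have hdet : (O * diagonal σ * Oᵀ).det = ∏ i, σ i := by
    rw [det_mul_right_comm, hO', Matrix.one_mul, det_diagonal]
  rw [hM, hdet]
  refine le_trans ?_ (mutualInfo_comp_le hT hNm (measurable_mulVec Oᵀ))
  refine mutualInfo_ge_diagonal hT ((measurable_mulVec Oᵀ).comp hNm)
    (map_eq_stdPi (hasGaussianLaw_mulVec hN _) (integral_mulVec_eq_zero hN2 hN0 _) hN1')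
    (hN2.mulVec _) (fun i => ?_) (u := fun t => Oᵀ *ᵥ u t) ((measurable_mulVec Oᵀ).comp hu)
    (hU.mulVec _) fun i => ?_
  · have := congrFun (congrFun hN1' i) i
    rw [one_apply_eq] at this
    rw [← this]
    simp [xmom, sq]
  · have := congrFun (congrFun hrot i) i
    rw [diagonal_apply_eq] at this
    rw [← this]
    simp [xmom, sq]

/-- The diagonal case again; now the rotation must also lose no information, which holds because it
is invertible. If the error covariance is singular the right side is infinite, and the lower bound
alone gives equality. -/
theorem mutualInfo_eq [IsProbabilityMeasure μ] [DecidableEq ι] {T : Ω → τ} {N : Ω → ι → ℝ}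
    (hT : Measurable T)
    (hNm : Measurable N) (hN : HasGaussianLaw N μ) (hN0 : ∀ i, ∫ ω, N ω i ∂μ = 0)
    (hN1 : xmom μ N N = 1) {u : τ → ι → ℝ} (hu : Measurable u)
    (hR : HasGaussianLaw (fun ω => N ω - u (T ω)) μ)
    (hR0 : ∀ i, ∫ ω, (N ω - u (T ω)) i ∂μ = 0)
    (hind : IndepFun T (fun ω => N ω - u (T ω)) μ) :
    mutualInfo μ T N
      = halfLogInv (xmom μ (fun ω => N ω - u (T ω)) (fun ω => N ω - u (T ω))).det := by
  have hN2 := sqInt_of_hasGaussianLaw hN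
  have hU : SqInt μ fun ω => u (T ω) := by
    have := hN2.sub (sqInt_of_hasGaussianLaw hR)
    simpa using this
  refine le_antisymm ?_ (mutualInfo_ge hT hNm hN hN0 hN1 hu hU)
  obtain ⟨O, σ, hO, hO', hσ0, hM⟩ := exists_diagonalization (xmom_posSemidef (hN2.sub hU))
  have hrot := xmom_rotate hN2 hU O
  rw [hM, show Oᵀ * (O * diagonal σ * Oᵀ) * O = (Oᵀ * O) * diagonal σ * (Oᵀ * O) by
    simp only [Matrix.mul_assoc], hO, Matrix.one_mul, Matrix.mul_one] at hrot
  have hN1' : xmom μ (fun ω => Oᵀ *ᵥ N ω) (fun ω => Oᵀ *ᵥ N ω) = 1 := by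
    rw [xmom_mulVec_left hN2 (hN2.mulVec _), xmom_mulVec_right hN2 hN2, hN1, Matrix.one_mul,
      transpose_transpose, hO]
  have hdet : (O * diagonal σ * Oᵀ).det = ∏ i, σ i := by
    rw [det_mul_right_comm, hO', Matrix.one_mul, det_diagonal]
  rw [hM, hdet, halfLogInv]
  split_ifs with h0
  · exact le_top
  have hσ : ∀ i, 0 < σ i := fun i =>
    lt_of_le_of_ne (hσ0 i) fun h => h0 (Finset.prod_eq_zero (Finset.mem_univ i) h.symm)
  have hback : mutualInfo μ T N ≤ mutualInfo μ T fun ω => Oᵀ *ᵥ N ω := by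
    have := mutualInfo_comp_le (μ := μ) hT ((measurable_mulVec Oᵀ).comp hNm) (measurable_mulVec O)
    simpa [Function.comp_def, mulVec_mulVec, hO'] using this
  refine hback.trans (le_of_eq ?_)
  refine mutualInfo_eq_diagonal hT ((measurable_mulVec Oᵀ).comp hNm)
    (map_eq_stdPi (hasGaussianLaw_mulVec hN _) (integral_mulVec_eq_zero hN2 hN0 _) hN1')
    (hN2.mulVec _) (fun i => ?_) (u := fun t => Oᵀ *ᵥ u t) ((measurable_mulVec Oᵀ).comp hu)
    hσ ?_ ?_ hrot ?_
  · have := congrFun (congrFun hN1' i) i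
    rw [one_apply_eq] at this
    rw [← this]
    simp [xmom, sq]
  · simpa only [Function.comp_def, mulVec_sub] using hasGaussianLaw_mulVec hR Oᵀ
  · simpa only [Function.comp_def, mulVec_sub] using
      integral_mulVec_eq_zero (sqInt_of_hasGaussianLaw hR) hR0 Oᵀ
  · simpa only [Function.comp_def, id, mulVec_sub] using
      hind.comp measurable_id (measurable_mulVec Oᵀ)

end GaussianInformation

/-! ### Conditional mutual information as mutual information with a residual. -/

section ConditionalInformation

variable {Ω : Type*} [MeasurableSpace Ω] {μ : Measure Ω}

/-- If `S = a(Y) + R` with `R` independent of `Y`, then `I(S; Z | Y) = I(R; (Y, Z))`. -/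
theorem condMutualInfo_eq_mutualInfo [IsProbabilityMeasure μ] {n : ℕ} {υ ζ : Type*}
    [MeasurableSpace υ]
    [MeasurableSpace ζ] {S R : Ω → Vec n} {Z : Ω → ζ} {Y : Ω → υ} {a : υ → Vec n}
    (hR : Measurable R) (hZ : Measurable Z) (hY : Measurable Y)
    (ha : Measurable a) (hS : ∀ ω, S ω = a (Y ω) + R ω) (hind : IndepFun Y R μ) :
    condMutualInfo μ S Z Y = mutualInfo μ (fun ω => (Y ω, Z ω)) R := by
  have hSm : Measurable S := by
    have : S = fun ω => a (Y ω) + R ω := funext hS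
    rw [this]; fun_prop
  have := Measure.isProbabilityMeasure_map (μ := μ) hR.aemeasurable
  have := Measure.isProbabilityMeasure_map (μ := μ) hY.aemeasurable
  have hYZ : Measurable fun ω => (Y ω, Z ω) := hY.prodMk hZ
  have := Measure.isProbabilityMeasure_map (μ := μ) hYZ.aemeasurable
  -- The kernel that sends y to the law of a(y) + R; it is a version of the conditional law of S
  -- given Y.
  let κ : Kernel υ (Vec n) :=
    ((Kernel.deterministic a ha) ×ₖ (Kernel.const υ (μ.map R))).map fun p => p.1 + p.2
  have : IsMarkovKernel κ := Kernel.IsMarkovKernel.map _ (by fun_prop)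
  have hκ : ∀ (y : υ) (f : Vec n → ℝ≥0∞), Measurable f →
      ∫⁻ s, f s ∂(κ y) = ∫⁻ r, f (a y + r) ∂(μ.map R) := by
    intro y f hf
    rw [Kernel.map_apply _ (by fun_prop), lintegral_map hf (by fun_prop), Kernel.prod_apply,
      Kernel.deterministic_apply, Kernel.const_apply, lintegral_prod _ (by fun_prop),
      lintegral_dirac' _ (by fun_prop)]
  have hcd : condDistrib S Y μ =ᵐ[μ.map Y] κ := by
    refine condDistrib_ae_eq_of_measure_eq_compProd Y hSm.aemeasurable ?_
    refine Measure.ext_of_lintegral _ fun f hf => ?_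
    rw [Measure.lintegral_compProd hf]
    have h1 : μ.map (fun ω => (Y ω, S ω))
        = ((μ.map Y).prod (μ.map R)).map fun p => (p.1, a p.1 + p.2) := by
      rw [← (indepFun_iff_map_prod_eq_prod_map_map hY.aemeasurable hR.aemeasurable).1 hind,
        Measure.map_map (by fun_prop) (by fun_prop)]
      congr 1
      ext ω : 1
      simp [hS]
    rw [h1, lintegral_map hf (by fun_prop), lintegral_prod _ (by fun_prop)]
    exact lintegral_congr fun y => (hκ y (fun s => f (y, s)) (by fun_prop)).symm
  -- This shear replaces R by S. It carries the joint law and the product law of (Y, Z) and R to the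
  -- two laws that define I(S; Z | Y), and relative entropy is invariant under it by data processing
  -- in both directions.
  let g : (υ × ζ) × Vec n → (υ × ζ) × Vec n := fun p => (p.1, a p.1.1 + p.2)
  let g' : (υ × ζ) × Vec n → (υ × ζ) × Vec n := fun p => (p.1, p.2 - a p.1.1)
  have hg : Measurable g := by fun_prop
  have hg' : Measurable g' := by fun_prop
  have href : (μ.map fun ω => (Y ω, Z ω)) ⊗ₘ (condDistrib S Y μ).prodMkRight ζ
      = ((μ.map fun ω => (Y ω, Z ω)).prod (μ.map R)).map g := by
    have h2 : (condDistrib S Y μ).prodMkRight ζ =ᵐ[μ.map fun ω => (Y ω, Z ω)]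
        κ.prodMkRight ζ := by
      have hfst : (μ.map fun ω => (Y ω, Z ω)).map Prod.fst = μ.map Y := by
        rw [Measure.map_map measurable_fst hYZ]; rfl
      rw [← hfst] at hcd
      filter_upwards [ae_of_ae_map measurable_fst.aemeasurable hcd] with p hp
      simpa using hp
    rw [Measure.compProd_congr h2]
    refine Measure.ext_of_lintegral _ fun f hf => ?_
    rw [Measure.lintegral_compProd hf, lintegral_map hf hg, lintegral_prod _ (by fun_prop)]
    exact lintegral_congr fun p => hκ p.1 (fun s => f (p, s)) (by fun_prop)
  have hjoint : μ.map (fun ω => ((Y ω, Z ω), S ω)) = (μ.map fun ω => ((Y ω, Z ω), R ω)).map g := by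
    rw [Measure.map_map hg (by fun_prop)]
    congr 1
    ext ω : 1
    simp [g, hS]
  have hinv : g' ∘ g = id := by
    ext p : 1
    simp [g, g']
  rw [condMutualInfo, href, hjoint, mutualInfo]
  refine le_antisymm (InformationTheory.klDiv_map_le _ _ hg) ?_
  have := InformationTheory.klDiv_map_le ((μ.map fun ω => ((Y ω, Z ω), R ω)).map g)
    (((μ.map fun ω => (Y ω, Z ω)).prod (μ.map R)).map g) hg'
  rwa [Measure.map_map hg' hg, Measure.map_map hg' hg, hinv, Measure.map_id, Measure.map_id] at this

theorem mutualInfo_congr {τ β : Type*} [MeasurableSpace τ] [MeasurableSpace β] {T : Ω → τ}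
    {N N' : Ω → β} (h : N =ᵐ[μ] N') : mutualInfo μ T N = mutualInfo μ T N' := by
  rw [mutualInfo, mutualInfo, Measure.map_congr h]
  congr 1
  refine Measure.map_congr ?_
  filter_upwards [h] with ω hω
  rw [hω]

end ConditionalInformation

/-! ### Conditional laws and expectations in the presence of an independent residual. -/

section Conditioning

theorem condCov_eq_xmom {Ω τ : Type*} [MeasurableSpace Ω] [MeasurableSpace τ]
    {μ : Measure Ω} {m n : ℕ} {U R : Ω → Vec m} {U' R' : Ω → Vec n} {T : Ω → τ}
    (h : μ[U | sig T] =ᵐ[μ] fun ω => U ω - R ω) (h' : μ[U' | sig T] =ᵐ[μ] fun ω => U' ω - R' ω) :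
    condCov μ U U' T = xmom μ (fun ω => (R ω).ofLp) fun ω => (R' ω).ofLp := by
  ext i j
  refine integral_congr_ae ?_
  filter_upwards [h, h'] with ω h1 h2
  rw [h1, h2, sub_sub_cancel, sub_sub_cancel]

variable {Ω τ τ' : Type*} [MeasurableSpace Ω] [MeasurableSpace τ] [MeasurableSpace τ']
  {μ : Measure Ω} [IsProbabilityMeasure μ]

theorem condDistrib_of_indepFun {n : ℕ} {R : Ω → Vec n} {T : Ω → τ} (hR : Measurable R)
    (hT : Measurable T) (h : IndepFun T R μ) :
    condDistrib R T μ =ᵐ[μ.map T] Kernel.const τ (μ.map R) := by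
  have := Measure.isProbabilityMeasure_map (μ := μ) hR.aemeasurable
  refine condDistrib_ae_eq_of_measure_eq_compProd T hR.aemeasurable ?_
  rw [Measure.compProd_const]
  exact (indepFun_iff_map_prod_eq_prod_map_map hT.aemeasurable hR.aemeasurable).1 h

/-- The conditional law of `F(V, R)` when `V` is a function of the condition `T` and `R` is
independent of `T`. -/
theorem condProb_of_indepFun {n : ℕ} {ν ζ : Type*} [MeasurableSpace ν] [MeasurableSpace ζ]
    {R : Ω → Vec n} {T : Ω → τ} (hR : Measurable R) (hT : Measurable T) (h : IndepFun T R μ)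
    {k : τ → ν} (hk : Measurable k) {F : ν × Vec n → ζ} (hF : Measurable F) {B : Set ζ}
    (hB : MeasurableSet B) :
    μ⟦(fun ω => F (k (T ω), R ω)) ⁻¹' B | sig T⟧ =ᵐ[μ]
      fun ω => ∫ r, (F ⁻¹' B).indicator (fun _ => (1 : ℝ)) (k (T ω), r) ∂(μ.map R) := by
  have hm : Measurable fun p : τ × Vec n => (F ⁻¹' B).indicator (fun _ => (1 : ℝ)) (k p.1, p.2) :=
    (measurable_const.indicator (hF hB)).comp (by fun_prop : Measurable fun p : τ × Vec n =>
      (k p.1, p.2))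
  have h1 := condExp_prod_ae_eq_integral_condDistrib (μ := μ) hT hR.aemeasurable
    hm.stronglyMeasurable (Integrable.of_bound (C := 1)
      (hm.comp (hT.prodMk hR)).aestronglyMeasurable (ae_of_all _ fun ω => by
        simp only [Set.indicator]; split_ifs <;> simp))
  have h2 : (fun ω => (F ⁻¹' B).indicator (fun _ => (1 : ℝ)) (k (T ω), R ω))
      = ((fun ω => F (k (T ω), R ω)) ⁻¹' B).indicator fun _ => (1 : ℝ) := by
    ext ω; rfl
  rw [h2] at h1
  refine h1.trans ?_
  filter_upwards [ae_of_ae_map hT.aemeasurable (condDistrib_of_indepFun hR hT h)] with ω hω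
  rw [hω, Kernel.const_apply]

/-- Given either variable, the law of Z = F(V, R) is obtained by fixing V and integrating out R. As
V is also a function of the coarser variable T', the two conditional laws coincide. All Markov
properties of the test channel come from here. -/
theorem condLawEq_of_indepFun {n : ℕ} {ν ζ : Type*} [MeasurableSpace ν] [MeasurableSpace ζ]
    {R : Ω → Vec n} {T : Ω → τ} {T' : Ω → τ'} (hR : Measurable R) (hT : Measurable T)
    (h : IndepFun T R μ) {k : τ → ν} (hk : Measurable k) {k' : τ' → ν} (hk' : Measurable k')
    {g : τ → τ'} (hg : Measurable g) (hgT : ∀ ω, T' ω = g (T ω))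
    (hkk : ∀ ω, k' (T' ω) = k (T ω)) {F : ν × Vec n → ζ} (hF : Measurable F) {Z : Ω → ζ}
    (hZ : ∀ ω, Z ω = F (k (T ω), R ω)) : CondLawEq μ Z T T' := by
  intro B hB
  obtain rfl : T' = g ∘ T := funext hgT
  have h1 := condProb_of_indepFun hR hT h hk hF hB
  have h2 := condProb_of_indepFun hR (hg.comp hT) (h.comp hg measurable_id) hk' hF hB
  simp only [hkk] at h2
  obtain rfl : Z = fun ω => F (k (T ω), R ω) := funext hZ
  exact h1.trans h2.symm

theorem integrable_vec {n : ℕ} {R : Ω → Vec n} (hR : SqInt μ fun ω => (R ω).ofLp) :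
    Integrable R μ :=
  (MemLp.of_eval_piLp hR).integrable one_le_two

theorem integral_vec_eq_zero {n : ℕ} {R : Ω → Vec n} (hR : SqInt μ fun ω => (R ω).ofLp)
    (h0 : ∀ i, ∫ ω, R ω i ∂μ = 0) : ∫ ω, R ω ∂μ = 0 := by
  ext i
  have := (EuclideanSpace.proj i : Vec n →L[ℝ] ℝ).integral_comp_comm (integrable_vec hR)
  simpa [h0] using this.symm

theorem condExp_add_indepFun {n : ℕ} {U R : Ω → Vec n} {T : Ω → τ} {a : τ → Vec n}
    (hR : Measurable R) (hT : Measurable T) (ha : Measurable a)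
    (hU : ∀ ω, U ω = a (T ω) + R ω) (h : IndepFun T R μ) (hU2 : SqInt μ fun ω => (U ω).ofLp)
    (hR2 : SqInt μ fun ω => (R ω).ofLp) (h0 : ∀ i, ∫ ω, R ω i ∂μ = 0) :
    μ[U | sig T] =ᵐ[μ] fun ω => a (T ω) := by
  have hUe : U = (fun ω => a (T ω)) + R := funext hU
  have hai : Integrable (fun ω => a (T ω)) μ := by
    have := (integrable_vec hU2).sub (integrable_vec hR2)
    rwa [hUe, add_sub_cancel_right] at this
  have h1 : μ[fun ω => a (T ω) | sig T] = fun ω => a (T ω) :=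
    condExp_of_stronglyMeasurable hT.comap_le
      (ha.comp (comap_measurable T)).stronglyMeasurable hai
  have h2 : μ[R | sig T] =ᵐ[μ] fun _ => ∫ ω, R ω ∂μ :=
    condExp_indep_eq hR.comap_le hT.comap_le (comap_measurable R).stronglyMeasurable h.symm
  rw [hUe]
  refine (condExp_add hai (integrable_vec hR2) _).trans ?_
  filter_upwards [h2] with ω hω
  rw [Pi.add_apply, h1, hω, integral_vec_eq_zero hR2 h0, add_zero]

/-- A function `e` of `A` that is independent of `D` is independent of `(D, Z)` if `Z` is
conditionally independent of `A` given `D`. -/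
theorem indepFun_of_condLawEq {α δ δ' ε ζ : Type*} [MeasurableSpace α] [MeasurableSpace δ]
    [MeasurableSpace δ'] [MeasurableSpace ε] [MeasurableSpace ζ] {A : Ω → α} {Z : Ω → ζ}
    {f : α → ε} {g : α → δ} {g' : δ → δ'} (hA : Measurable A) (hZ : Measurable Z)
    (hf : Measurable f) (hg : Measurable g) (hg' : Measurable g')
    (hZA : CondLawEq μ Z A fun ω => g' (g (A ω)))
    (h : IndepFun (fun ω => f (A ω)) (fun ω => g (A ω)) μ) :
    IndepFun (fun ω => f (A ω)) (fun ω => (g (A ω), Z ω)) μ := by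
  have he : Measurable fun ω => f (A ω) := hf.comp hA
  have hD : Measurable fun ω => g (A ω) := hg.comp hA
  have hDZ : Measurable fun ω => (g (A ω), Z ω) := hD.prodMk hZ
  have := Measure.isProbabilityMeasure_map (μ := μ) he.aemeasurable
  have := Measure.isProbabilityMeasure_map (μ := μ) hDZ.aemeasurable
  have := Measure.isProbabilityMeasure_map (μ := μ) (he.prodMk hDZ).aemeasurable
  rw [indepFun_iff_map_prod_eq_prod_map_map he.aemeasurable hDZ.aemeasurable]
  refine Measure.ext_prod₃ fun {s} {t} {u} hs ht hu => ?_
  rw [Measure.prod_prod, Measure.map_apply (he.prodMk hDZ) (hs.prod (ht.prod hu)),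
    Measure.map_apply he hs, Measure.map_apply hDZ (ht.prod hu)]
  set q : Ω → ℝ := μ⟦Z ⁻¹' u | sig fun ω => g' (g (A ω))⟧ with hq
  have hZA' := hZA u hu
  have hZi : Integrable ((Z ⁻¹' u).indicator fun _ => (1 : ℝ)) μ :=
    (integrable_const 1).indicator (hZ hu)
  have hmeas : ∀ E : Set Ω, MeasurableSet E → μ.real (E ∩ Z ⁻¹' u)
      = ∫ ω in E, (Z ⁻¹' u).indicator (fun _ => (1 : ℝ)) ω ∂μ := by
    intro E hE
    rw [setIntegral_indicator (hZ hu)]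
    simp
  have hcond : ∀ E : Set Ω, MeasurableSet[sig A] E → μ.real (E ∩ Z ⁻¹' u) = ∫ ω in E, q ω ∂μ := by
    intro E hE
    rw [hmeas E (hA.comap_le _ hE), ← setIntegral_condExp hA.comap_le hZi hE]
    exact integral_congr_ae (ae_restrict_of_ae hZA')
  set E₁ : Set Ω := (fun ω => f (A ω)) ⁻¹' s
  set E₂ : Set Ω := (fun ω => g (A ω)) ⁻¹' t
  have hE₁ : MeasurableSet[sig A] E₁ := ⟨f ⁻¹' s, hf hs, rfl⟩
  have hE₂ : MeasurableSet[sig A] E₂ := ⟨g ⁻¹' t, hg ht, rfl⟩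
  have hs1 : (fun ω => (f (A ω), g (A ω), Z ω)) ⁻¹' (s ×ˢ t ×ˢ u) = (E₁ ∩ E₂) ∩ Z ⁻¹' u := by
    ext ω
    simp only [Set.mem_preimage, Set.mem_prod, Set.mem_inter_iff, E₁, E₂]
    tauto
  have hs2 : (fun ω => (g (A ω), Z ω)) ⁻¹' (t ×ˢ u) = E₂ ∩ Z ⁻¹' u := rfl
  rw [hs1, hs2, ← ENNReal.toReal_eq_toReal_iff' (by finiteness) (by finiteness),
    ENNReal.toReal_mul]
  change μ.real _ = μ.real _ * μ.real _
  rw [hcond _ (hE₁.inter hE₂), hcond _ hE₂]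
  have hD' : Measurable[sig fun ω => g (A ω)] fun ω => g' (g (A ω)) :=
    hg'.comp (comap_measurable fun ω => g (A ω))
  have hqm : Measurable[sig fun ω => g (A ω)] (E₂.indicator q) :=
    ((stronglyMeasurable_condExp.measurable).mono hD'.comap_le le_rfl).indicator ⟨t, ht, rfl⟩
  have h1m : Measurable[sig fun ω => f (A ω)] (E₁.indicator fun _ => (1 : ℝ)) :=
    measurable_const.indicator ⟨s, hs, rfl⟩
  -- The conditional probability q depends only on g'(g(A)), so this compares a function of f(A)
  -- with a function of g(A). Independence then factors the integral of q over E₁ ∩ E₂.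
  have hind : IndepFun (E₁.indicator fun _ => (1 : ℝ)) (E₂.indicator q) μ := by
    rw [IndepFun_iff_Indep]
    exact indep_of_indep_of_le_left (indep_of_indep_of_le_right h hqm.comap_le) h1m.comap_le
  have hmul := hind.integral_mul_eq_mul_integral
    (h1m.mono he.comap_le le_rfl).aestronglyMeasurable
    (hqm.mono hD.comap_le le_rfl).aestronglyMeasurable
  have hE₁' := hA.comap_le _ hE₁
  have hE₂' := hA.comap_le _ hE₂
  rw [integral_indicator hE₂', integral_indicator hE₁'] at hmul
  rw [← integral_indicator (hE₁'.inter hE₂')]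
  have hfun : (E₁.indicator fun _ => (1 : ℝ)) * E₂.indicator q = (E₁ ∩ E₂).indicator q := by
    ext ω
    by_cases h1 : ω ∈ E₁ <;> by_cases h2 : ω ∈ E₂ <;> simp [h1, h2]
  rw [← hfun, hmul]
  simp

end Conditioning

/-! ### Linear functions of a Gaussian vector. -/

section GaussianLinear

/-- `U` is a continuous linear function of `G`. -/
def LinOf {Ω E : Type*} [NormedAddCommGroup E] [NormedSpace ℝ E] {ι : Type*} (G : Ω → E)
    (U : Ω → ι → ℝ) : Prop :=
  ∃ L : E →L[ℝ] (ι → ℝ), ∀ ω, U ω = L (G ω)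

section

variable {Ω E : Type*} [NormedAddCommGroup E] [NormedSpace ℝ E] {G : Ω → E} {ι κ : Type*}

theorem LinOf.sub {U V : Ω → ι → ℝ} (hU : LinOf G U) (hV : LinOf G V) :
    LinOf G fun ω => U ω - V ω := by
  obtain ⟨L, hL⟩ := hU
  obtain ⟨M, hM⟩ := hV
  exact ⟨L - M, fun ω => by simp only [hL, hM, _root_.sub_apply]⟩

theorem LinOf.add {U V : Ω → ι → ℝ} (hU : LinOf G U) (hV : LinOf G V) :
    LinOf G fun ω => U ω + V ω := by
  obtain ⟨L, hL⟩ := hU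
  obtain ⟨M, hM⟩ := hV
  exact ⟨L + M, fun ω => by simp only [hL, hM, _root_.add_apply]⟩

theorem LinOf.mulVec [Fintype ι] [Fintype κ] {U : Ω → ι → ℝ} (hU : LinOf G U)
    (A : Matrix κ ι ℝ) : LinOf G fun ω => A *ᵥ U ω := by
  obtain ⟨L, hL⟩ := hU
  exact ⟨(LinearMap.toContinuousLinearMap A.mulVecLin).comp L, fun ω => by simp only [hL]; rfl⟩

end

variable {Ω : Type*} [MeasurableSpace Ω] {μ : Measure Ω}
variable {E : Type*} [NormedAddCommGroup E] [NormedSpace ℝ E] [MeasurableSpace E] [BorelSpace E]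
  {G : Ω → E}
variable {ι κ κ' : Type*}

theorem LinOf.hasGaussianLaw [Fintype ι] {U : Ω → ι → ℝ} (hU : LinOf G U)
    (hG : HasGaussianLaw G μ) : HasGaussianLaw U μ := by
  obtain ⟨L, hL⟩ := hU
  rw [show U = fun ω => L (G ω) from funext hL]
  exact hG.map_fun L

theorem LinOf.sqInt [Fintype ι] {U : Ω → ι → ℝ} (hU : LinOf G U) (hG : HasGaussianLaw G μ) :
    SqInt μ U :=
  sqInt_of_hasGaussianLaw (hU.hasGaussianLaw hG)

theorem LinOf.integral_eq_zero [CompleteSpace E] [SecondCountableTopology E] {U : Ω → ι → ℝ}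
    (hU : LinOf G U) (hG : HasGaussianLaw G μ) (h0 : ∫ ω, G ω ∂μ = 0) (i : ι) :
    ∫ ω, U ω i ∂μ = 0 := by
  obtain ⟨L, hL⟩ := hU
  have := ((ContinuousLinearMap.proj (R := ℝ) (φ := fun _ : ι => ℝ) i).comp L).integral_comp_comm
    hG.integrable
  rw [h0, map_zero] at this
  simpa [hL] using this

/-- Jointly Gaussian and uncorrelated implies independent. The vectors V and V' are stacked into one
vector indexed by κ ⊕ κ', so that uncorrelatedness with each yields independence from the pair. -/
theorem LinOf.indepFun [Fintype ι] [Fintype κ] [Fintype κ'] [CompleteSpace E]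
    [SecondCountableTopology E] {U : Ω → ι → ℝ}
    {V : Ω → κ → ℝ} {V' : Ω → κ' → ℝ} (hG : HasGaussianLaw G μ) (h0 : ∫ ω, G ω ∂μ = 0)
    (hU : LinOf G U) (hV : LinOf G V) (hV' : LinOf G V') (hUV : xmom μ U V = 0)
    (hUV' : xmom μ U V' = 0) : IndepFun (fun ω => (V ω, V' ω)) U μ := by
  have := hG.isProbabilityMeasure
  have hU2 := hU.sqInt hG
  have hV2 := hV.sqInt hG
  have hV2' := hV'.sqInt hG
  have hU0 := hU.integral_eq_zero hG h0
  obtain ⟨L, hL⟩ := hU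
  obtain ⟨M, hM⟩ := hV
  obtain ⟨M', hM'⟩ := hV'
  let K : E →L[ℝ] (κ ⊕ κ' → ℝ) := ContinuousLinearMap.pi
    (Sum.elim (fun k => (ContinuousLinearMap.proj (R := ℝ) (φ := fun _ : κ => ℝ) k).comp M)
      fun k => (ContinuousLinearMap.proj (R := ℝ) (φ := fun _ : κ' => ℝ) k).comp M')
  have hK : ∀ ω, K (G ω) = Sum.elim (V ω) (V' ω) := by
    intro ω
    ext (k | k) <;> simp [K, hM, hM']
  have hpair : HasGaussianLaw (fun ω => (U ω, Sum.elim (V ω) (V' ω))) μ := by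
    have := hG.map_fun (L.prod K)
    simpa [hL, hK] using this
  have hcov : ∀ i (j : κ ⊕ κ'), cov[fun ω => U ω i, fun ω => Sum.elim (V ω) (V' ω) j; μ] = 0 := by
    rintro i (j | j)
    · simp only [Sum.elim_inl]
      rw [covariance_eq_sub (hU2 i) (hV2 j), hU0, zero_mul, sub_zero]
      exact congrFun (congrFun hUV i) j
    · simp only [Sum.elim_inr]
      rw [covariance_eq_sub (hU2 i) (hV2' j), hU0, zero_mul, sub_zero]
      exact congrFun (congrFun hUV' i) j
  have h := HasGaussianLaw.indepFun_of_covariance_eval (X := fun i ω => U ω i)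
    (Y := fun j ω => Sum.elim (V ω) (V' ω) j) hpair hcov
  exact (h.comp measurable_id (ψ := fun x : κ ⊕ κ' → ℝ => (fun k => x (Sum.inl k),
    fun k => x (Sum.inr k))) (by fun_prop)).symm

end GaussianLinear

/-! ### Residuals of X and S given Y, and the source covariances. -/

section SourceMoments

variable {nx ns ny : ℕ}

/-- The matrix `Q_{X,Y} Q_Y⁻¹` of the estimator `E[X|Y]`. -/
def gainX (P : Measure (Src nx ns ny)) : Matrix (Fin nx) (Fin ny) ℝ := covXY P * (covY P)⁻¹

/-- The matrix `Q_{S,Y} Q_Y⁻¹` of the estimator `E[S|Y]`. -/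
def gainS (P : Measure (Src nx ns ny)) : Matrix (Fin ns) (Fin ny) ℝ := covSY P * (covY P)⁻¹

/-- The coordinates of `X`. -/
def cx (v : Src nx ns ny) : Fin nx → ℝ := (srcX v).ofLp

/-- The coordinates of `S`. -/
def cs (v : Src nx ns ny) : Fin ns → ℝ := (srcS v).ofLp

/-- The coordinates of `Y`. -/
def cy (v : Src nx ns ny) : Fin ny → ℝ := (srcY v).ofLp

/-- The coordinates of `X - E[X|Y]`. -/
def resX (P : Measure (Src nx ns ny)) (v : Src nx ns ny) : Fin nx → ℝ := cx v - gainX P *ᵥ cy v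

/-- The coordinates of `S - E[S|Y]`. -/
def resS (P : Measure (Src nx ns ny)) (v : Src nx ns ny) : Fin ns → ℝ := cs v - gainS P *ᵥ cy v

@[fun_prop]
theorem measurable_srcX : Measurable (srcX : Src nx ns ny → _) := measurable_fst

@[fun_prop]
theorem measurable_srcS : Measurable (srcS : Src nx ns ny → _) :=
  measurable_fst.comp measurable_snd

@[fun_prop]
theorem measurable_srcY : Measurable (srcY : Src nx ns ny → _) :=
  measurable_snd.comp measurable_snd

theorem linOf_cx : LinOf (id : Src nx ns ny → _) cx :=
  ⟨(EuclideanSpace.equiv (Fin nx) ℝ : Vec nx →L[ℝ] _).comp (ContinuousLinearMap.fst ℝ _ _),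
    fun _ => rfl⟩

theorem linOf_cs : LinOf (id : Src nx ns ny → _) cs :=
  ⟨(EuclideanSpace.equiv (Fin ns) ℝ : Vec ns →L[ℝ] _).comp
    ((ContinuousLinearMap.fst ℝ _ _).comp (ContinuousLinearMap.snd ℝ _ _)), fun _ => rfl⟩

theorem linOf_cy : LinOf (id : Src nx ns ny → _) cy :=
  ⟨(EuclideanSpace.equiv (Fin ny) ℝ : Vec ny →L[ℝ] _).comp
    ((ContinuousLinearMap.snd ℝ _ _).comp (ContinuousLinearMap.snd ℝ _ _)), fun _ => rfl⟩

theorem LinOf.measurable {E ι : Type*} [NormedAddCommGroup E] [NormedSpace ℝ E]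
    [MeasurableSpace E] [BorelSpace E] [Countable ι] {U : E → ι → ℝ} (hU : LinOf id U) :
    Measurable U := by
  obtain ⟨L, hL⟩ := hU
  rw [show U = fun v => L v from funext hL]
  exact measurable_pi_iff.2 fun i => ((continuous_apply i).comp L.continuous).measurable

theorem LinOf.comp {Ω Ω' E ι : Type*} [NormedAddCommGroup E] [NormedSpace ℝ E] {G : Ω → E}
    {U : Ω → ι → ℝ} (hU : LinOf G U) (ξ : Ω' → Ω) : LinOf (fun ω => G (ξ ω)) fun ω => U (ξ ω) := by
  obtain ⟨L, hL⟩ := hU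
  exact ⟨L, fun ω => hL _⟩

theorem linOf_resX (P : Measure (Src nx ns ny)) : LinOf id (resX P) :=
  linOf_cx.sub (linOf_cy.mulVec _)

theorem linOf_resS (P : Measure (Src nx ns ny)) : LinOf id (resS P) :=
  linOf_cs.sub (linOf_cy.mulVec _)

variable {P : Measure (Src nx ns ny)}

theorem xmom_comp {Ω ι κ : Type*} [MeasurableSpace Ω] {μ : Measure Ω} {ξ : Ω → Src nx ns ny}
    [Countable ι] [Countable κ]
    (hξ : Measurable ξ) (hlaw : μ.map ξ = P) {U : Src nx ns ny → ι → ℝ}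
    {V : Src nx ns ny → κ → ℝ} (hU : LinOf id U) (hV : LinOf id V) :
    xmom μ (fun ω => U (ξ ω)) (fun ω => V (ξ ω)) = xmom P U V := by
  ext i j
  have hm : Measurable fun v => U v i * V v j :=
    ((measurable_pi_apply i).comp hU.measurable).mul ((measurable_pi_apply j).comp hV.measurable)
  rw [xmom, xmom, of_apply, of_apply, ← hlaw,
    integral_map hξ.aemeasurable hm.aestronglyMeasurable]

variable [IsGaussian P]

theorem crossCov_eq_xmom {m n : ℕ} {U : Src nx ns ny → Vec m} {V : Src nx ns ny → Vec n}
    (hmean : ∫ v, v ∂P = 0) (hU : LinOf id fun v => (U v).ofLp)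
    (hV : LinOf id fun v => (V v).ofLp) :
    crossCov P U V = xmom P (fun v => (U v).ofLp) fun v => (V v).ofLp := by
  have hG : HasGaussianLaw (id : Src nx ns ny → _) P := IsGaussian.hasGaussianLaw_id
  ext i j
  rw [crossCov, of_apply, covariance_eq_sub (hU.sqInt hG i) (hV.sqInt hG j),
    hU.integral_eq_zero hG hmean, zero_mul, sub_zero]
  rfl

theorem xmom_cx_cy (hmean : ∫ v, v ∂P = 0) : xmom P cx cy = covXY P :=
  (crossCov_eq_xmom hmean linOf_cx linOf_cy).symm

theorem xmom_cs_cy (hmean : ∫ v, v ∂P = 0) : xmom P cs cy = covSY P :=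
  (crossCov_eq_xmom hmean linOf_cs linOf_cy).symm

theorem xmom_cy_cy (hmean : ∫ v, v ∂P = 0) : xmom P cy cy = covY P :=
  (crossCov_eq_xmom hmean linOf_cy linOf_cy).symm

theorem LinOf.sqInt_id {ι : Type*} [Fintype ι] {U : Src nx ns ny → ι → ℝ} (hU : LinOf id U) :
    SqInt P U := hU.sqInt IsGaussian.hasGaussianLaw_id

theorem xmom_resX_cy (hmean : ∫ v, v ∂P = 0) (hY : (covY P).PosDef) : xmom P (resX P) cy = 0 := by
  unfold resX
  rw [xmom_sub_left linOf_cx.sqInt_id (linOf_cy.mulVec _).sqInt_id linOf_cy.sqInt_id,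
    xmom_mulVec_left linOf_cy.sqInt_id linOf_cy.sqInt_id, xmom_cx_cy hmean, xmom_cy_cy hmean, gainX,
    nonsing_inv_mul_cancel_right _ _ ((isUnit_iff_isUnit_det _).1 hY.isUnit), sub_self]

theorem xmom_resS_cy (hmean : ∫ v, v ∂P = 0) (hY : (covY P).PosDef) : xmom P (resS P) cy = 0 := by
  unfold resS
  rw [xmom_sub_left linOf_cs.sqInt_id (linOf_cy.mulVec _).sqInt_id linOf_cy.sqInt_id,
    xmom_mulVec_left linOf_cy.sqInt_id linOf_cy.sqInt_id, xmom_cs_cy hmean, xmom_cy_cy hmean, gainS,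
    nonsing_inv_mul_cancel_right _ _ ((isUnit_iff_isUnit_det _).1 hY.isUnit), sub_self]

theorem LinOf.indepFun_id {ι κ κ' : Type*} [Fintype ι] [Fintype κ] [Fintype κ']
    {U : Src nx ns ny → ι → ℝ} {V : Src nx ns ny → κ → ℝ} {V' : Src nx ns ny → κ' → ℝ}
    (hmean : ∫ v, v ∂P = 0) (hU : LinOf id U) (hV : LinOf id V) (hV' : LinOf id V')
    (hUV : xmom P U V = 0) (hUV2 : xmom P U V' = 0) : IndepFun (fun v => (V v, V' v)) U P :=
  LinOf.indepFun IsGaussian.hasGaussianLaw_id hmean hU hV hV' hUV hUV2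

/-- The estimator `E[U|Y]` of a linear function `U` of the source. -/
theorem condExp_srcY {n : ℕ} {U : Src nx ns ny → Vec n} {K : Matrix (Fin n) (Fin ny) ℝ}
    (hmean : ∫ v, v ∂P = 0) (hU : LinOf id fun v => (U v).ofLp)
    (h : xmom P (fun v => (U v).ofLp - K *ᵥ cy v) cy = 0) :
    P[U | sig srcY] =ᵐ[P] fun v => U v - WithLp.toLp 2 ((U v).ofLp - K *ᵥ cy v) := by
  have hR : LinOf id fun v : Src nx ns ny => (U v).ofLp - K *ᵥ cy v := hU.sub (linOf_cy.mulVec K)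
  have hind : IndepFun srcY (fun v => WithLp.toLp 2 ((U v).ofLp - K *ᵥ cy v)) P :=
    (hR.indepFun_id hmean linOf_cy linOf_cy h h).comp
      (φ := fun p : (Fin ny → ℝ) × (Fin ny → ℝ) => (WithLp.toLp 2 p.1 : Vec ny))
      (ψ := fun x : Fin n → ℝ => (WithLp.toLp 2 x : Vec n)) (by fun_prop) (by fun_prop)
  have hRm : Measurable fun v => (WithLp.toLp 2 ((U v).ofLp - K *ᵥ cy v) : Vec n) :=
    (by fun_prop : Measurable fun x : Fin n → ℝ => (WithLp.toLp 2 x : Vec n)).comp hR.measurable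
  have h1 := condExp_add_indepFun (μ := P) (U := U)
    (a := fun y : Vec ny => (WithLp.toLp 2 (K *ᵥ y.ofLp) : Vec n))
    hRm measurable_srcY ((by fun_prop : Measurable fun x : Fin n → ℝ =>
      (WithLp.toLp 2 x : Vec n)).comp
      ((measurable_mulVec K).comp (by fun_prop : Measurable fun y : Vec ny => y.ofLp)))
    (fun v => by
      change _ = WithLp.toLp 2 (K *ᵥ cy v) + _
      rw [← WithLp.toLp_add, add_sub_cancel, WithLp.toLp_ofLp]) hind hU.sqInt_id hR.sqInt_id
    (hR.integral_eq_zero IsGaussian.hasGaussianLaw_id hmean)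
  filter_upwards [h1] with v hv
  rw [hv, WithLp.toLp_sub, WithLp.toLp_ofLp, sub_sub_cancel]
  rfl

theorem covXgY_eq (hmean : ∫ v, v ∂P = 0) (hY : (covY P).PosDef) :
    covXgY P = xmom P (resX P) (resX P) :=
  have h := condExp_srcY (U := srcX) hmean linOf_cx (xmom_resX_cy hmean hY)
  condCov_eq_xmom h h

theorem covSgY_eq (hmean : ∫ v, v ∂P = 0) (hY : (covY P).PosDef) :
    covSgY P = xmom P (resS P) (resS P) :=
  have h := condExp_srcY (U := srcS) hmean linOf_cs (xmom_resS_cy hmean hY)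
  condCov_eq_xmom h h

theorem covXSgY_eq (hmean : ∫ v, v ∂P = 0) (hY : (covY P).PosDef) :
    covXSgY P = xmom P (resX P) (resS P) :=
  condCov_eq_xmom (condExp_srcY (U := srcX) hmean linOf_cx (xmom_resX_cy hmean hY))
    (condExp_srcY (U := srcS) hmean linOf_cs (xmom_resS_cy hmean hY))

end SourceMoments

/-! ### Whitening the residual of S, and the innovation of X. -/

section Whitening

theorem indepFun_comp_of_map {Ω Ω' α β : Type*} [MeasurableSpace Ω] [MeasurableSpace Ω']
    [MeasurableSpace α] [MeasurableSpace β] {μ : Measure Ω} {P : Measure Ω'} {ξ : Ω → Ω'}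
    (hξ : Measurable ξ) (hlaw : μ.map ξ = P) {f : Ω' → α} {g : Ω' → β} (hf : Measurable f)
    (hg : Measurable g) (h : IndepFun f g P) :
    IndepFun (fun ω => f (ξ ω)) (fun ω => g (ξ ω)) μ := by
  rw [indepFun_iff_measure_inter_preimage_eq_mul] at h ⊢
  intro s t hs ht
  have h1 := h s t hs ht
  rw [← hlaw, Measure.map_apply hξ ((hf hs).inter (hg ht)), Measure.map_apply hξ (hf hs),
    Measure.map_apply hξ (hg ht)] at h1
  exact h1

variable {nx ns ny r : ℕ}

/-- A factorization `Q_{S|Y} = B Bᵀ` with a left inverse `Bp` of `B`. -/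
structure IsWhitening (P : Measure (Src nx ns ny)) (B : Matrix (Fin ns) (Fin r) ℝ)
    (Bp : Matrix (Fin r) (Fin ns) ℝ) : Prop where
  factor : covSgY P = B * Bᵀ
  left_inv : Bp * B = 1

/-- The white vector `N` with `S - E[S|Y] = B N`. -/
def whiteS (P : Measure (Src nx ns ny)) (Bp : Matrix (Fin r) (Fin ns) ℝ) (v : Src nx ns ny) :
    Fin r → ℝ := Bp *ᵥ resS P v

/-- The matrix `E[X Nᵀ]`. -/
def whiteC (P : Measure (Src nx ns ny)) (Bp : Matrix (Fin r) (Fin ns) ℝ) :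
    Matrix (Fin nx) (Fin r) ℝ := covXSgY P * Bpᵀ

/-- The part of `X` that is independent of `(S, Y)`. -/
def innov (P : Measure (Src nx ns ny)) (Bp : Matrix (Fin r) (Fin ns) ℝ) (v : Src nx ns ny) :
    Fin nx → ℝ := resX P v - whiteC P Bp *ᵥ whiteS P Bp v

theorem linOf_whiteS (P : Measure (Src nx ns ny)) (Bp : Matrix (Fin r) (Fin ns) ℝ) :
    LinOf id (whiteS P Bp) := (linOf_resS P).mulVec _

theorem linOf_innov (P : Measure (Src nx ns ny)) (Bp : Matrix (Fin r) (Fin ns) ℝ) :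
    LinOf id (innov P Bp) := (linOf_resX P).sub ((linOf_whiteS P Bp).mulVec _)

variable {P : Measure (Src nx ns ny)} [IsGaussian P] {B : Matrix (Fin ns) (Fin r) ℝ}
  {Bp : Matrix (Fin r) (Fin ns) ℝ}

theorem exists_isWhitening (hmean : ∫ v, v ∂P = 0) (hY : (covY P).PosDef) :
    ∃ (r : ℕ) (B : Matrix (Fin ns) (Fin r) ℝ) (Bp : Matrix (Fin r) (Fin ns) ℝ),
      IsWhitening P B Bp := by
  have h : (covSgY P).PosSemidef := by
    rw [covSgY_eq hmean hY]
    exact xmom_posSemidef (linOf_resS P).sqInt_id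
  obtain ⟨r, B, Bp, h1, h2, -⟩ := exists_factor h
  exact ⟨r, B, Bp, h1, h2⟩

theorem IsWhitening.xmom_whiteS (h : IsWhitening P B Bp) (hmean : ∫ v, v ∂P = 0)
    (hY : (covY P).PosDef) : xmom P (whiteS P Bp) (whiteS P Bp) = 1 := by
  have hS := (linOf_resS P).sqInt_id (P := P)
  have h2 : Bᵀ * Bpᵀ = 1 := by rw [← transpose_mul, h.left_inv, transpose_one]
  unfold whiteS
  rw [xmom_mulVec_left hS (hS.mulVec _), xmom_mulVec_right hS hS, ← covSgY_eq hmean hY, h.factor,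
    Matrix.mul_assoc, h2, Matrix.mul_one, h.left_inv]

/-- The residual has covariance B Bᵀ, which 1 - B Bp annihilates; so the residual lies almost surely
in the range of B. -/
theorem IsWhitening.resS_ae (h : IsWhitening P B Bp) (hmean : ∫ v, v ∂P = 0)
    (hY : (covY P).PosDef) : resS P =ᵐ[P] fun v => B *ᵥ whiteS P Bp v := by
  have h1 : (1 - B * Bp) * xmom P (resS P) (resS P) = 0 := by
    rw [← covSgY_eq hmean hY, h.factor, Matrix.sub_mul, Matrix.one_mul, Matrix.mul_assoc,
      ← Matrix.mul_assoc Bp, h.left_inv, Matrix.one_mul, sub_self]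
  filter_upwards [ae_mulVec_eq_zero (linOf_resS P).sqInt_id h1] with v hv
  rw [sub_mulVec, one_mulVec, sub_eq_zero] at hv
  rw [whiteS, mulVec_mulVec]
  exact hv

/-- By this factorization H Q_{X,S|Y}ᵀ = (H B) Cᵀ, so the constraints see H only through H B. -/
theorem IsWhitening.covXSgY_factor (h : IsWhitening P B Bp) (hmean : ∫ v, v ∂P = 0)
    (hY : (covY P).PosDef) : covXSgY P = whiteC P Bp * Bᵀ := by
  have hS := (linOf_resS P).sqInt_id (P := P)
  have hX := (linOf_resX P).sqInt_id (P := P)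
  rw [whiteC, covXSgY_eq hmean hY]
  conv_lhs => rw [xmom_congr (ae_eq_refl _) (h.resS_ae hmean hY)]
  unfold whiteS
  rw [xmom_mulVec_right hX (hS.mulVec _), xmom_mulVec_right hX hS]

theorem xmom_resX_whiteS (hmean : ∫ v, v ∂P = 0) (hY : (covY P).PosDef) :
    xmom P (resX P) (whiteS P Bp) = whiteC P Bp := by
  unfold whiteS
  rw [xmom_mulVec_right (linOf_resX P).sqInt_id (linOf_resS P).sqInt_id, ← covXSgY_eq hmean hY,
    whiteC]

theorem xmom_whiteS_cy (hmean : ∫ v, v ∂P = 0) (hY : (covY P).PosDef) :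
    xmom P (whiteS P Bp) cy = 0 := by
  unfold whiteS
  rw [xmom_mulVec_left (linOf_resS P).sqInt_id linOf_cy.sqInt_id, xmom_resS_cy hmean hY,
    Matrix.mul_zero]

theorem IsWhitening.xmom_innov_whiteS (h : IsWhitening P B Bp) (hmean : ∫ v, v ∂P = 0)
    (hY : (covY P).PosDef) : xmom P (innov P Bp) (whiteS P Bp) = 0 := by
  have hN := (linOf_whiteS P Bp).sqInt_id (P := P)
  unfold innov
  rw [xmom_sub_left (linOf_resX P).sqInt_id (hN.mulVec _) hN, xmom_mulVec_left hN hN,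
    h.xmom_whiteS hmean hY, xmom_resX_whiteS hmean hY, Matrix.mul_one, sub_self]

theorem IsWhitening.xmom_innov_resS (h : IsWhitening P B Bp) (hmean : ∫ v, v ∂P = 0)
    (hY : (covY P).PosDef) : xmom P (innov P Bp) (resS P) = 0 := by
  rw [xmom_congr (ae_eq_refl _) (h.resS_ae hmean hY),
    xmom_mulVec_right (linOf_innov P Bp).sqInt_id (linOf_whiteS P Bp).sqInt_id,
    h.xmom_innov_whiteS hmean hY, Matrix.zero_mul]

theorem xmom_innov_cy (hmean : ∫ v, v ∂P = 0) (hY : (covY P).PosDef) :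
    xmom P (innov P Bp) cy = 0 := by
  unfold innov
  rw [xmom_sub_left (linOf_resX P).sqInt_id ((linOf_whiteS P Bp).mulVec _).sqInt_id
    linOf_cy.sqInt_id, xmom_mulVec_left (linOf_whiteS P Bp).sqInt_id linOf_cy.sqInt_id,
    xmom_whiteS_cy hmean hY, xmom_resX_cy hmean hY, Matrix.mul_zero, sub_self]

theorem measurable_toLp_mulVec {m n : ℕ} (A : Matrix (Fin m) (Fin n) ℝ) :
    Measurable fun y : Vec n => (WithLp.toLp 2 (A *ᵥ y.ofLp) : Vec m) :=
  (by fun_prop : Measurable fun x : Fin m → ℝ => (WithLp.toLp 2 x : Vec m)).comp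
    ((measurable_mulVec A).comp (by fun_prop : Measurable fun y : Vec n => y.ofLp))

/-- The conditional mutual information `I(S; Z | Y)` in terms of the white vector. -/
theorem IsWhitening.condMutualInfo_eq (h : IsWhitening P B Bp) (hmean : ∫ v, v ∂P = 0)
    (hY : (covY P).PosDef) {Ω ζ : Type*} [MeasurableSpace Ω] [MeasurableSpace ζ] {μ : Measure Ω}
    [IsProbabilityMeasure μ] {ξ : Ω → Src nx ns ny} (hξ : Measurable ξ) (hlaw : μ.map ξ = P)
    {Z : Ω → ζ} (hZ : Measurable Z) :
    condMutualInfo μ (fun ω => srcS (ξ ω)) Z (fun ω => srcY (ξ ω))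
      = mutualInfo μ (fun ω => (srcY (ξ ω), Z ω)) fun ω => whiteS P Bp (ξ ω) := by
  have hto : Measurable fun x : Fin ns → ℝ => (WithLp.toLp 2 x : Vec ns) := by fun_prop
  have hRm : Measurable fun ω => (WithLp.toLp 2 (resS P (ξ ω)) : Vec ns) :=
    hto.comp ((linOf_resS P).measurable.comp hξ)
  have hindP : IndepFun srcY (fun v => (WithLp.toLp 2 (resS P v) : Vec ns)) P :=
    ((linOf_resS P).indepFun_id hmean linOf_cy linOf_cy (xmom_resS_cy hmean hY)
      (xmom_resS_cy hmean hY)).comp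
      (φ := fun p : (Fin ny → ℝ) × (Fin ny → ℝ) => (WithLp.toLp 2 p.1 : Vec ny))
      (ψ := fun x : Fin ns → ℝ => (WithLp.toLp 2 x : Vec ns)) (by fun_prop) (by fun_prop)
  have hind : IndepFun (fun ω => srcY (ξ ω))
      (fun ω => (WithLp.toLp 2 (resS P (ξ ω)) : Vec ns)) μ := by
    exact indepFun_comp_of_map hξ hlaw measurable_srcY (hto.comp (linOf_resS P).measurable) hindP
  have hYm : Measurable fun ω => srcY (ξ ω) := measurable_srcY.comp hξ
  rw [condMutualInfo_eq_mutualInfo (μ := μ) hRm hZ hYm (measurable_toLp_mulVec (gainS P))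
    (fun ω => by
      change _ = WithLp.toLp 2 (gainS P *ᵥ cy (ξ ω)) + WithLp.toLp 2 (cs (ξ ω) - _)
      rw [← WithLp.toLp_add, add_sub_cancel]
      rfl) hind]
  have hae : (fun ω => (WithLp.toLp 2 (resS P (ξ ω)) : Vec ns)) =ᵐ[μ]
      fun ω => WithLp.toLp 2 (B *ᵥ whiteS P Bp (ξ ω)) := by
    have h1 := h.resS_ae hmean hY
    rw [← hlaw] at h1
    filter_upwards [ae_of_ae_map hξ.aemeasurable h1] with ω hω
    rw [hlaw] at hω
    rw [hω]
  -- The residual and the white vector are almost surely linear functions of each other, so data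
  -- processing applies both ways.
  refine le_antisymm ?_ ?_
  · rw [mutualInfo_congr hae]
    exact mutualInfo_comp_le (hYm.prodMk hZ) ((linOf_whiteS P Bp).measurable.comp hξ)
      (g := fun x => (WithLp.toLp 2 (B *ᵥ x) : Vec ns))
      ((by fun_prop : Measurable fun x : Fin ns → ℝ => (WithLp.toLp 2 x : Vec ns)).comp
        (measurable_mulVec B))
  · exact mutualInfo_comp_le (hYm.prodMk hZ) hRm (g := fun x : Vec ns => Bp *ᵥ x.ofLp)
      ((measurable_mulVec Bp).comp (by fun_prop))

end Whitening

/-! ### Test channel parameters in whitened coordinates. -/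

section ChannelAlgebra

variable {nx ns ny r : ℕ} {P : Measure (Src nx ns ny)} {H : Matrix (Fin nx) (Fin ns) ℝ}
  {QW D : Matrix (Fin nx) (Fin nx) ℝ} {B : Matrix (Fin ns) (Fin r) ℝ}
  {Bp : Matrix (Fin r) (Fin ns) ℝ}

theorem IsChannelParam.covHatgY_eq (h : IsChannelParam P H QW D) :
    covHatgY P H QW = H * (covXSgY P)ᵀ := by
  rw [covHatgY, h.noise_eq, add_sub_cancel]

theorem IsChannelParam.covHatgY_posSemidef (h : IsChannelParam P H QW D) :
    (covHatgY P H QW).PosSemidef := by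
  rw [h.covHatgY_eq]
  exact h.mul_posSemidef

theorem IsWhitening.covHatgY_sub (hw : IsWhitening P B Bp) :
    covHatgY P H QW - (H * B) * (H * B)ᵀ = QW := by
  rw [covHatgY, hw.factor, transpose_mul]
  simp only [Matrix.mul_assoc, add_sub_cancel_left]

theorem IsWhitening.covSgHatY_eq (hw : IsWhitening P B Bp) :
    covSgHatY P H QW = B * schur (covHatgY P H QW) (H * B) * Bᵀ := by
  rw [covSgHatY, schur, hw.factor, transpose_mul, Matrix.mul_sub, Matrix.sub_mul, Matrix.mul_one]
  simp only [Matrix.mul_assoc]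

theorem IsChannelParam.schur_posSemidef (h : IsChannelParam P H QW D) (hw : IsWhitening P B Bp) :
    (schur (covHatgY P H QW) (H * B)).PosSemidef :=
  RemoteRDF.schur_posSemidef h.covHatgY_posSemidef (by
    rw [hw.covHatgY_sub]; exact h.noise_posSemidef)

theorem IsChannelParam.covSgHatY_posSemidef (h : IsChannelParam P H QW D)
    (hw : IsWhitening P B Bp) : (covSgHatY P H QW).PosSemidef := by
  rw [hw.covSgHatY_eq]
  exact posSemidef_mul_mul_transpose (h.schur_posSemidef hw) B

/-- The difference is B (1 - Schur complement) Bᵀ, and 1 - Jᵀ Q† J with J = H B has the form K Q Kᵀ.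
Thus the ordering constraint of the first characterization is automatic. -/
theorem IsChannelParam.covSgY_sub_posSemidef (h : IsChannelParam P H QW D)
    (hw : IsWhitening P B Bp) : (covSgY P - covSgHatY P H QW).PosSemidef := by
  have hJ : (covHatgY P H QW - (H * B) * (H * B)ᵀ).PosSemidef := by
    rw [hw.covHatgY_sub]; exact h.noise_posSemidef
  have h2 : covSgY P - covSgHatY P H QW = B * (((H * B)ᵀ * pinv (covHatgY P H QW)) *
      covHatgY P H QW * ((H * B)ᵀ * pinv (covHatgY P H QW))ᵀ) * Bᵀ := by
    have h3 : ((H * B)ᵀ * pinv (covHatgY P H QW)) * covHatgY P H QW *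
        ((H * B)ᵀ * pinv (covHatgY P H QW))ᵀ = 1 - schur (covHatgY P H QW) (H * B) := by
      have h4 : (schur (covHatgY P H QW) (H * B))ᵀ = schur (covHatgY P H QW) (H * B) := by
        simpa using (h.schur_posSemidef hw).1.eq
      rw [transpose_mul_pinv_mul_of_le h.covHatgY_posSemidef hJ, ← transpose_mul, ← h4, schur,
        transpose_sub, transpose_one, sub_sub_cancel]
    rw [h3, hw.covSgHatY_eq, hw.factor, Matrix.mul_sub, Matrix.sub_mul, Matrix.mul_one]
  rw [h2]
  exact posSemidef_mul_mul_transpose (posSemidef_mul_mul_transpose h.covHatgY_posSemidef _) _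

theorem IsWhitening.covHatgY_sub_posSemidef (hw : IsWhitening P B Bp) :
    (covHatgY P H QW - QW).PosSemidef := by
  rw [covHatgY, add_sub_cancel_right, hw.factor, ← Matrix.mul_assoc, Matrix.mul_assoc _ Bᵀ,
    ← transpose_mul]
  exact posSemidef_mul_transpose _

theorem IsChannelParam.halfLogDetRatio_source (h : IsChannelParam P H QW D)
    (hw : IsWhitening P B Bp) : halfLogDetRatio (covSgY P) (covSgHatY P H QW)
      = halfLogInv (schur (covHatgY P H QW) (H * B)).det := by
  rw [hw.covSgHatY_eq, hw.factor, halfLogDetRatio_factor hw.left_inv (h.schur_posSemidef hw)]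

theorem IsChannelParam.halfLogDetRatio_channel (h : IsChannelParam P H QW D)
    (hw : IsWhitening P B Bp) : halfLogDetRatio (covHatgY P H QW) QW
      = halfLogInv (schur (covHatgY P H QW) (H * B)).det := by
  rw [← halfLogDetRatio_noise h.covHatgY_posSemidef (by
    rw [hw.covHatgY_sub]; exact h.noise_posSemidef), hw.covHatgY_sub]

variable [IsGaussian P]

theorem IsChannelParam.covHatgY_eq_white (h : IsChannelParam P H QW D) (hw : IsWhitening P B Bp)
    (hmean : ∫ v, v ∂P = 0) (hY : (covY P).PosDef) :
    covHatgY P H QW = (H * B) * (whiteC P Bp)ᵀ := by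
  rw [h.covHatgY_eq, hw.covXSgY_factor hmean hY, transpose_mul, transpose_transpose,
    Matrix.mul_assoc]

theorem IsChannelParam.feasible (h : IsChannelParam P H QW D) (hw : IsWhitening P B Bp)
    (hmean : ∫ v, v ∂P = 0) (hY : (covY P).PosDef) (hD : D.PosSemidef) {Δ : ℝ}
    (htr : D.trace ≤ Δ) : Feasible (whiteC P Bp) (covXgY P) Δ (H * B) := by
  have h1 := h.covHatgY_eq_white hw hmean hY
  have h2 : covXgY P - (H * B) * (whiteC P Bp)ᵀ = D := by
    rw [← h1, h.covHatgY_eq, h.mul_eq_sub, sub_sub_cancel]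
  refine ⟨?_, ?_, ?_, ?_⟩
  · rw [← h1]; exact h.covHatgY_posSemidef
  · rw [← h1, hw.covHatgY_sub]; exact h.noise_posSemidef
  · rwa [h2]
  · rwa [h2]

/-- Inverse to passing from H to H B: the choice H = J Bp recovers J because Bp B = 1, and the
constraints then determine Q_W and Σ_Δ. -/
theorem Feasible.isChannelParam {Δ : ℝ} {J : Matrix (Fin nx) (Fin r) ℝ}
    (h : Feasible (whiteC P Bp) (covXgY P) Δ J) (hw : IsWhitening P B Bp)
    (hmean : ∫ v, v ∂P = 0) (hY : (covY P).PosDef) :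
    IsChannelParam P (J * Bp) (J * (whiteC P Bp)ᵀ - J * Jᵀ) (covXgY P - J * (whiteC P Bp)ᵀ) := by
  have hJ : J * Bp * B = J := by rw [Matrix.mul_assoc, hw.left_inv, Matrix.mul_one]
  have h1 : J * Bp * (covXSgY P)ᵀ = J * (whiteC P Bp)ᵀ := by
    rw [hw.covXSgY_factor hmean hY, transpose_mul, transpose_transpose, ← Matrix.mul_assoc, hJ]
  refine ⟨h.noise_posSemidef, ?_, ?_, ?_, ?_⟩
  · rw [h1, sub_sub_cancel]
  · have h2 : (J * (whiteC P Bp)ᵀ)ᵀ = J * (whiteC P Bp)ᵀ := by simpa using h.posSemidef.1.eq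
    rw [h1, ← h2, ← h1, transpose_mul, transpose_transpose]
  · rw [h1]; exact h.posSemidef
  · rw [h1, hw.factor, ← Matrix.mul_assoc, hJ, Matrix.mul_assoc, ← transpose_mul, hJ]

end ChannelAlgebra

/-! ### The Gaussian vector of source and noise. -/

section ChannelMoments

variable {nx ns ny : ℕ}

/-- The coordinates of the noise. -/
def cw (p : Src nx ns ny × Vec nx) : Fin nx → ℝ := p.2.ofLp

/-- The coordinates of `X̂ - E[X̂|Y] = H (S - E[S|Y]) + W`. -/
def chanRes (P : Measure (Src nx ns ny)) (H : Matrix (Fin nx) (Fin ns) ℝ)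
    (p : Src nx ns ny × Vec nx) : Fin nx → ℝ := H *ᵥ resS P p.1 + cw p

/-- The coordinates of the error `X - X̂`. -/
def chanErr (P : Measure (Src nx ns ny)) (H : Matrix (Fin nx) (Fin ns) ℝ)
    (p : Src nx ns ny × Vec nx) : Fin nx → ℝ := resX P p.1 - chanRes P H p

/-- The coordinates of `S - E[S|X̂,Y]`. -/
def chanPost (P : Measure (Src nx ns ny)) (H : Matrix (Fin nx) (Fin ns) ℝ)
    (QW : Matrix (Fin nx) (Fin nx) ℝ) (p : Src nx ns ny × Vec nx) : Fin ns → ℝ :=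
  resS P p.1 - (covSgY P * Hᵀ * pinv (covHatgY P H QW)) *ᵥ chanRes P H p

theorem LinOf.comp_fst {E F ι : Type*} [NormedAddCommGroup E] [NormedSpace ℝ E]
    [NormedAddCommGroup F] [NormedSpace ℝ F] {U : E → ι → ℝ} (hU : LinOf id U) :
    LinOf (id : E × F → _) fun p => U p.1 := by
  obtain ⟨L, hL⟩ := hU
  exact ⟨L.comp (ContinuousLinearMap.fst ℝ _ _), fun p => hL p.1⟩

theorem linOf_cw : LinOf (id : Src nx ns ny × Vec nx → _) cw :=
  ⟨(EuclideanSpace.equiv (Fin nx) ℝ : Vec nx →L[ℝ] _).comp (ContinuousLinearMap.snd ℝ _ _),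
    fun _ => rfl⟩

theorem linOf_chanRes (P : Measure (Src nx ns ny)) (H : Matrix (Fin nx) (Fin ns) ℝ) :
    LinOf id (chanRes P H) := ((linOf_resS P).comp_fst.mulVec H).add linOf_cw

theorem linOf_chanErr (P : Measure (Src nx ns ny)) (H : Matrix (Fin nx) (Fin ns) ℝ) :
    LinOf id (chanErr P H) := (linOf_resX P).comp_fst.sub (linOf_chanRes P H)

theorem linOf_chanPost (P : Measure (Src nx ns ny)) (H : Matrix (Fin nx) (Fin ns) ℝ)
    (QW : Matrix (Fin nx) (Fin nx) ℝ) : LinOf id (chanPost P H QW) :=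
  (linOf_resS P).comp_fst.sub ((linOf_chanRes P H).mulVec _)

variable {P : Measure (Src nx ns ny)} {H : Matrix (Fin nx) (Fin ns) ℝ}
  {QW D : Matrix (Fin nx) (Fin nx) ℝ}
variable {Ω : Type*} [MeasurableSpace Ω] {μ : Measure Ω}
  {X : Ω → Vec nx} {S : Ω → Vec ns} {Y : Ω → Vec ny} {W : Ω → Vec nx}

/-- The source and the noise together. -/
def chanG (X : Ω → Vec nx) (S : Ω → Vec ns) (Y : Ω → Vec ny) (W : Ω → Vec nx) (ω : Ω) :
    Src nx ns ny × Vec nx := ((X ω, S ω, Y ω), W ω)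

theorem IsRealization.measurable_source (hr : IsRealization P QW μ X S Y W) :
    Measurable fun ω => (X ω, S ω, Y ω) :=
  hr.measurable_X.prodMk (hr.measurable_S.prodMk hr.measurable_Y)

theorem IsRealization.measurable_chanG (hr : IsRealization P QW μ X S Y W) :
    Measurable (chanG X S Y W) := hr.measurable_source.prodMk hr.measurable_W

theorem IsRealization.xmom_noise (hr : IsRealization P QW μ X S Y W) (hQW : QW.PosSemidef) :
    xmom μ (fun ω => cw (chanG X S Y W ω)) (fun ω => cw (chanG X S Y W ω)) = QW := by
  ext i j
  have h0 : ∀ k, ∫ x : Vec nx, x k ∂(multivariateGaussian 0 QW) = 0 := by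
    intro k
    have hi : Integrable (fun x : Vec nx => x) (multivariateGaussian 0 QW) :=
      (IsGaussian.hasGaussianLaw_id (μ := multivariateGaussian 0 QW)).integrable
    have := (EuclideanSpace.proj k : Vec nx →L[ℝ] ℝ).integral_comp_comm hi
    simpa using this
  have hsq : SqInt (multivariateGaussian 0 QW) fun x : Vec nx => x.ofLp :=
    LinOf.sqInt ⟨(EuclideanSpace.equiv (Fin nx) ℝ : Vec nx →L[ℝ] _), fun _ => rfl⟩
      (IsGaussian.hasGaussianLaw_id (μ := multivariateGaussian 0 QW))
  have h1 := covariance_eval_multivariateGaussian (μ := (0 : Vec nx)) hQW i j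
  rw [covariance_eq_sub (hsq i) (hsq j), h0, zero_mul, sub_zero] at h1
  rw [← h1, ← hr.law_noise, integral_map hr.measurable_W.aemeasurable
    (by fun_prop)]
  rfl

variable [IsGaussian P]

theorem IsRealization.hasGaussianLaw (hr : IsRealization P QW μ X S Y W) :
    HasGaussianLaw (chanG X S Y W) μ := by
  refine IndepFun.hasGaussianLaw (X := fun ω => (X ω, S ω, Y ω)) (Y := W) ⟨?_⟩ ⟨?_⟩ hr.indep.symm
  · rw [hr.law_source]; infer_instance
  · rw [hr.law_noise]; infer_instance

theorem IsRealization.integral_eq_zero (hr : IsRealization P QW μ X S Y W)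
    (hmean : ∫ v, v ∂P = 0) : ∫ ω, chanG X S Y W ω ∂μ = 0 := by
  have hG := hr.hasGaussianLaw.integrable
  have h1 : ∫ ω, (X ω, S ω, Y ω) ∂μ = 0 := by
    rw [← hmean, ← hr.law_source]
    exact (integral_map hr.measurable_source.aemeasurable
      measurable_id.aestronglyMeasurable).symm
  have h2 : ∫ ω, W ω ∂μ = 0 := by
    rw [← integral_id_multivariateGaussian (μ := (0 : Vec nx)) (S := QW), ← hr.law_noise]
    exact (integral_map hr.measurable_W.aemeasurable
      measurable_id.aestronglyMeasurable).symm
  exact (integral_pair (f := fun ω => (X ω, S ω, Y ω)) (g := W) hG.fst hG.snd).trans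
    (by rw [h1, h2]; rfl)

theorem IsRealization.xmom_source_noise {ι : Type*} [Fintype ι]
    (hr : IsRealization P QW μ X S Y W) (hmean : ∫ v, v ∂P = 0) {U : Src nx ns ny → ι → ℝ}
    (hU : LinOf id U) :
    xmom μ (fun ω => U (X ω, S ω, Y ω)) (fun ω => cw (chanG X S Y W ω)) = 0 := by
  ext i j
  have hind : IndepFun (fun ω => U (X ω, S ω, Y ω) i) (fun ω => cw (chanG X S Y W ω) j) μ :=
    hr.indep.symm.comp (φ := fun v => U v i) (ψ := fun w : Vec nx => w j)
      ((measurable_pi_apply i).comp hU.measurable) (by fun_prop)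
  have h1 := (hU.comp_fst (F := Vec nx)).comp (chanG X S Y W)
  have h2 := (linOf_cw (nx := nx) (ns := ns) (ny := ny)).comp (chanG X S Y W)
  have h3 := hind.integral_mul_eq_mul_integral
    (h1.sqInt hr.hasGaussianLaw i).aestronglyMeasurable
    (h2.sqInt hr.hasGaussianLaw j).aestronglyMeasurable
  rw [h2.integral_eq_zero hr.hasGaussianLaw (hr.integral_eq_zero hmean), mul_zero] at h3
  exact h3

end ChannelMoments

/-! ### Second moments and orthogonality relations of the test channel. -/

section ChannelCovariances

variable {nx ns ny : ℕ} {P : Measure (Src nx ns ny)} [IsGaussian P]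
  {H : Matrix (Fin nx) (Fin ns) ℝ} {QW D : Matrix (Fin nx) (Fin nx) ℝ}
variable {Ω : Type*} {X : Ω → Vec nx} {S : Ω → Vec ns} {Y : Ω → Vec ny} {W : Ω → Vec nx}

theorem linOf_source {ι : Type*} {U : Src nx ns ny → ι → ℝ} (hU : LinOf id U)
    (X : Ω → Vec nx) (S : Ω → Vec ns) (Y : Ω → Vec ny) (W : Ω → Vec nx) :
    LinOf (chanG X S Y W) fun ω => U (chanG X S Y W ω).1 := hU.comp_fst.comp (chanG X S Y W)

variable [MeasurableSpace Ω] {μ : Measure Ω}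

/-- Moments of a linear function of the source with `X̂ - E[X̂|Y]`. -/
theorem IsRealization.xmom_source_chanRes {ι : Type*} [Fintype ι]
    (hr : IsRealization P QW μ X S Y W) (hmean : ∫ v, v ∂P = 0) {U : Src nx ns ny → ι → ℝ}
    (hU : LinOf id U) :
    xmom μ (fun ω => U (chanG X S Y W ω).1) (fun ω => chanRes P H (chanG X S Y W ω))
      = xmom P U (resS P) * Hᵀ := by
  have hG := hr.hasGaussianLaw
  have hU2 := (linOf_source hU X S Y W).sqInt hG
  have hS2 := (linOf_source (linOf_resS P) X S Y W).sqInt hG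
  have hW2 := (linOf_cw.comp (chanG X S Y W)).sqInt hG
  unfold chanRes
  rw [xmom_add_right hU2 (hS2.mulVec H) hW2, xmom_mulVec_right hU2 hS2]
  have h1 : xmom μ (fun ω => U (chanG X S Y W ω).1) (fun ω => resS P (chanG X S Y W ω).1)
      = xmom P U (resS P) := xmom_comp hr.measurable_source hr.law_source hU (linOf_resS P)
  have h2 : xmom μ (fun ω => U (chanG X S Y W ω).1) (fun ω => cw (chanG X S Y W ω)) = 0 :=
    hr.xmom_source_noise hmean hU
  rw [h1, h2, add_zero]

theorem IsRealization.xmom_chanRes_cy (hr : IsRealization P QW μ X S Y W)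
    (hmean : ∫ v, v ∂P = 0) (hY : (covY P).PosDef) :
    xmom μ (fun ω => chanRes P H (chanG X S Y W ω)) (fun ω => cy (chanG X S Y W ω).1) = 0 := by
  rw [← xmom_transpose, hr.xmom_source_chanRes hmean linOf_cy, ← xmom_transpose,
    xmom_resS_cy hmean hY]
  simp

theorem IsRealization.xmom_noise_chanRes (hr : IsRealization P QW μ X S Y W)
    (hQW : QW.PosSemidef) (hmean : ∫ v, v ∂P = 0) :
    xmom μ (fun ω => cw (chanG X S Y W ω)) (fun ω => chanRes P H (chanG X S Y W ω)) = QW := by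
  have hG := hr.hasGaussianLaw
  have hS2 := (linOf_source (linOf_resS P) X S Y W).sqInt hG
  have hW2 := (linOf_cw.comp (chanG X S Y W)).sqInt hG
  unfold chanRes
  rw [xmom_add_right hW2 (hS2.mulVec H) hW2, xmom_mulVec_right hW2 hS2, hr.xmom_noise hQW,
    ← xmom_transpose]
  have h1 : xmom μ (fun ω => resS P (chanG X S Y W ω).1) (fun ω => cw (chanG X S Y W ω)) = 0 :=
    hr.xmom_source_noise hmean (linOf_resS P)
  rw [h1]
  simp

theorem IsRealization.xmom_chanRes (hr : IsRealization P QW μ X S Y W)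
    (hQW : QW.PosSemidef) (hmean : ∫ v, v ∂P = 0) (hY : (covY P).PosDef) :
    xmom μ (fun ω => chanRes P H (chanG X S Y W ω)) (fun ω => chanRes P H (chanG X S Y W ω))
      = covHatgY P H QW := by
  have hG := hr.hasGaussianLaw
  have hS2 := (linOf_source (linOf_resS P) X S Y W).sqInt hG
  have hW2 := (linOf_cw.comp (chanG X S Y W)).sqInt hG
  have hV2 := ((linOf_chanRes P H).comp (chanG X S Y W)).sqInt hG
  conv_lhs => enter [2]; unfold chanRes
  rw [xmom_add_left (hS2.mulVec H) hW2 hV2, xmom_mulVec_left hS2 hV2,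
    hr.xmom_noise_chanRes hQW hmean, hr.xmom_source_chanRes hmean (linOf_resS P),
    ← covSgY_eq hmean hY, covHatgY, Matrix.mul_assoc]

theorem IsRealization.xmom_resX_chanRes (hr : IsRealization P QW μ X S Y W)
    (h : IsChannelParam P H QW D) (hmean : ∫ v, v ∂P = 0) (hY : (covY P).PosDef) :
    xmom μ (fun ω => resX P (chanG X S Y W ω).1) (fun ω => chanRes P H (chanG X S Y W ω))
      = covHatgY P H QW := by
  rw [hr.xmom_source_chanRes hmean (linOf_resX P), ← covXSgY_eq hmean hY, ← h.mul_symm,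
    h.covHatgY_eq]

/-- Orthogonality principle. The symmetry of H Q_{X,S|Y}ᵀ and the choice of Q_W make the cross
moment of the residual of X with that of X̂ equal to the covariance of the latter, so X̂ is already
the best estimate of X. -/
theorem IsRealization.xmom_chanErr_chanRes (hr : IsRealization P QW μ X S Y W)
    (h : IsChannelParam P H QW D) (hmean : ∫ v, v ∂P = 0) (hY : (covY P).PosDef) :
    xmom μ (fun ω => chanErr P H (chanG X S Y W ω)) (fun ω => chanRes P H (chanG X S Y W ω))
      = 0 := by
  have hG := hr.hasGaussianLaw
  have hX2 := (linOf_source (linOf_resX P) X S Y W).sqInt hG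
  have hV2 := ((linOf_chanRes P H).comp (chanG X S Y W)).sqInt hG
  conv_lhs => enter [2]; unfold chanErr
  rw [xmom_sub_left hX2 hV2 hV2, hr.xmom_resX_chanRes h hmean hY,
    hr.xmom_chanRes h.noise_posSemidef hmean hY, sub_self]

theorem IsRealization.xmom_chanErr_cy (hr : IsRealization P QW μ X S Y W)
    (hmean : ∫ v, v ∂P = 0) (hY : (covY P).PosDef) :
    xmom μ (fun ω => chanErr P H (chanG X S Y W ω)) (fun ω => cy (chanG X S Y W ω).1) = 0 := by
  have hG := hr.hasGaussianLaw
  have hX2 := (linOf_source (linOf_resX P) X S Y W).sqInt hG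
  have hy2 := (linOf_source linOf_cy X S Y W).sqInt hG
  have hV2 := ((linOf_chanRes P H).comp (chanG X S Y W)).sqInt hG
  have h1 : xmom μ (fun ω => resX P (chanG X S Y W ω).1) (fun ω => cy (chanG X S Y W ω).1) = 0 :=
    (xmom_comp hr.measurable_source hr.law_source (linOf_resX P) linOf_cy).trans
      (xmom_resX_cy hmean hY)
  unfold chanErr
  rw [xmom_sub_left hX2 hV2 hy2, h1, hr.xmom_chanRes_cy hmean hY, sub_self]

theorem IsRealization.xmom_chanErr (hr : IsRealization P QW μ X S Y W)
    (h : IsChannelParam P H QW D) (hmean : ∫ v, v ∂P = 0) (hY : (covY P).PosDef) :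
    xmom μ (fun ω => chanErr P H (chanG X S Y W ω)) (fun ω => chanErr P H (chanG X S Y W ω))
      = D := by
  have hG := hr.hasGaussianLaw
  have hX2 := (linOf_source (linOf_resX P) X S Y W).sqInt hG
  have hV2 := ((linOf_chanRes P H).comp (chanG X S Y W)).sqInt hG
  have he2 := ((linOf_chanErr P H).comp (chanG X S Y W)).sqInt hG
  have h1 : xmom μ (fun ω => resX P (chanG X S Y W ω).1) (fun ω => resX P (chanG X S Y W ω).1)
      = covXgY P :=
    (xmom_comp hr.measurable_source hr.law_source (linOf_resX P) (linOf_resX P)).trans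
      (covXgY_eq hmean hY).symm
  conv_lhs => enter [3]; unfold chanErr
  rw [xmom_sub_right he2 hX2 hV2, hr.xmom_chanErr_chanRes h hmean hY, sub_zero]
  unfold chanErr
  rw [xmom_sub_left hX2 hV2 hX2, h1, ← xmom_transpose, hr.xmom_resX_chanRes h hmean hY,
    h.covHatgY_eq, transpose_mul, transpose_transpose, ← h.mul_symm, h.mul_eq_sub, sub_sub_cancel]

theorem IsRealization.xmom_chanPost_cy (hr : IsRealization P QW μ X S Y W)
    (hmean : ∫ v, v ∂P = 0) (hY : (covY P).PosDef) :
    xmom μ (fun ω => chanPost P H QW (chanG X S Y W ω)) (fun ω => cy (chanG X S Y W ω).1) = 0 := by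
  have hG := hr.hasGaussianLaw
  have hS2 := (linOf_source (linOf_resS P) X S Y W).sqInt hG
  have hy2 := (linOf_source linOf_cy X S Y W).sqInt hG
  have hV2 := ((linOf_chanRes P H).comp (chanG X S Y W)).sqInt hG
  have h1 : xmom μ (fun ω => resS P (chanG X S Y W ω).1) (fun ω => cy (chanG X S Y W ω).1) = 0 :=
    (xmom_comp hr.measurable_source hr.law_source (linOf_resS P) linOf_cy).trans
      (xmom_resS_cy hmean hY)
  unfold chanPost
  rw [xmom_sub_left hS2 (hV2.mulVec _) hy2, h1, xmom_mulVec_left hV2 hy2,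
    hr.xmom_chanRes_cy hmean hY, Matrix.mul_zero, sub_self]

/-- The normal equations for estimating S from X̂ - E[X̂|Y]. They hold although Q_{X̂|Y} may be
singular: Q_W ⪰ 0 puts the columns of H B in the range of Q_{X̂|Y}. -/
theorem IsChannelParam.mul_pinv_mul (h : IsChannelParam P H QW D) (hmean : ∫ v, v ∂P = 0)
    (hY : (covY P).PosDef) :
    covSgY P * Hᵀ * pinv (covHatgY P H QW) * covHatgY P H QW = covSgY P * Hᵀ := by
  obtain ⟨r, B, Bp, hw⟩ := exists_isWhitening (P := P) hmean hY
  have h1 := transpose_mul_pinv_mul_of_le h.covHatgY_posSemidef (J := H * B) (by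
    rw [hw.covHatgY_sub]; exact h.noise_posSemidef)
  have h2 : covSgY P * Hᵀ = B * (H * B)ᵀ := by
    rw [hw.factor, transpose_mul, Matrix.mul_assoc]
  rw [h2, Matrix.mul_assoc, Matrix.mul_assoc, ← Matrix.mul_assoc _ (pinv _), h1]

theorem IsRealization.xmom_chanPost_chanRes (hr : IsRealization P QW μ X S Y W)
    (h : IsChannelParam P H QW D) (hmean : ∫ v, v ∂P = 0) (hY : (covY P).PosDef) :
    xmom μ (fun ω => chanPost P H QW (chanG X S Y W ω)) (fun ω => chanRes P H (chanG X S Y W ω))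
      = 0 := by
  have hG := hr.hasGaussianLaw
  have hS2 := (linOf_source (linOf_resS P) X S Y W).sqInt hG
  have hV2 := ((linOf_chanRes P H).comp (chanG X S Y W)).sqInt hG
  conv_lhs => enter [2]; unfold chanPost
  rw [xmom_sub_left hS2 (hV2.mulVec _) hV2, xmom_mulVec_left hV2 hV2,
    hr.xmom_chanRes h.noise_posSemidef hmean hY, h.mul_pinv_mul hmean hY,
    hr.xmom_source_chanRes hmean (linOf_resS P), ← covSgY_eq hmean hY, sub_self]

theorem IsRealization.xmom_chanPost (hr : IsRealization P QW μ X S Y W)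
    (h : IsChannelParam P H QW D) (hmean : ∫ v, v ∂P = 0) (hY : (covY P).PosDef) :
    xmom μ (fun ω => chanPost P H QW (chanG X S Y W ω))
      (fun ω => chanPost P H QW (chanG X S Y W ω)) = covSgHatY P H QW := by
  have hG := hr.hasGaussianLaw
  have hS2 := (linOf_source (linOf_resS P) X S Y W).sqInt hG
  have hV2 := ((linOf_chanRes P H).comp (chanG X S Y W)).sqInt hG
  have he2 := ((linOf_chanPost P H QW).comp (chanG X S Y W)).sqInt hG
  have h1 : xmom μ (fun ω => resS P (chanG X S Y W ω).1) (fun ω => resS P (chanG X S Y W ω).1)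
      = covSgY P :=
    (xmom_comp hr.measurable_source hr.law_source (linOf_resS P) (linOf_resS P)).trans
      (covSgY_eq hmean hY).symm
  have hSt : (covSgY P)ᵀ = covSgY P := by
    rw [covSgY_eq hmean hY, xmom_transpose]
  conv_lhs => enter [3]; unfold chanPost
  rw [xmom_sub_right he2 hS2 (hV2.mulVec _), xmom_mulVec_right he2 hV2,
    hr.xmom_chanPost_chanRes h hmean hY, Matrix.zero_mul, sub_zero]
  unfold chanPost
  rw [xmom_sub_left hS2 (hV2.mulVec _) hS2, xmom_mulVec_left hV2 hS2, h1, ← xmom_transpose,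
    hr.xmom_source_chanRes hmean (linOf_resS P), ← covSgY_eq hmean hY, transpose_mul,
    transpose_transpose, hSt, covSgHatY]
  simp only [Matrix.mul_assoc]

/-- `(X̂ - E[X̂|Y], Y)` is independent of a jointly Gaussian vector that is uncorrelated
with both. -/
theorem IsRealization.indepFun {ι : Type*} [Fintype ι] (hr : IsRealization P QW μ X S Y W)
    (hmean : ∫ v, v ∂P = 0) {U : Src nx ns ny × Vec nx → ι → ℝ} (hU : LinOf id U)
    (h1 : xmom μ (fun ω => U (chanG X S Y W ω)) (fun ω => chanRes P H (chanG X S Y W ω)) = 0)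
    (h2 : xmom μ (fun ω => U (chanG X S Y W ω)) (fun ω => cy (chanG X S Y W ω).1) = 0) :
    IndepFun (fun ω => (chanRes P H (chanG X S Y W ω), cy (chanG X S Y W ω).1))
      (fun ω => U (chanG X S Y W ω)) μ :=
  LinOf.indepFun hr.hasGaussianLaw (hr.integral_eq_zero hmean) (hU.comp _)
    ((linOf_chanRes P H).comp _) (linOf_source linOf_cy X S Y W) h1 h2

end ChannelCovariances

/-! ### Mean square error as a trace. -/

section SquareError

variable {Ω : Type*} [MeasurableSpace Ω] {μ : Measure Ω} {n : ℕ}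

theorem lintegral_enorm_sq {U : Ω → Vec n} (hU : SqInt μ fun ω => (U ω).ofLp) :
    ∫⁻ ω, ‖U ω‖ₑ ^ 2 ∂μ
      = ENNReal.ofReal (xmom μ (fun ω => (U ω).ofLp) fun ω => (U ω).ofLp).trace := by
  have h1 : ∀ ω, ‖U ω‖ₑ ^ 2 = ENNReal.ofReal (∑ i, U ω i * U ω i) := by
    intro ω
    rw [← ofReal_norm, ← ENNReal.ofReal_pow (norm_nonneg _), EuclideanSpace.real_norm_sq_eq]
    simp only [sq]
  simp only [h1]
  rw [← ofReal_integral_eq_lintegral_ofReal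
    (integrable_finsetSum _ fun i _ => hU.integrable_mul hU i i)
    (ae_of_all _ fun ω => Finset.sum_nonneg fun i _ => mul_self_nonneg _),
    integral_finsetSum _ fun i _ => hU.integrable_mul hU i i]
  rfl

theorem sqInt_of_lintegral_ne_top {U : Ω → Vec n} (hUm : Measurable U)
    (hU : ∫⁻ ω, ‖U ω‖ₑ ^ 2 ∂μ ≠ ⊤) : SqInt μ fun ω => (U ω).ofLp := by
  have h : MemLp U 2 μ := by
    refine ⟨hUm.aestronglyMeasurable, ?_⟩
    rw [eLpNorm_lt_top_iff_lintegral_rpow_enorm_lt_top two_ne_zero ENNReal.ofNat_ne_top]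
    simpa using hU.lt_top
  exact fun i => h.eval_piLp i

end SquareError

/-! ### The test channel: decompositions, Markov properties, distortion and rate. -/

section TestChannel

variable {nx ns ny : ℕ} {P : Measure (Src nx ns ny)}
  {H : Matrix (Fin nx) (Fin ns) ℝ} {QW D : Matrix (Fin nx) (Fin nx) ℝ}
variable {Ω : Type*} {X : Ω → Vec nx} {S : Ω → Vec ns} {Y : Ω → Vec ny} {W : Ω → Vec nx}

/-- Both Z and X̂ have the form K Y + (X̂ - E[X̂|Y]), with different K. Given Y they carry the same
information, so later statements are proved once for arbitrary K. -/
theorem chanZ_ofLp (P : Measure (Src nx ns ny)) (X : Ω → Vec nx) (Y : Ω → Vec ny) (ω : Ω) :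
    (chanZ H S W ω).ofLp
      = (H * gainS P) *ᵥ (Y ω).ofLp + chanRes P H (chanG X S Y W ω) := by
  have h1 : (chanZ H S W ω).ofLp = H *ᵥ (S ω).ofLp + (W ω).ofLp := rfl
  have h2 : chanRes P H (chanG X S Y W ω)
      = H *ᵥ ((S ω).ofLp - gainS P *ᵥ (Y ω).ofLp) + (W ω).ofLp := rfl
  rw [h1, h2, mulVec_sub, mulVec_mulVec]
  abel

theorem chanX_ofLp (X : Ω → Vec nx) (ω : Ω) :
    (chanX P H S Y W ω).ofLp = gainX P *ᵥ (Y ω).ofLp + chanRes P H (chanG X S Y W ω) := by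
  have h1 : (chanX P H S Y W ω).ofLp
      = ((covXY P - H * covSY P) * (covY P)⁻¹) *ᵥ (Y ω).ofLp + (chanZ H S W ω).ofLp := rfl
  rw [h1, chanZ_ofLp P X Y, Matrix.sub_mul, sub_mulVec, gainX, gainS, Matrix.mul_assoc]
  abel

theorem source_eq_chanX_add (ω : Ω) :
    X ω = chanX P H S Y W ω + WithLp.toLp 2 (chanErr P H (chanG X S Y W ω)) := by
  have h2 : chanErr P H (chanG X S Y W ω)
      = (X ω).ofLp - gainX P *ᵥ (Y ω).ofLp - chanRes P H (chanG X S Y W ω) := rfl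
  have h3 : (chanX P H S Y W ω) = WithLp.toLp 2 (chanX P H S Y W ω).ofLp := rfl
  rw [h3, chanX_ofLp X, ← WithLp.toLp_add, h2]
  have : gainX P *ᵥ (Y ω).ofLp + chanRes P H (chanG X S Y W ω)
      + ((X ω).ofLp - gainX P *ᵥ (Y ω).ofLp - chanRes P H (chanG X S Y W ω)) = (X ω).ofLp := by abel
  rw [this]

theorem hidden_eq_add (X : Ω → Vec nx) (ω : Ω) :
    S ω = WithLp.toLp 2 (gainS P *ᵥ (Y ω).ofLp +
      (covSgY P * Hᵀ * pinv (covHatgY P H QW)) *ᵥ chanRes P H (chanG X S Y W ω))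
      + WithLp.toLp 2 (chanPost P H QW (chanG X S Y W ω)) := by
  have h2 : chanPost P H QW (chanG X S Y W ω) = (S ω).ofLp - gainS P *ᵥ (Y ω).ofLp
      - (covSgY P * Hᵀ * pinv (covHatgY P H QW)) *ᵥ chanRes P H (chanG X S Y W ω) := rfl
  rw [h2, ← WithLp.toLp_add]
  have : gainS P *ᵥ (Y ω).ofLp +
      (covSgY P * Hᵀ * pinv (covHatgY P H QW)) *ᵥ chanRes P H (chanG X S Y W ω)
      + ((S ω).ofLp - gainS P *ᵥ (Y ω).ofLp
      - (covSgY P * Hᵀ * pinv (covHatgY P H QW)) *ᵥ chanRes P H (chanG X S Y W ω))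
      = (S ω).ofLp := by abel
  rw [this]

variable [MeasurableSpace Ω] {μ : Measure Ω}

theorem measurable_toEuclideanLin {m n : ℕ} (A : Matrix (Fin m) (Fin n) ℝ) :
    Measurable (toEuclideanLin A) :=
  (LinearMap.continuous_of_finiteDimensional (toEuclideanLin A)).measurable

theorem measurable_chanDec (P : Measure (Src nx ns ny)) (H : Matrix (Fin nx) (Fin ns) ℝ) :
    Measurable (chanDec P H) :=
  ((measurable_toEuclideanLin _).comp measurable_fst).add measurable_snd

theorem IsRealization.measurable_chanZ (hr : IsRealization P QW μ X S Y W) :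
    Measurable (chanZ H S W) :=
  ((measurable_toEuclideanLin H).comp hr.measurable_S).add hr.measurable_W

theorem IsRealization.measurable_chanX (hr : IsRealization P QW μ X S Y W) :
    Measurable (chanX P H S Y W) :=
  (measurable_chanDec P H).comp (hr.measurable_Y.prodMk hr.measurable_chanZ)

theorem IsRealization.condLawEq_chanZ [IsProbabilityMeasure μ] (hr : IsRealization P QW μ X S Y W) :
    CondLawEq μ (chanZ H S W) (fun ω => (X ω, S ω, Y ω)) S :=
  condLawEq_of_indepFun (k := fun t : Src nx ns ny => t.2.1) (k' := id)
    (g := fun t : Src nx ns ny => t.2.1) (F := fun p => toEuclideanLin H p.1 + p.2) hr.measurable_W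
    (hr.measurable_X.prodMk (hr.measurable_S.prodMk hr.measurable_Y))
    hr.indep.symm (by fun_prop) measurable_id (by fun_prop) (fun _ => rfl) (fun _ => rfl)
    (((measurable_toEuclideanLin H).comp measurable_fst).add measurable_snd) (fun _ => rfl)

theorem IsRealization.condLawEq_chanX [IsProbabilityMeasure μ] (hr : IsRealization P QW μ X S Y W) :
    CondLawEq μ (chanX P H S Y W) (fun ω => (X ω, S ω, Y ω)) (fun ω => (S ω, Y ω)) :=
  condLawEq_of_indepFun (k := fun t : Src nx ns ny => t.2) (k' := id)
    (g := fun t : Src nx ns ny => t.2)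
    (F := fun p => chanDec P H (p.1.2, toEuclideanLin H p.1.1 + p.2)) hr.measurable_W
    (hr.measurable_X.prodMk (hr.measurable_S.prodMk hr.measurable_Y))
    hr.indep.symm (by fun_prop) measurable_id (by fun_prop) (fun _ => rfl) (fun _ => rfl)
    ((measurable_chanDec P H).comp ((measurable_snd.comp measurable_fst).prodMk
      (((measurable_toEuclideanLin H).comp (measurable_fst.comp measurable_fst)).add
        measurable_snd))) (fun _ => rfl)

variable [IsGaussian P]

theorem IsRealization.mse_chanX (hr : IsRealization P QW μ X S Y W)
    (h : IsChannelParam P H QW D) (hmean : ∫ v, v ∂P = 0) (hY : (covY P).PosDef) :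
    mse μ X (chanX P H S Y W) = ENNReal.ofReal D.trace := by
  have he : ∀ ω, X ω - chanX P H S Y W ω = WithLp.toLp 2 (chanErr P H (chanG X S Y W ω)) :=
    fun ω => sub_eq_of_eq_add' (source_eq_chanX_add ω)
  simp only [mse, he]
  rw [lintegral_enorm_sq (U := fun ω => WithLp.toLp 2 (chanErr P H (chanG X S Y W ω)))
    (((linOf_chanErr P H).comp (chanG X S Y W)).sqInt hr.hasGaussianLaw),
    ← hr.xmom_chanErr h hmean hY]

/-- Every function of `(X̂ - E[X̂|Y], Y)` is independent of a jointly Gaussian vector that is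
uncorrelated with both. -/
theorem IsRealization.indepFun_toLp {m : ℕ} (hr : IsRealization P QW μ X S Y W)
    (hmean : ∫ v, v ∂P = 0) {U : Src nx ns ny × Vec nx → Fin m → ℝ} (hU : LinOf id U)
    (h1 : xmom μ (fun ω => U (chanG X S Y W ω)) (fun ω => chanRes P H (chanG X S Y W ω)) = 0)
    (h2 : xmom μ (fun ω => U (chanG X S Y W ω)) (fun ω => cy (chanG X S Y W ω).1) = 0)
    {τ : Type*} [MeasurableSpace τ] {T : Ω → τ} {φ : (Fin nx → ℝ) × (Fin ny → ℝ) → τ}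
    (hφ : Measurable φ) (hT : ∀ ω, T ω = φ (chanRes P H (chanG X S Y W ω), (Y ω).ofLp)) :
    IndepFun T (fun ω => (WithLp.toLp 2 (U (chanG X S Y W ω)) : Vec m)) μ := by
  obtain rfl : T = fun ω => φ (chanRes P H (chanG X S Y W ω), (Y ω).ofLp) := funext hT
  exact (hr.indepFun hmean hU h1 h2).comp (φ := φ)
    (ψ := fun x : Fin m → ℝ => (WithLp.toLp 2 x : Vec m)) hφ (by fun_prop)

theorem IsRealization.indepFun_Y_toLp {m : ℕ} (hr : IsRealization P QW μ X S Y W)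
    (hmean : ∫ v, v ∂P = 0) {U : Src nx ns ny × Vec nx → Fin m → ℝ} (hU : LinOf id U)
    (h2 : xmom μ (fun ω => U (chanG X S Y W ω)) (fun ω => cy (chanG X S Y W ω).1) = 0) :
    IndepFun Y (fun ω => (WithLp.toLp 2 (U (chanG X S Y W ω)) : Vec m)) μ :=
  (LinOf.indepFun hr.hasGaussianLaw (hr.integral_eq_zero hmean) (hU.comp _)
    (linOf_source linOf_cy X S Y W) (linOf_source linOf_cy X S Y W) h2 h2).comp
    (φ := fun p : (Fin ny → ℝ) × (Fin ny → ℝ) => (WithLp.toLp 2 p.1 : Vec ny))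
    (ψ := fun x : Fin m → ℝ => (WithLp.toLp 2 x : Vec m)) (by fun_prop) (by fun_prop)

variable [IsProbabilityMeasure μ]

theorem IsRealization.condExp_eq {m : ℕ} (hr : IsRealization P QW μ X S Y W)
    (hmean : ∫ v, v ∂P = 0) {R : Src nx ns ny × Vec nx → Fin m → ℝ} (hR : LinOf id R)
    {τ : Type*} [MeasurableSpace τ] {T : Ω → τ} (hT : Measurable T)
    (hind : IndepFun T (fun ω => (WithLp.toLp 2 (R (chanG X S Y W ω)) : Vec m)) μ)
    {U : Ω → Vec m} {a : τ → Vec m} (ha : Measurable a)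
    (hU : ∀ ω, U ω = a (T ω) + WithLp.toLp 2 (R (chanG X S Y W ω)))
    (hU2 : SqInt μ fun ω => (U ω).ofLp) : μ[U | sig T] =ᵐ[μ] fun ω => a (T ω) :=
  condExp_add_indepFun (R := fun ω => WithLp.toLp 2 (R (chanG X S Y W ω)))
    ((by fun_prop : Measurable fun x : Fin m → ℝ => (WithLp.toLp 2 x : Vec m)).comp
      (hR.measurable.comp hr.measurable_chanG)) hT ha hU hind hU2
    ((hR.comp _).sqInt hr.hasGaussianLaw)
    ((hR.comp _).integral_eq_zero hr.hasGaussianLaw (hr.integral_eq_zero hmean))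

/-- The error in estimating the white vector from (Y, Z) is Bp (S - E[S|X̂,Y]), Gaussian and
independent of (Y, Z), so the information is given exactly by its covariance. Arbitrary K covers
both Z and X̂. -/
theorem IsRealization.condMutualInfo_eq (hr : IsRealization P QW μ X S Y W)
    (h : IsChannelParam P H QW D) (hmean : ∫ v, v ∂P = 0) (hY : (covY P).PosDef)
    {Z : Ω → Vec nx} (hZ : Measurable Z) {K : Matrix (Fin nx) (Fin ny) ℝ}
    (hK : ∀ ω, (Z ω).ofLp = K *ᵥ (Y ω).ofLp + chanRes P H (chanG X S Y W ω)) :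
    condMutualInfo μ S Z Y = halfLogDetRatio (covSgY P) (covSgHatY P H QW) := by
  obtain ⟨r, B, Bp, hw⟩ := exists_isWhitening (P := P) hmean hY
  have hG := hr.hasGaussianLaw
  set A := covSgY P * Hᵀ * pinv (covHatgY P H QW) with hA
  have h1 := hw.condMutualInfo_eq hmean hY hr.measurable_source hr.law_source hZ
  change condMutualInfo μ S Z Y = mutualInfo μ (fun ω => (Y ω, Z ω)) _ at h1
  rw [h1]
  have hN := linOf_source (linOf_whiteS P Bp) X S Y W
  have hpost := linOf_chanPost P H QW
  let u : Vec ny × Vec nx → Fin r → ℝ := fun t => (Bp * A) *ᵥ (t.2.ofLp - K *ᵥ t.1.ofLp)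
  have hu : Measurable u := (measurable_mulVec (Bp * A)).comp
    (((by fun_prop : Measurable fun t : Vec ny × Vec nx => t.2.ofLp)).sub
      ((measurable_mulVec K).comp (by fun_prop : Measurable fun t : Vec ny × Vec nx => t.1.ofLp)))
  have hsub : (fun ω => whiteS P Bp (X ω, S ω, Y ω) - u (Y ω, Z ω))
      = fun ω => Bp *ᵥ chanPost P H QW (chanG X S Y W ω) := by
    ext1 ω
    have h2 : u (Y ω, Z ω) = Bp *ᵥ (A *ᵥ chanRes P H (chanG X S Y W ω)) := by
      simp only [u, hK, add_sub_cancel_left, mulVec_mulVec]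
    rw [h2, whiteS, ← mulVec_sub]
    rfl
  have hp2 := (hpost.comp (chanG X S Y W)).sqInt hG
  have hind : IndepFun (fun ω => (Y ω, Z ω))
      (fun ω => Bp *ᵥ chanPost P H QW (chanG X S Y W ω)) μ := by
    have := hr.indepFun_toLp hmean hpost (hr.xmom_chanPost_chanRes h hmean hY)
      (hr.xmom_chanPost_cy hmean hY) (T := fun ω => (Y ω, Z ω))
      (φ := fun p => ((WithLp.toLp 2 p.2 : Vec ny), (WithLp.toLp 2 (K *ᵥ p.2 + p.1) : Vec nx)))
      ((by fun_prop : Measurable fun p : (Fin nx → ℝ) × (Fin ny → ℝ) =>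
          (WithLp.toLp 2 p.2 : Vec ny)).prodMk
        ((by fun_prop : Measurable fun x : Fin nx → ℝ => (WithLp.toLp 2 x : Vec nx)).comp
          (((measurable_mulVec K).comp measurable_snd).add measurable_fst)))
      (fun ω => by
        refine Prod.ext rfl ?_
        simp only [← hK])
    exact this.comp (φ := id) (ψ := fun x : Vec ns => Bp *ᵥ x.ofLp) measurable_id
      ((measurable_mulVec Bp).comp (by fun_prop))
  rw [mutualInfo_eq (T := fun ω => (Y ω, Z ω)) (N := fun ω => whiteS P Bp (X ω, S ω, Y ω))
    (hr.measurable_Y.prodMk hZ)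
    ((linOf_whiteS P Bp).measurable.comp hr.measurable_source) (hN.hasGaussianLaw hG)
    (hN.integral_eq_zero hG (hr.integral_eq_zero hmean))
    ((xmom_comp hr.measurable_source hr.law_source (linOf_whiteS P Bp) (linOf_whiteS P Bp)).trans
      (hw.xmom_whiteS hmean hY)) hu
    (by rw [hsub]; exact ((hpost.comp (chanG X S Y W)).mulVec Bp).hasGaussianLaw hG)
    (by
      intro i
      simp only [fun ω => congrFun hsub ω]
      exact ((hpost.comp (chanG X S Y W)).mulVec Bp).integral_eq_zero hG
        (hr.integral_eq_zero hmean) i)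
    (by rw [hsub]; exact hind), hsub, xmom_mulVec_left hp2 (hp2.mulVec _),
    xmom_mulVec_right hp2 hp2, hr.xmom_chanPost h hmean hY, h.halfLogDetRatio_source hw,
    hw.covSgHatY_eq]
  have h2 : Bᵀ * Bpᵀ = 1 := by rw [← transpose_mul, hw.left_inv, transpose_one]
  rw [Matrix.mul_assoc, h2, Matrix.mul_one, ← Matrix.mul_assoc, hw.left_inv, Matrix.one_mul]

end TestChannel

/-! ### Structural properties and admissibility of the test channel. -/

section StructuralProperties

variable {nx ns ny : ℕ} {P : Measure (Src nx ns ny)}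
  {H : Matrix (Fin nx) (Fin ns) ℝ} {QW D : Matrix (Fin nx) (Fin nx) ℝ}
variable {Ω : Type*} {X : Ω → Vec nx} {S : Ω → Vec ns} {Y : Ω → Vec ny} {W : Ω → Vec nx}
variable [MeasurableSpace Ω] {μ : Measure Ω}

theorem IsRealization.map {Ω' : Type*} [MeasurableSpace Ω'] {ψ : Ω → Ω'} (hψ : Measurable ψ)
    {X' : Ω' → Vec nx} {S' : Ω' → Vec ns} {Y' : Ω' → Vec ny} {W' : Ω' → Vec nx}
    (hX : Measurable X') (hS : Measurable S') (hY : Measurable Y') (hW : Measurable W')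
    (hr : IsRealization P QW μ (fun ω => X' (ψ ω)) (fun ω => S' (ψ ω)) (fun ω => Y' (ψ ω))
      (fun ω => W' (ψ ω))) : IsRealization P QW (μ.map ψ) X' S' Y' W' := by
  have hs : Measurable fun ω => (X' ω, S' ω, Y' ω) := hX.prodMk (hS.prodMk hY)
  refine ⟨hX, hS, hY, hW, ?_, ?_, ?_⟩
  · rw [Measure.map_map hs hψ]
    exact hr.law_source
  · rw [Measure.map_map hW hψ]
    exact hr.law_noise
  · rw [indepFun_iff_measure_inter_preimage_eq_mul]
    intro s t hs' ht'
    rw [Measure.map_apply hψ ((hW hs').inter (hs ht')), Measure.map_apply hψ (hW hs'),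
      Measure.map_apply hψ (hs ht')]
    exact indepFun_iff_measure_inter_preimage_eq_mul.1 hr.indep s t hs' ht'

variable [IsGaussian P]

theorem measurable_toLp_mulVec_add {m n : ℕ} (A : Matrix (Fin m) (Fin n) ℝ) :
    Measurable fun p : (Fin m → ℝ) × (Fin n → ℝ) => (WithLp.toLp 2 (A *ᵥ p.2 + p.1) : Vec m) :=
  (by fun_prop : Measurable fun x : Fin m → ℝ => (WithLp.toLp 2 x : Vec m)).comp
    (((measurable_mulVec A).comp measurable_snd).add measurable_fst)

theorem IsRealization.sqInt_chanX (hr : IsRealization P QW μ X S Y W) :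
    SqInt μ fun ω => (chanX P H S Y W ω).ofLp := by
  simp only [chanX_ofLp X]
  exact ((linOf_source linOf_cy X S Y W).mulVec (gainX P) |>.sqInt hr.hasGaussianLaw).add
    (((linOf_chanRes P H).comp (chanG X S Y W)).sqInt hr.hasGaussianLaw)

theorem IsRealization.sqInt_chanZ (hr : IsRealization P QW μ X S Y W) :
    SqInt μ fun ω => (chanZ H S W ω).ofLp := by
  simp only [chanZ_ofLp P X Y]
  exact ((linOf_source linOf_cy X S Y W).mulVec (H * gainS P) |>.sqInt hr.hasGaussianLaw).add
    (((linOf_chanRes P H).comp (chanG X S Y W)).sqInt hr.hasGaussianLaw)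

variable [IsProbabilityMeasure μ]

/-- The covariance of a vector `K Y + (X̂ - E[X̂|Y])` given `Y`. -/
theorem IsRealization.condExp_Y_and_condCov (hr : IsRealization P QW μ X S Y W)
    (hQW : QW.PosSemidef) (hmean : ∫ v, v ∂P = 0) (hY : (covY P).PosDef) {Z : Ω → Vec nx}
    (hZ2 : SqInt μ fun ω => (Z ω).ofLp) {K : Matrix (Fin nx) (Fin ny) ℝ}
    (hK : ∀ ω, (Z ω).ofLp = K *ᵥ (Y ω).ofLp + chanRes P H (chanG X S Y W ω)) :
    μ[Z | sig Y] =ᵐ[μ] (fun ω => WithLp.toLp 2 (K *ᵥ (Y ω).ofLp)) ∧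
      condCov μ Z Z Y = covHatgY P H QW := by
  have h1 : μ[Z | sig Y] =ᵐ[μ] fun ω => WithLp.toLp 2 (K *ᵥ (Y ω).ofLp) :=
    hr.condExp_eq hmean (linOf_chanRes P H) hr.measurable_Y
      (hr.indepFun_Y_toLp hmean (linOf_chanRes P H) (hr.xmom_chanRes_cy hmean hY))
      (a := fun y => WithLp.toLp 2 (K *ᵥ y.ofLp)) (measurable_toLp_mulVec K)
      (fun ω => by rw [← WithLp.toLp_add, ← hK]) hZ2
  refine ⟨h1, ?_⟩
  have h2 : μ[Z | sig Y] =ᵐ[μ] fun ω =>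
      Z ω - WithLp.toLp 2 (chanRes P H (chanG X S Y W ω)) := by
    filter_upwards [h1] with ω hω
    rw [hω, eq_sub_iff_add_eq, ← WithLp.toLp_add, ← hK]
  rw [condCov_eq_xmom h2 h2]
  exact hr.xmom_chanRes hQW hmean hY

theorem IsRealization.condCov_hidden (hr : IsRealization P QW μ X S Y W)
    (h : IsChannelParam P H QW D) (hmean : ∫ v, v ∂P = 0) (hY : (covY P).PosDef)
    {Z : Ω → Vec nx} (hZ : Measurable Z) {K : Matrix (Fin nx) (Fin ny) ℝ}
    (hK : ∀ ω, (Z ω).ofLp = K *ᵥ (Y ω).ofLp + chanRes P H (chanG X S Y W ω)) :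
    condCov μ S S (fun ω => (Z ω, Y ω)) = covSgHatY P H QW := by
  set A := covSgY P * Hᵀ * pinv (covHatgY P H QW) with hA
  have hpost := linOf_chanPost P H QW
  have hto : Measurable fun x : Fin ns → ℝ => (WithLp.toLp 2 x : Vec ns) := by fun_prop
  have h1 := hr.condExp_eq (T := fun ω => (Z ω, Y ω)) (U := S) hmean hpost
    (hZ.prodMk hr.measurable_Y)
    (hr.indepFun_toLp hmean hpost (hr.xmom_chanPost_chanRes h hmean hY)
      (hr.xmom_chanPost_cy hmean hY)
      (φ := fun p => ((WithLp.toLp 2 (K *ᵥ p.2 + p.1) : Vec nx), (WithLp.toLp 2 p.2 : Vec ny)))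
      ((measurable_toLp_mulVec_add K).prodMk (by fun_prop))
      (fun ω => Prod.ext (by simp only [← hK]) rfl))
    (a := fun t => WithLp.toLp 2 (gainS P *ᵥ t.2.ofLp + A *ᵥ (t.1.ofLp - K *ᵥ t.2.ofLp)))
    (hto.comp (((measurable_mulVec (gainS P)).comp (by fun_prop :
      Measurable fun t : Vec nx × Vec ny => t.2.ofLp)).add ((measurable_mulVec A).comp
        ((by fun_prop : Measurable fun t : Vec nx × Vec ny => t.1.ofLp).sub
          ((measurable_mulVec K).comp (by fun_prop :
            Measurable fun t : Vec nx × Vec ny => t.2.ofLp))))))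
    (fun ω => by
      simp only [hK, add_sub_cancel_left]
      exact hidden_eq_add X ω)
    ((linOf_source linOf_cs X S Y W).sqInt hr.hasGaussianLaw)
  have h2 : μ[S | sig fun ω => (Z ω, Y ω)] =ᵐ[μ] fun ω =>
      S ω - WithLp.toLp 2 (chanPost P H QW (chanG X S Y W ω)) := by
    filter_upwards [h1] with ω hω
    rw [hω, eq_sub_iff_add_eq]
    simp only [hK, add_sub_cancel_left]
    exact (hidden_eq_add X ω).symm
  rw [condCov_eq_xmom h2 h2]
  exact hr.xmom_chanPost h hmean hY

/-- The statements on the conditional law and mean of X given X̂ rest on one fact: X = X̂ + error,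
with an error independent of (X̂, Y, Z). The equalities between Z and X̂ come from the formulas
valid for every K. -/
theorem IsRealization.structuralProperties (hr : IsRealization P QW μ X S Y W)
    (h : IsChannelParam P H QW D) (hmean : ∫ v, v ∂P = 0) (hY : (covY P).PosDef) :
    StructuralProperties P H QW D μ X S Y (chanZ H S W) (chanX P H S Y W) := by
  have hG := hr.hasGaussianLaw
  have hXm := hr.measurable_chanX (H := H)
  have hZm := hr.measurable_chanZ (H := H)
  have hYm := hr.measurable_Y
  have herr := linOf_chanErr P H
  have herrm : Measurable fun ω => (WithLp.toLp 2 (chanErr P H (chanG X S Y W ω)) : Vec nx) :=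
    (by fun_prop : Measurable fun x : Fin nx → ℝ => (WithLp.toLp 2 x : Vec nx)).comp
      (herr.measurable.comp hr.measurable_chanG)
  have hKX := chanX_ofLp (P := P) (H := H) (S := S) (Y := Y) (W := W) X
  have hKZ := chanZ_ofLp (H := H) (S := S) (W := W) P X Y
  have hindXYZ : IndepFun (fun ω => (chanX P H S Y W ω, Y ω, chanZ H S W ω))
      (fun ω => (WithLp.toLp 2 (chanErr P H (chanG X S Y W ω)) : Vec nx)) μ :=
    hr.indepFun_toLp hmean herr (hr.xmom_chanErr_chanRes h hmean hY)
      (hr.xmom_chanErr_cy hmean hY)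
      (φ := fun p => ((WithLp.toLp 2 (gainX P *ᵥ p.2 + p.1) : Vec nx),
        (WithLp.toLp 2 p.2 : Vec ny), (WithLp.toLp 2 ((H * gainS P) *ᵥ p.2 + p.1) : Vec nx)))
      ((measurable_toLp_mulVec_add _).prodMk ((by fun_prop : Measurable
        fun p : (Fin nx → ℝ) × (Fin ny → ℝ) => (WithLp.toLp 2 p.2 : Vec ny)).prodMk
        (measurable_toLp_mulVec_add _)))
      (fun ω => by rw [← hKX, ← hKZ])
  have hindXY : IndepFun (fun ω => (chanX P H S Y W ω, Y ω))
      (fun ω => (WithLp.toLp 2 (chanErr P H (chanG X S Y W ω)) : Vec nx)) μ :=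
    hindXYZ.comp (φ := fun t => (t.1, t.2.1)) (by fun_prop) measurable_id
  have hindX : IndepFun (chanX P H S Y W)
      (fun ω => (WithLp.toLp 2 (chanErr P H (chanG X S Y W ω)) : Vec nx)) μ :=
    hindXYZ.comp (φ := fun t : Vec nx × Vec ny × Vec nx => t.1) (by fun_prop) measurable_id
  have hX2 : SqInt μ fun ω => (X ω).ofLp := (linOf_source linOf_cx X S Y W).sqInt hG
  have hEX : μ[X | sig (chanX P H S Y W)] =ᵐ[μ] chanX P H S Y W :=
    hr.condExp_eq hmean herr hXm hindX (a := id) measurable_id source_eq_chanX_add hX2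
  have hcovX := hr.condExp_Y_and_condCov h.noise_posSemidef hmean hY hr.sqInt_chanX hKX
  have hcovZ := hr.condExp_Y_and_condCov h.noise_posSemidef hmean hY hr.sqInt_chanZ hKZ
  have hSX := hr.condCov_hidden h hmean hY hXm hKX
  have hSZ := hr.condCov_hidden h hmean hY hZm hKZ
  refine ⟨?_, ?_, ?_, hr.condLawEq_chanZ, ?_, ?_, ?_, hSX, hcovX.2, ?_, ?_, hEX, ?_⟩
  · rw [← hr.xmom_chanErr h hmean hY]
    ext i j
    have he : ∀ ω, X ω - chanX P H S Y W ω = WithLp.toLp 2 (chanErr P H (chanG X S Y W ω)) :=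
      fun ω => sub_eq_of_eq_add' (source_eq_chanX_add ω)
    simp only [secondMoment, he]
    rfl
  · exact condLawEq_of_indepFun (k := fun t : Vec nx × Vec ny × Vec nx => t.1)
      (k' := fun t : Vec nx × Vec ny => t.1) (g := fun t : Vec nx × Vec ny × Vec nx => (t.1, t.2.1))
      (F := fun p : Vec nx × Vec nx => p.1 + p.2) herrm (hXm.prodMk (hYm.prodMk hZm)) hindXYZ
      (by fun_prop) (by fun_prop) (by fun_prop) (fun _ => rfl) (fun _ => rfl) (by fun_prop)
      source_eq_chanX_add
  · exact condLawEq_of_indepFun (k := fun t : Vec nx × Vec ny => t.1)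
      (k' := id) (g := fun t : Vec nx × Vec ny => t.1)
      (F := fun p : Vec nx × Vec nx => p.1 + p.2) herrm (hXm.prodMk hYm) hindXY
      (by fun_prop) (by fun_prop) (by fun_prop) (fun _ => rfl) (fun _ => rfl) (by fun_prop)
      source_eq_chanX_add
  · rw [hr.condMutualInfo_eq h hmean hY hZm hKZ, hr.condMutualInfo_eq h hmean hY hXm hKX]
  · rw [hSX, hSZ]
  · rw [hcovX.2, hcovZ.2]
  · rw [hcovX.2, h.covHatgY_eq, h.mul_eq_sub]
  · refine Filter.EventuallyEq.trans ?_ hEX.symm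
    exact hr.condExp_eq hmean herr (hXm.prodMk (hYm.prodMk hZm)) hindXYZ
      (a := fun t => t.1) measurable_fst source_eq_chanX_add hX2
  · refine Filter.EventuallyEq.trans ?_ hcovX.1.symm
    refine hr.condExp_eq (R := fun p => resX P p.1) (T := Y)
      (a := fun y => WithLp.toLp 2 (gainX P *ᵥ y.ofLp)) hmean (linOf_resX P).comp_fst hYm
      (hr.indepFun_Y_toLp (U := fun p => resX P p.1) hmean (linOf_resX P).comp_fst
        ((xmom_comp hr.measurable_source hr.law_source (linOf_resX P) linOf_cy).trans
          (xmom_resX_cy hmean hY)))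
      (measurable_toLp_mulVec _) (fun ω => ?_) hX2
    rw [← WithLp.toLp_add]
    have : resX P (chanG X S Y W ω).1 = (X ω).ofLp - gainX P *ᵥ (Y ω).ofLp := rfl
    rw [this, add_sub_cancel]

theorem IsRealization.decAdmissible (hr : IsRealization P QW μ X S Y W)
    (h : IsChannelParam P H QW D) (hmean : ∫ v, v ∂P = 0) (hY : (covY P).PosDef) {Δ : ℝ}
    (htr : D.trace ≤ Δ) : DecAdmissible μ X S Y (chanZ H S W) (chanDec P H) Δ :=
  ⟨hr.measurable_chanZ, measurable_chanDec P H, hr.condLawEq_chanZ,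
    (hr.mse_chanX h hmean hY).le.trans (ENNReal.ofReal_le_ofReal htr)⟩

theorem IsRealization.encAdmissible (hr : IsRealization P QW μ X S Y W)
    (h : IsChannelParam P H QW D) (hmean : ∫ v, v ∂P = 0) (hY : (covY P).PosDef) {Δ : ℝ}
    (htr : D.trace ≤ Δ) : EncAdmissible μ X S Y (chanX P H S Y W) Δ :=
  ⟨hr.measurable_chanX, hr.condLawEq_chanX,
    (hr.mse_chanX h hmean hY).le.trans (ENNReal.ofReal_le_ofReal htr)⟩

theorem isRealization_prod (P : Measure (Src nx ns ny)) [IsProbabilityMeasure P]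
    (QW : Matrix (Fin nx) (Fin nx) ℝ) :
    IsRealization P QW (P.prod (multivariateGaussian 0 QW)) (fun p => srcX p.1)
      (fun p => srcS p.1) (fun p => srcY p.1) Prod.snd := by
  refine ⟨by fun_prop, by fun_prop, by fun_prop, measurable_snd, ?_, ?_, ?_⟩
  · exact Measure.fst_prod
  · exact Measure.snd_prod
  · exact (indepFun_prod (X := fun v : Src nx ns ny => v) (Y := fun w : Vec nx => w) measurable_id
      measurable_id).symm

/-- The rate distortion function ranges over laws on a product space whose second coordinate is Z
itself. The independent pair of source and noise is therefore pushed forward to ((X, S, Y), H S +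
W), and the noise is recovered by subtracting H S. -/
theorem IsChannelParam.exists_decLaw (h : IsChannelParam P H QW D) (hmean : ∫ v, v ∂P = 0)
    (hY : (covY P).PosDef) {Δ : ℝ} (htr : D.trace ≤ Δ) :
    ∃ ρ : ProbabilityMeasure (Src nx ns ny × Vec nx), IsDecLaw P Δ ρ ∧
      condMutualInfo (ρ : Measure (Src nx ns ny × Vec nx)) (fun v => srcS v.1) Prod.snd
        (fun v => srcY v.1) = halfLogDetRatio (covSgY P) (covSgHatY P H QW) := by
  have hH : Measurable fun v : Src nx ns ny × Vec nx => toEuclideanLin H (srcS v.1) :=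
    (measurable_toEuclideanLin H).comp (by fun_prop)
  let ψ : Src nx ns ny × Vec nx → Src nx ns ny × Vec nx :=
    fun p => (p.1, toEuclideanLin H (srcS p.1) + p.2)
  let W' : Src nx ns ny × Vec nx → Vec nx := fun p => p.2 - toEuclideanLin H (srcS p.1)
  have hψ : Measurable ψ := measurable_fst.prodMk (hH.add measurable_snd)
  have hW' : Measurable W' := measurable_snd.sub hH
  have hWψ : (fun p => W' (ψ p)) = Prod.snd := funext fun p => add_sub_cancel_left _ _
  have hr : IsRealization P QW ((P.prod (multivariateGaussian 0 QW)).map ψ)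
      (fun p => srcX p.1) (fun p => srcS p.1) (fun p => srcY p.1) W' := by
    refine IsRealization.map hψ (by fun_prop) (by fun_prop) (by fun_prop) hW' ?_
    rw [hWψ]
    exact isRealization_prod P QW
  have := Measure.isProbabilityMeasure_map (μ := P.prod (multivariateGaussian 0 QW))
    hψ.aemeasurable
  have hZ : chanZ H (fun p : Src nx ns ny × Vec nx => srcS p.1) W' = Prod.snd :=
    funext fun p => add_sub_cancel _ _
  refine ⟨⟨_, this⟩, ⟨hr.law_source, chanDec P H, ?_⟩, ?_⟩
  · rw [← hZ]
    exact hr.decAdmissible h hmean hY htr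
  · rw [← hZ]
    exact hr.condMutualInfo_eq h hmean hY hr.measurable_chanZ (chanZ_ofLp P _ _)

theorem IsChannelParam.exists_encLaw (h : IsChannelParam P H QW D) (hmean : ∫ v, v ∂P = 0)
    (hY : (covY P).PosDef) {Δ : ℝ} (htr : D.trace ≤ Δ) :
    ∃ ρ : ProbabilityMeasure (Src nx ns ny × Vec nx), IsEncLaw P Δ ρ ∧
      condMutualInfo (ρ : Measure (Src nx ns ny × Vec nx)) (fun v => srcS v.1) Prod.snd
        (fun v => srcY v.1) = halfLogDetRatio (covSgY P) (covSgHatY P H QW) := by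
  let K := (covXY P - H * covSY P) * (covY P)⁻¹
  have hH : Measurable fun v : Src nx ns ny × Vec nx => toEuclideanLin H (srcS v.1) :=
    (measurable_toEuclideanLin H).comp (by fun_prop)
  have hK : Measurable fun v : Src nx ns ny × Vec nx => toEuclideanLin K (srcY v.1) :=
    (measurable_toEuclideanLin K).comp (by fun_prop)
  let ψ : Src nx ns ny × Vec nx → Src nx ns ny × Vec nx :=
    fun p => (p.1, toEuclideanLin K (srcY p.1) + (toEuclideanLin H (srcS p.1) + p.2))
  let W' : Src nx ns ny × Vec nx → Vec nx :=
    fun p => p.2 - toEuclideanLin K (srcY p.1) - toEuclideanLin H (srcS p.1)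
  have hψ : Measurable ψ := measurable_fst.prodMk (hK.add (hH.add measurable_snd))
  have hW' : Measurable W' := (measurable_snd.sub hK).sub hH
  have hWψ : (fun p => W' (ψ p)) = Prod.snd := funext fun p => by
    change _ + (_ + p.2) - _ - _ = p.2
    rw [add_sub_cancel_left, add_sub_cancel_left]
  have hr : IsRealization P QW ((P.prod (multivariateGaussian 0 QW)).map ψ)
      (fun p => srcX p.1) (fun p => srcS p.1) (fun p => srcY p.1) W' := by
    refine IsRealization.map hψ (by fun_prop) (by fun_prop) (by fun_prop) hW' ?_
    rw [hWψ]
    exact isRealization_prod P QW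
  have := Measure.isProbabilityMeasure_map (μ := P.prod (multivariateGaussian 0 QW))
    hψ.aemeasurable
  have hX : chanX P H (fun p : Src nx ns ny × Vec nx => srcS p.1) (fun p => srcY p.1) W'
      = Prod.snd := funext fun p => by
    change toEuclideanLin K (srcY p.1) + (toEuclideanLin H (srcS p.1)
      + (p.2 - toEuclideanLin K (srcY p.1) - toEuclideanLin H (srcS p.1))) = p.2
    rw [add_sub_cancel, add_sub_cancel]
  refine ⟨⟨_, this⟩, ⟨hr.law_source, ?_⟩, ?_⟩
  · rw [← hX]
    exact hr.encAdmissible h hmean hY htr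
  · rw [← hX]
    exact hr.condMutualInfo_eq h hmean hY hr.measurable_chanX (chanX_ofLp _)

end StructuralProperties

/-! ### The converse bound. -/

section Converse

theorem xmom_sub_sub {Ω ι : Type*} [MeasurableSpace Ω] {μ : Measure Ω} {U V : Ω → ι → ℝ}
    (hU : SqInt μ U) (hV : SqInt μ V) :
    xmom μ (fun ω => U ω - V ω) (fun ω => U ω - V ω)
      = xmom μ U U - xmom μ U V - (xmom μ U V)ᵀ + xmom μ V V := by
  rw [xmom_sub_left hU hV (hU.sub hV), xmom_sub_right hU hU hV, xmom_sub_right hV hU hV,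
    xmom_transpose]
  abel

theorem xmom_eq_zero_of_indepFun {Ω ι κ : Type*} [MeasurableSpace Ω] {μ : Measure Ω}
    {U : Ω → ι → ℝ} {V : Ω → κ → ℝ} (hU : SqInt μ U) (hV : SqInt μ V) (h : IndepFun U V μ)
    (h0 : ∀ i, ∫ ω, U ω i ∂μ = 0) : xmom μ U V = 0 := by
  ext i j
  have h1 := (h.comp (measurable_pi_apply i) (measurable_pi_apply j)).integral_mul_eq_mul_integral
    (hU i).aestronglyMeasurable (hV j).aestronglyMeasurable
  have h2 : ∫ ω, ((fun x : ι → ℝ => x i) ∘ U) ω ∂μ = 0 := h0 i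
  rw [h2, zero_mul] at h1
  exact h1

/-- The normal equations of linear least squares estimation. -/
theorem exists_normal_equation {Ω ι : Type*} [MeasurableSpace Ω] {μ : Measure Ω} {n : ℕ}
    [Fintype ι] {U : Ω → Fin n → ℝ} {V : Ω → ι → ℝ} (hU : SqInt μ U) (hV : SqInt μ V) :
    ∃ Γ : Matrix ι (Fin n) ℝ, Γ * xmom μ U U = xmom μ V U := by
  have hp := isPinv_pinv (xmom_posSemidef hU)
  refine ⟨xmom μ V U * (pinv (xmom μ U U))ᵀ, ?_⟩
  set Q := xmom μ U U with hQ
  have hQt : Qᵀ = Q := xmom_transpose U U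
  -- The component of U in the kernel of its second moment matrix vanishes almost surely, so it does
  -- not contribute to the cross moment with V.
  have h1 : (1 - Q * pinv Q) * Q = 0 := by rw [Matrix.sub_mul, hp.1, Matrix.one_mul, sub_self]
  have h2 : xmom μ V (fun ω => (1 - Q * pinv Q) *ᵥ U ω) = 0 := by
    rw [xmom_congr (ae_eq_refl V) (V' := fun _ => 0) (ae_mulVec_eq_zero hU h1)]
    ext i j
    simp [xmom]
  rw [xmom_mulVec_right hV hU, transpose_sub, transpose_one, hp.2.2.1, Matrix.mul_sub,
    Matrix.mul_one, sub_eq_zero] at h2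
  rw [Matrix.mul_assoc]
  conv_lhs => rw [← hQt, ← transpose_mul, hQt, hp.2.2.1, ← h2]

variable {nx ns ny r : ℕ} {P : Measure (Src nx ns ny)} [IsGaussian P]
  {B : Matrix (Fin ns) (Fin r) ℝ} {Bp : Matrix (Fin r) (Fin ns) ℝ}

/-- The innovation of `X` is independent of `(Y, Z)` if `Z` is conditionally independent of
`(X, S, Y)` given a function of `(S, Y)`. -/
theorem IsWhitening.indepFun_innov (hw : IsWhitening P B Bp) (hmean : ∫ v, v ∂P = 0)
    (hY : (covY P).PosDef) {Ω ζ δ : Type*} [MeasurableSpace Ω] [MeasurableSpace ζ]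
    [MeasurableSpace δ] {μ : Measure Ω} [IsProbabilityMeasure μ] {ξ : Ω → Src nx ns ny}
    (hξ : Measurable ξ) (hlaw : μ.map ξ = P) {Z : Ω → ζ} (hZ : Measurable Z)
    {g' : Vec ns × Vec ny → δ} (hg' : Measurable g')
    (hM : CondLawEq μ Z ξ fun ω => g' (srcS (ξ ω), srcY (ξ ω))) :
    IndepFun (fun ω => innov P Bp (ξ ω)) (fun ω => (srcY (ξ ω), Z ω)) μ := by
  have hto : ∀ n, Measurable fun x : Fin n → ℝ => (WithLp.toLp 2 x : Vec n) := fun n => by fun_prop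
  have hP : IndepFun (innov P Bp) (fun v : Src nx ns ny => (srcS v, srcY v)) P := by
    have h1 := ((linOf_innov P Bp).indepFun_id hmean (linOf_resS P) linOf_cy
      (hw.xmom_innov_resS hmean hY) (xmom_innov_cy hmean hY)).symm
    have h2 := h1.comp measurable_id (ψ := fun p : (Fin ns → ℝ) × (Fin ny → ℝ) =>
      ((WithLp.toLp 2 (gainS P *ᵥ p.2 + p.1) : Vec ns), (WithLp.toLp 2 p.2 : Vec ny)))
      ((measurable_toLp_mulVec_add _).prodMk ((hto ny).comp measurable_snd))
    have h4 : (fun v : Src nx ns ny => (srcS v, srcY v)) = fun v =>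
        ((WithLp.toLp 2 (gainS P *ᵥ cy v + resS P v) : Vec ns),
          (WithLp.toLp 2 (cy v) : Vec ny)) := by
      funext v
      rw [resS, add_sub_cancel]
      rfl
    rw [h4]
    exact h2
  -- This gives independence of (S, Y, Z); S is then dropped.
  have h3 := indepFun_of_condLawEq hξ hZ (linOf_innov P Bp).measurable
    (g := fun v : Src nx ns ny => (srcS v, srcY v)) (by fun_prop) hg' hM
    (indepFun_comp_of_map hξ hlaw (linOf_innov P Bp).measurable (by fun_prop) hP)
  exact h3.comp measurable_id (ψ := fun t : (Vec ns × Vec ny) × ζ => (t.1.2, t.2)) (by fun_prop)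

/-- The reconstruction, centred at E[X|Y], is replaced by the linear least squares estimate V of X -
E[X|Y] built from it, and J = E[V Nᵀ]. Only the second moments of V matter; no Gaussian assumption
on Z is made. The two problems enter only through the independence of the innovation from (Y, Z). -/
theorem IsWhitening.exists_feasible_le (hw : IsWhitening P B Bp) (hmean : ∫ v, v ∂P = 0)
    (hY : (covY P).PosDef) {Δ : ℝ} (hΔ : 0 ≤ Δ) {Ω ζ : Type*} [MeasurableSpace Ω]
    [MeasurableSpace ζ] {μ : Measure Ω} [IsProbabilityMeasure μ] {ξ : Ω → Src nx ns ny}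
    (hξ : Measurable ξ) (hlaw : μ.map ξ = P) {Z : Ω → ζ} (hZ : Measurable Z)
    {f : Vec ny × ζ → Vec nx} (hf : Measurable f)
    (hdist : mse μ (fun ω => srcX (ξ ω)) (fun ω => f (srcY (ξ ω), Z ω)) ≤ ENNReal.ofReal Δ)
    (hind : IndepFun (fun ω => innov P Bp (ξ ω)) (fun ω => (srcY (ξ ω), Z ω)) μ) :
    ∃ J, Feasible (whiteC P Bp) (covXgY P) Δ J ∧
      halfLogInv (schur (J * (whiteC P Bp)ᵀ) J).det
        ≤ condMutualInfo μ (fun ω => srcS (ξ ω)) Z (fun ω => srcY (ξ ω)) := by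
  have hG : HasGaussianLaw ξ μ := ⟨by rw [hlaw]; infer_instance⟩
  have h0 : ∫ ω, ξ ω ∂μ = 0 := by
    rw [← hmean, ← hlaw]
    exact (integral_map hξ.aemeasurable measurable_id.aestronglyMeasurable).symm
  set C := whiteC P Bp with hC
  have hxl : LinOf ξ fun ω => resX P (ξ ω) := (linOf_resX P).comp ξ
  have hNl : LinOf ξ fun ω => whiteS P Bp (ξ ω) := (linOf_whiteS P Bp).comp ξ
  have hel : LinOf ξ fun ω => innov P Bp (ξ ω) := (linOf_innov P Bp).comp ξ
  have hx := hxl.sqInt hG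
  have hN := hNl.sqInt hG
  have he := hel.sqInt hG
  have hTm : Measurable fun ω => (srcY (ξ ω), Z ω) := (measurable_srcY.comp hξ).prodMk hZ
  -- the reconstruction, centred at `E[X|Y]`
  let est : Vec ny × ζ → Fin nx → ℝ := fun t => (f t).ofLp - gainX P *ᵥ t.1.ofLp
  have hest : Measurable est := ((by fun_prop : Measurable fun x : Vec nx => x.ofLp).comp hf).sub
    ((measurable_mulVec _).comp (by fun_prop : Measurable fun t : Vec ny × ζ => t.1.ofLp))
  let U : Ω → Fin nx → ℝ := fun ω => est (srcY (ξ ω), Z ω)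
  have hxU : ∀ ω, resX P (ξ ω) - U ω = (srcX (ξ ω) - f (srcY (ξ ω), Z ω)).ofLp := by
    intro ω
    change cx (ξ ω) - gainX P *ᵥ cy (ξ ω) - ((f (srcY (ξ ω), Z ω)).ofLp - gainX P *ᵥ cy (ξ ω))
      = cx (ξ ω) - (f (srcY (ξ ω), Z ω)).ofLp
    abel
  have herr : SqInt μ fun ω => resX P (ξ ω) - U ω := by
    simp only [hxU]
    exact sqInt_of_lintegral_ne_top ((measurable_srcX.comp hξ).sub (hf.comp hTm))
      (ne_top_of_le_ne_top ENNReal.ofReal_ne_top hdist)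
  have htr : (xmom μ (fun ω => resX P (ξ ω) - U ω) fun ω => resX P (ξ ω) - U ω).trace ≤ Δ := by
    rw [← ENNReal.ofReal_le_ofReal_iff hΔ]
    simp only [hxU] at herr ⊢
    rw [← lintegral_enorm_sq herr]
    exact hdist
  have hU : SqInt μ U := by
    have := hx.sub herr
    simpa only [sub_sub_cancel] using this
  obtain ⟨Γ, hΓ⟩ := exists_normal_equation hU hx
  let V : Ω → Fin nx → ℝ := fun ω => Γ *ᵥ U ω
  have hV : SqInt μ V := hU.mulVec Γ
  have hVU : xmom μ V U = xmom μ (fun ω => resX P (ξ ω)) U := by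
    rw [← hΓ]; exact xmom_mulVec_left hU hU Γ
  have hxV : xmom μ (fun ω => resX P (ξ ω)) V = xmom μ V V := by
    have h1 : xmom μ V V = xmom μ V U * Γᵀ := xmom_mulVec_right hV hU Γ
    rw [h1, hVU]
    exact xmom_mulVec_right hx hU Γ
  have hVt : (xmom μ V V)ᵀ = xmom μ V V := xmom_transpose V V
  set J := xmom μ V (fun ω => whiteS P Bp (ξ ω)) with hJ
  -- Expand X - E[X|Y] as innovation plus C N. The innovation is centred and independent of V, so
  -- E[V (X - E[X|Y])ᵀ] is E[V Nᵀ] Cᵀ; by orthogonality it is also E[V Vᵀ].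
  have hJC : J * Cᵀ = xmom μ V V := by
    have hindV : IndepFun (fun ω => innov P Bp (ξ ω)) V μ :=
      hind.comp measurable_id (ψ := fun t => Γ *ᵥ est t) ((measurable_mulVec Γ).comp hest)
    have h1 := xmom_eq_zero_of_indepFun he hV hindV (hel.integral_eq_zero hG h0)
    rw [← hVt, ← hxV, xmom_transpose]
    have h2 : (fun ω => resX P (ξ ω))
        = fun ω => innov P Bp (ξ ω) + C *ᵥ whiteS P Bp (ξ ω) :=
      funext fun ω => (sub_add_cancel _ _).symm
    rw [h2, xmom_add_right hV he (hN.mulVec C), xmom_mulVec_right hV hN, ← xmom_transpose _ V, h1,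
      transpose_zero, zero_add]
  have hNN : xmom μ (fun ω => whiteS P Bp (ξ ω)) (fun ω => whiteS P Bp (ξ ω)) = 1 :=
    (xmom_comp hξ hlaw (linOf_whiteS P Bp) (linOf_whiteS P Bp)).trans (hw.xmom_whiteS hmean hY)
  have hxx : xmom μ (fun ω => resX P (ξ ω)) (fun ω => resX P (ξ ω)) = covXgY P :=
    (xmom_comp hξ hlaw (linOf_resX P) (linOf_resX P)).trans (covXgY_eq hmean hY).symm
  have hPSD : (xmom μ V V).PosSemidef := xmom_posSemidef hV
  -- This is the second moment matrix of V - J N, as N is white.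
  have hnoise : (xmom μ V V - J * Jᵀ).PosSemidef := by
    have h1 := xmom_posSemidef (hV.sub (hN.mulVec J))
    rw [xmom_sub_sub hV (hN.mulVec J), xmom_mulVec_right hV hN,
      xmom_mulVec_right (hN.mulVec J) hN, xmom_mulVec_left hN hN, hNN, Matrix.mul_one, ← hJ,
      transpose_mul, transpose_transpose, sub_add_cancel] at h1
    exact h1
  have herrV : xmom μ (fun ω => resX P (ξ ω) - V ω) (fun ω => resX P (ξ ω) - V ω)
      = covXgY P - xmom μ V V := by
    rw [xmom_sub_sub hx hV, hxx, hxV, hVt, sub_add_cancel]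
  refine ⟨J, ⟨?_, ?_, ?_, ?_⟩, ?_⟩
  · rwa [hJC]
  · rwa [hJC]
  · rw [hJC, ← herrV]
    exact xmom_posSemidef (hx.sub hV)
  · refine le_trans ?_ htr
    -- Pythagoras: passing from U to V lowers the error matrix by E[(V - U)(V - U)ᵀ].
    have h1 := (xmom_posSemidef (hV.sub hU)).trace_nonneg
    have h2 : xmom μ (fun ω => resX P (ξ ω) - U ω) (fun ω => resX P (ξ ω) - U ω)
        = (covXgY P - xmom μ V V) + xmom μ (fun ω => V ω - U ω) fun ω => V ω - U ω := by
      rw [xmom_sub_sub hx hU, xmom_sub_sub hV hU, hVU, hxx]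
      abel
    rw [hJC, h2, trace_add]
    linarith
  · rw [hw.condMutualInfo_eq hmean hY hξ hlaw hZ, hJC, det_schur_eq hPSD hnoise]
    -- A V is the best linear estimate of N from V; its error covariance is the Schur complement.
    set A := Jᵀ * pinv (xmom μ V V) with hA
    have h1 := mutualInfo_ge (T := fun ω => (srcY (ξ ω), Z ω)) (N := fun ω => whiteS P Bp (ξ ω))
      (u := fun t => A *ᵥ (Γ *ᵥ est t)) hTm ((linOf_whiteS P Bp).measurable.comp hξ)
      (hNl.hasGaussianLaw hG) (hNl.integral_eq_zero hG h0) hNN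
      ((measurable_mulVec A).comp ((measurable_mulVec Γ).comp hest)) (hV.mulVec A)
    refine le_trans (le_of_eq ?_) h1
    have h2 := xmom_sub_sub hN (hV.mulVec A)
    rw [xmom_mulVec_right hN hV, xmom_mulVec_right (hV.mulVec A) hV, xmom_mulVec_left hV hV, hNN,
      ← xmom_transpose V, ← hJ, ← transpose_mul, transpose_transpose,
      sub_right_comm] at h2
    rw [← h2]

/-- Every admissible auxiliary variable is outperformed by a feasible Gaussian one. -/
theorem IsWhitening.exists_feasible_of_dec (hw : IsWhitening P B Bp) (hmean : ∫ v, v ∂P = 0)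
    (hY : (covY P).PosDef) {Δ : ℝ} (hΔ : 0 ≤ Δ) {ζ : Type*} [MeasurableSpace ζ]
    {ρ : ProbabilityMeasure (Src nx ns ny × ζ)} (hρ : IsDecLaw P Δ ρ) :
    ∃ J, Feasible (whiteC P Bp) (covXgY P) Δ J ∧
      halfLogInv (schur (J * (whiteC P Bp)ᵀ) J).det
        ≤ condMutualInfo (ρ : Measure (Src nx ns ny × ζ)) (fun v => srcS v.1) Prod.snd
          (fun v => srcY v.1) := by
  obtain ⟨hlaw, f, hadm⟩ := hρ
  refine hw.exists_feasible_le hmean hY hΔ measurable_fst hlaw measurable_snd hadm.measurable_rec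
    hadm.distortion ?_
  exact hw.indepFun_innov hmean hY measurable_fst hlaw measurable_snd
    (g' := fun d => d.1) measurable_fst hadm.markov

/-- The same bound holds although the encoder sees Y, because the innovation is independent of S and
Y together; this is why side information at the encoder gains nothing. Here X̂ is its own
reconstruction. -/
theorem IsWhitening.exists_feasible_of_enc (hw : IsWhitening P B Bp) (hmean : ∫ v, v ∂P = 0)
    (hY : (covY P).PosDef) {Δ : ℝ} (hΔ : 0 ≤ Δ)
    {ρ : ProbabilityMeasure (Src nx ns ny × Vec nx)} (hρ : IsEncLaw P Δ ρ) :
    ∃ J, Feasible (whiteC P Bp) (covXgY P) Δ J ∧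
      halfLogInv (schur (J * (whiteC P Bp)ᵀ) J).det
        ≤ condMutualInfo (ρ : Measure (Src nx ns ny × Vec nx)) (fun v => srcS v.1) Prod.snd
          (fun v => srcY v.1) := by
  obtain ⟨hlaw, hadm⟩ := hρ
  refine hw.exists_feasible_le hmean hY hΔ measurable_fst hlaw measurable_snd (f := Prod.snd)
    measurable_snd hadm.distortion ?_
  exact hw.indepFun_innov hmean hY measurable_fst hlaw measurable_snd
    (g' := id) measurable_id hadm.markov

end Converse

/-! ### Identification of both rates and both characterizations with the optimum. -/

section Optimality

variable {nx ns ny r : ℕ} {P : Measure (Src nx ns ny)}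
  {B : Matrix (Fin ns) (Fin r) ℝ} {Bp : Matrix (Fin r) (Fin ns) ℝ} {Δ : ℝ}

/-- The rate of the best test channel at distortion `Δ`. -/
def feasibleRate (P : Measure (Src nx ns ny)) (Bp : Matrix (Fin r) (Fin ns) ℝ) (Δ : ℝ) : ℝ≥0∞ :=
  ⨅ (J : Matrix (Fin nx) (Fin r) ℝ) (_ : Feasible (whiteC P Bp) (covXgY P) Δ J),
    halfLogInv (schur (J * (whiteC P Bp)ᵀ) J).det

/-- The best rate is attained. -/
theorem exists_feasible_eq_rate (h : ∃ J, Feasible (whiteC P Bp) (covXgY P) Δ J) :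
    ∃ J, Feasible (whiteC P Bp) (covXgY P) Δ J ∧
      halfLogInv (schur (J * (whiteC P Bp)ᵀ) J).det = feasibleRate P Bp Δ := by
  obtain ⟨J, hJ, hmax⟩ := exists_feasible_max h
  exact ⟨J, hJ, le_antisymm (le_iInf₂ fun J' hJ' => halfLogInv_anti
    (schur_posSemidef hJ'.posSemidef hJ'.noise_posSemidef).det_nonneg (hmax J' hJ'))
    (iInf₂_le J hJ)⟩

variable [IsGaussian P]

theorem Feasible.channel_schur {J : Matrix (Fin nx) (Fin r) ℝ}
    (h : Feasible (whiteC P Bp) (covXgY P) Δ J) (hw : IsWhitening P B Bp)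
    (hmean : ∫ v, v ∂P = 0) (hY : (covY P).PosDef) :
    schur (covHatgY P (J * Bp) (J * (whiteC P Bp)ᵀ - J * Jᵀ)) (J * Bp * B)
      = schur (J * (whiteC P Bp)ᵀ) J := by
  have hJ : J * Bp * B = J := by rw [Matrix.mul_assoc, hw.left_inv, Matrix.mul_one]
  rw [(h.isChannelParam hw hmean hY).covHatgY_eq_white hw hmean hY, hJ]

theorem IsWhitening.rdfDec_eq (hw : IsWhitening P B Bp) (hmean : ∫ v, v ∂P = 0)
    (hY : (covY P).PosDef) (hΔ : 0 ≤ Δ) : rdfDec P Δ = feasibleRate P Bp Δ := by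
  refine le_antisymm (le_iInf₂ fun J hJ => ?_)
    (le_iInf fun ζ => le_iInf fun _ => le_iInf₂ fun ρ hρ => ?_)
  · have h := hJ.isChannelParam hw hmean hY
    obtain ⟨ρ, hρ, hI⟩ := h.exists_decLaw hmean hY hJ.trace_le
    rw [h.halfLogDetRatio_source hw, hJ.channel_schur hw hmean hY] at hI
    rw [← hI]
    exact iInf_le_of_le (Vec nx) (iInf_le_of_le inferInstance (iInf₂_le ρ hρ))
  · obtain ⟨J, hJ, hle⟩ := hw.exists_feasible_of_dec hmean hY hΔ hρ
    exact (iInf₂_le J hJ).trans hle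

theorem IsWhitening.rdfEnc_eq (hw : IsWhitening P B Bp) (hmean : ∫ v, v ∂P = 0)
    (hY : (covY P).PosDef) (hΔ : 0 ≤ Δ) : rdfEnc P Δ = feasibleRate P Bp Δ := by
  refine le_antisymm (le_iInf₂ fun J hJ => ?_) (le_iInf₂ fun ρ hρ => ?_)
  · have h := hJ.isChannelParam hw hmean hY
    obtain ⟨ρ, hρ, hI⟩ := h.exists_encLaw hmean hY hJ.trace_le
    rw [h.halfLogDetRatio_source hw, hJ.channel_schur hw hmean hY] at hI
    rw [← hI]
    exact iInf₂_le ρ hρ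
  · obtain ⟨J, hJ, hle⟩ := hw.exists_feasible_of_enc hmean hY hΔ hρ
    exact (iInf₂_le J hJ).trans hle

/-- Feasible matrices and parameters correspond through J = H B and H = J Bp with equal objective,
and the ordering constraints are automatic. -/
theorem IsWhitening.sourceCharacterization_eq (hw : IsWhitening P B Bp) (hmean : ∫ v, v ∂P = 0)
    (hY : (covY P).PosDef) : sourceCharacterization P Δ = feasibleRate P Bp Δ := by
  refine le_antisymm (le_iInf₂ fun J hJ => ?_)
    (le_iInf fun H => le_iInf fun QW => le_iInf₂ fun D hD => ?_)
  · have h := hJ.isChannelParam hw hmean hY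
    rw [← hJ.channel_schur hw hmean hY, ← h.halfLogDetRatio_source hw]
    exact iInf_le_of_le _ (iInf_le_of_le _ (iInf₂_le _ ⟨h, hJ.error_posSemidef, hJ.trace_le,
      h.covSgY_sub_posSemidef hw, h.covSgHatY_posSemidef hw⟩))
  · rw [hD.1.halfLogDetRatio_source hw, hD.1.covHatgY_eq_white hw hmean hY]
    exact iInf₂_le _ (hD.1.feasible hw hmean hY hD.2.1 hD.2.2.1)

theorem IsWhitening.channelCharacterization_eq (hw : IsWhitening P B Bp)
    (hmean : ∫ v, v ∂P = 0) (hY : (covY P).PosDef) :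
    channelCharacterization P Δ = feasibleRate P Bp Δ := by
  refine le_antisymm (le_iInf₂ fun J hJ => ?_)
    (le_iInf fun H => le_iInf fun QW => le_iInf₂ fun D hD => ?_)
  · have h := hJ.isChannelParam hw hmean hY
    rw [← hJ.channel_schur hw hmean hY, ← h.halfLogDetRatio_channel hw]
    exact iInf_le_of_le _ (iInf_le_of_le _ (iInf₂_le _ ⟨h, hJ.error_posSemidef, hJ.trace_le,
      hw.covHatgY_sub_posSemidef, h.noise_posSemidef⟩))
  · rw [hD.1.halfLogDetRatio_channel hw, hD.1.covHatgY_eq_white hw hmean hY]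
    exact iInf₂_le _ (hD.1.feasible hw hmean hY hD.2.1 hD.2.2.1)

end Optimality

end RemoteRDF

end

/-! ### The main theorem. -/

theorem theorem5 {nx ns ny : ℕ} (P : Measure (RemoteRDF.Src nx ns ny)) [IsGaussian P]
    (hmean : ∫ v, v ∂P = 0) (hY : (RemoteRDF.covY P).PosDef) (Δ : ℝ) (hΔ : 0 ≤ Δ) :
    -- every test channel of the stated form exists and has the structural properties
    (∀ (H : Matrix (Fin nx) (Fin ns) ℝ) (QW D : Matrix (Fin nx) (Fin nx) ℝ),
      RemoteRDF.IsChannelParam P H QW D →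
      (∃ (Ω : Type) (_ : MeasurableSpace Ω) (μ : ProbabilityMeasure Ω)
        (X : Ω → RemoteRDF.Vec nx) (S : Ω → RemoteRDF.Vec ns) (Y : Ω → RemoteRDF.Vec ny)
        (W : Ω → RemoteRDF.Vec nx),
        RemoteRDF.IsRealization P QW (μ : Measure Ω) X S Y W) ∧
      (∀ (Ω : Type*) [MeasurableSpace Ω] (μ : Measure Ω) [IsProbabilityMeasure μ]
        (X : Ω → RemoteRDF.Vec nx) (S : Ω → RemoteRDF.Vec ns) (Y : Ω → RemoteRDF.Vec ny)
        (W : Ω → RemoteRDF.Vec nx),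
        RemoteRDF.IsRealization P QW μ X S Y W →
        RemoteRDF.StructuralProperties P H QW D μ X S Y
          (RemoteRDF.chanZ H S W) (RemoteRDF.chanX P H S Y W))) ∧
    -- if any auxiliary variable is admissible, a test channel of this form achieves the rate
    ((∃ (ζ : Type) (_ : MeasurableSpace ζ)
        (ρ : ProbabilityMeasure (RemoteRDF.Src nx ns ny × ζ)), RemoteRDF.IsDecLaw P Δ ρ) →
      ∃ (H : Matrix (Fin nx) (Fin ns) ℝ) (QW D : Matrix (Fin nx) (Fin nx) ℝ),
        RemoteRDF.IsChannelParam P H QW D ∧ D.PosSemidef ∧ D.trace ≤ Δ ∧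
        RemoteRDF.halfLogDetRatio (RemoteRDF.covSgY P) (RemoteRDF.covSgHatY P H QW) =
          RemoteRDF.rdfDec P Δ ∧
        RemoteRDF.halfLogDetRatio (RemoteRDF.covHatgY P H QW) QW = RemoteRDF.rdfDec P Δ ∧
        ∀ (Ω : Type*) [MeasurableSpace Ω] (μ : Measure Ω) [IsProbabilityMeasure μ]
          (X : Ω → RemoteRDF.Vec nx) (S : Ω → RemoteRDF.Vec ns) (Y : Ω → RemoteRDF.Vec ny)
          (W : Ω → RemoteRDF.Vec nx),
          RemoteRDF.IsRealization P QW μ X S Y W →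
          RemoteRDF.DecAdmissible μ X S Y (RemoteRDF.chanZ H S W) (RemoteRDF.chanDec P H) Δ ∧
          RemoteRDF.EncAdmissible μ X S Y (RemoteRDF.chanX P H S Y W) Δ ∧
          RemoteRDF.condMutualInfo μ S (RemoteRDF.chanZ H S W) Y = RemoteRDF.rdfDec P Δ) ∧
    -- the two rate distortion functions coincide, and have the two characterizations
    RemoteRDF.rdfDec P Δ = RemoteRDF.rdfEnc P Δ ∧
    RemoteRDF.rdfDec P Δ = RemoteRDF.sourceCharacterization P Δ ∧
    RemoteRDF.rdfDec P Δ = RemoteRDF.channelCharacterization P Δ := by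
  obtain ⟨r, B, Bp, hw⟩ := RemoteRDF.exists_isWhitening (P := P) hmean hY
  have hdec := hw.rdfDec_eq hmean hY hΔ
  refine ⟨fun H QW D h => ⟨⟨_, _, ⟨P.prod (multivariateGaussian 0 QW), inferInstance⟩, _, _, _, _,
      RemoteRDF.isRealization_prod P QW⟩,
      fun Ω _ μ _ X S Y W hr => hr.structuralProperties h hmean hY⟩, ?_,
    hdec.trans (hw.rdfEnc_eq hmean hY hΔ).symm,
    hdec.trans (hw.sourceCharacterization_eq hmean hY).symm,
    hdec.trans (hw.channelCharacterization_eq hmean hY).symm⟩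
  rintro ⟨ζ, _, ρ, hρ⟩
  -- By the converse an admissible variable yields a feasible matrix, so the compact feasible set is
  -- nonempty and an optimal test channel exists.
  obtain ⟨J₀, hJ₀, -⟩ := hw.exists_feasible_of_dec hmean hY hΔ hρ
  obtain ⟨J, hJ, hrate⟩ := RemoteRDF.exists_feasible_eq_rate ⟨J₀, hJ₀⟩
  have h := hJ.isChannelParam hw hmean hY
  rw [← hJ.channel_schur hw hmean hY, ← hdec] at hrate
  have hsrc := (h.halfLogDetRatio_source hw).trans hrate
  exact ⟨_, _, _, h, hJ.error_posSemidef, hJ.trace_le, hsrc,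
    (h.halfLogDetRatio_channel hw).trans hrate, fun Ω _ μ _ X S Y W hr =>
    ⟨hr.decAdmissible h hmean hY hJ.trace_le, hr.encAdmissible h hmean hY hJ.trace_le,
      (hr.condMutualInfo_eq h hmean hY hr.measurable_chanZ
        (RemoteRDF.chanZ_ofLp P X Y)).trans hsrc⟩⟩
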